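/- For $n\ge 1$ let $B_n$ be the braid group on $n$ strands with standard generators $\sigma_1,\dots,\sigma_{n-1}$; for $m\le n$ an element of $B_m$ is regarded as an element of $B_n$ through $\sigma_i\mapsto\sigma_i$. For $1\le a,b\le n$ put $[a,b]=\sigma_a\sigma_{a+1}\cdots\sigma_{b-1}$ if $a<b$, $[a,b]=\sigma_{a-1}\sigma_{a-2}\cdots\sigma_b$ if $a>b$, and $[a,a]=1$. Let $\widehat\beta$ denote the oriented link in $\mathbb{R}^3$ (up to isotopy) that is the standard closure of the braid $\beta$. For $2\le r_1\le\dots\le r_k$ and $s_1,\dots,s_k\ge 1$, the T-link $T((r_1,s_1),\dots,(r_k,s_k))$ is the closure of the braid $[1,r_1]^{s_1}\cdots[1,r_k]^{s_k}\in B_{r_k}$; with a single pair this is the torus link $T(r_1,s_1)$. All parameters below are integers. (i) If $n\ge 2$ and $1\le d\le n$, then in $B_n$ $$[1,n]^d=[d,1]\,[1,n]\,[1,n-1]^{d-1}\quad\text{and}\quad [n,1]^d=[n-1,1]^{d-1}\,[n,1]\,[1,d].$$ (ii) If $1\le\rho\le m$, $x\ge 0$, $m+x\ge 2$ and $\gamma\in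 B_m$, then $$\widehat{\gamma\,[1,m+x]^{\rho}}=\widehat{\gamma\,[\rho,1]^x\,[1,m]^{\rho}}\quad\text{and}\quad \widehat{\gamma\,[m+x,1]^{\rho}}=\widehat{\gamma\,[m,1]^{\rho}\,[1,\rho]^x},$$ where in each equation the braid on the left lies in $B_{m+x}$ and the braid on the right lies in $B_m$. (iii) For $2\le\rho\le m\le n$ and $y\ge 1$, the link $T((m,y),(n,\rho))$ is the closure of the braid $[\rho,1]^{n-m}[1,m]^{\rho+y}\in B_m$. (iv) For $\rho,n\ge 2$ and $y\ge 1$, $T((2,y),(n,\rho))=T((2,y),(\rho,n))$. (v) If $2\le m<n$, $m\mid n$ and $y\ge 1$, then $T((m,y),(n,m))=T(m,n+y)$. -/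

import Mathlib

/-! ### Braid groups -/

/-- Indices of the standard generators `σ_1, …, σ_{n-1}` of the braid group on `n` strands. -/
abbrev BraidGen (n : ℕ) : Type := {i : ℕ // 1 ≤ i ∧ i < n}

/-- The Artin relators: `σ_i σ_{i+1} σ_i = σ_{i+1} σ_i σ_{i+1}`, and `σ_i σ_j = σ_j σ_i`
whenever `j ≥ i + 2`. -/
def artinRels (n : ℕ) : Set (FreeGroup (BraidGen n)) :=
  {r | ∃ i j : BraidGen n, i.1 + 1 = j.1 ∧
      r = FreeGroup.of i * FreeGroup.of j * FreeGroup.of i *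
        (FreeGroup.of j * FreeGroup.of i * FreeGroup.of j)⁻¹} ∪
  {r | ∃ i j : BraidGen n, i.1 + 2 ≤ j.1 ∧
      r = FreeGroup.of i * FreeGroup.of j * (FreeGroup.of j * FreeGroup.of i)⁻¹}

/-- The braid group `B_n`, by Artin's presentation. -/
abbrev BraidGroup (n : ℕ) : Type := PresentedGroup (artinRels n)

/-- The generator `σ_i` of `B_n`, for `1 ≤ i < n` (only such indices are ever used). -/
def sigma (n i : ℕ) : BraidGroup n :=
  if h : 1 ≤ i ∧ i < n then PresentedGroup.of ⟨i, h⟩ else 1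

/-- The braid `[a,b]` of `B_n`: it is `σ_a σ_{a+1} ⋯ σ_{b-1}` if `a < b`,
`σ_{a-1} σ_{a-2} ⋯ σ_b` if `a > b`, and `1` if `a = b`. -/
def bracket (n a b : ℕ) : BraidGroup n :=
  if a ≤ b then ((List.range' a (b - a)).map (sigma n)).prod
  else ((List.range' b (a - b)).reverse.map (sigma n)).prod

/-- The value of `σ_i ∈ B_m` under the inclusion in `B_n`. -/
def braidInclGen {m n : ℕ} (h : m ≤ n) (i : BraidGen m) : BraidGroup n :=
  PresentedGroup.of (⟨i.1, i.2.1, lt_of_lt_of_le i.2.2 h⟩ : BraidGen n)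

theorem braidIncl_rels {m n : ℕ} (h : m ≤ n) :
    ∀ r ∈ artinRels m, FreeGroup.lift (braidInclGen h) r = 1 := by
  rintro r (⟨i, j, hij, rfl⟩ | ⟨i, j, hij, rfl⟩)
  · have key := PresentedGroup.one_of_mem (rels := artinRels n) (Or.inl
      ⟨⟨i.1, i.2.1, lt_of_lt_of_le i.2.2 h⟩, ⟨j.1, j.2.1, lt_of_lt_of_le j.2.2 h⟩, hij, rfl⟩)
    simpa [braidInclGen, PresentedGroup.of] using key
  · have key := PresentedGroup.one_of_mem (rels := artinRels n) (Or.inr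
      ⟨⟨i.1, i.2.1, lt_of_lt_of_le i.2.2 h⟩, ⟨j.1, j.2.1, lt_of_lt_of_le j.2.2 h⟩, hij, rfl⟩)
    simpa [braidInclGen, PresentedGroup.of] using key

/-- The standard homomorphism `B_m → B_n`, `σ_i ↦ σ_i`, for `m ≤ n`: add `n - m` straight
strands on the right. -/
def braidIncl {m n : ℕ} (h : m ≤ n) : BraidGroup m →* BraidGroup n :=
  PresentedGroup.toGroup (braidIncl_rels h)

/-- A braid word on `n` strands; `(i, true)` stands for `σ_i`, `(i, false)` for `σ_i⁻¹`. -/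
abbrev BraidWord (n : ℕ) : Type := List (BraidGen n × Bool)

/-- The braid represented by a braid word. -/
def BraidWord.toBraid {n : ℕ} (w : BraidWord n) : BraidGroup n :=
  PresentedGroup.mk (artinRels n) (FreeGroup.mk w)

/-! ### Oriented polygonal links in `ℝ³` and their isotopy -/

/-- Points of three-space. -/
abbrev Pt : Type := Fin 3 → ℝ

/-- The point set covered by a set of directed edges `(tail, head)`. -/
def polySupport (E : Set (Pt × Pt)) : Set Pt := ⋃ e ∈ E, segment ℝ e.1 e.2

/-- A set of directed edges is an oriented polygonal link if it is finite, its edges are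
non-degenerate, every edge has exactly one successor and exactly one predecessor, and distinct
edges meet at most in common end points. That is: it is a finite disjoint union of oriented simple
closed polygons. -/
structure IsPolygonalLink (E : Set (Pt × Pt)) : Prop where
  finite : E.Finite
  ne : ∀ e ∈ E, e.1 ≠ e.2
  next : ∀ e ∈ E, ∃! f, f ∈ E ∧ f.1 = e.2
  prev : ∀ e ∈ E, ∃! f, f ∈ E ∧ f.2 = e.1
  inter : ∀ e ∈ E, ∀ f ∈ E, e ≠ f →
    segment ℝ e.1 e.2 ∩ segment ℝ f.1 f.2 ⊆ {e.1, e.2} ∩ {f.1, f.2}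

/-- The elementary (triangle) move on oriented polygonal links: the edge `ab` is replaced by the
two edges `ac`, `cb`, where the triangle `abc` meets the link in the edge `ab` only. The case where
`c` lies on the edge `ab` is the subdivision of that edge. -/
def TriangleMove (E F : Set (Pt × Pt)) : Prop :=
  IsPolygonalLink E ∧ IsPolygonalLink F ∧
  ∃ a b c : Pt, (a, b) ∈ E ∧
    convexHull ℝ {a, b, c} ∩ polySupport E = segment ℝ a b ∧
    F = (E \ {(a, b)}) ∪ {(a, c), (c, b)}

/-- Two oriented polygonal links are the same link (are isotopic) if a finite sequence of
triangle moves and inverse triangle moves leads from one to the other. -/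
def PolyIsotopic (E F : Set (Pt × Pt)) : Prop :=
  IsPolygonalLink E ∧ IsPolygonalLink F ∧ Relation.EqvGen TriangleMove E F

/-! ### Closed braids -/

/-- The point with coordinates `x`, `y`, `z`. -/
def pt (x y z : ℝ) : Pt := ![x, y, z]

/-- The point where the strand in position `k` passes between the `j`-th and the `(j+1)`-st letter
of a braid word. The braid runs in the direction of increasing `x`, and the positions
`k = 1, …, n` are the lines `y = -k` of the plane `z = 0`, from left to right. -/
def gridPt (j k : ℕ) : Pt := pt j (-k) 0

/-- The top of the bridge over the crossing of positions `i`, `i + 1` in the `j`-th slab. -/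
noncomputable def bridgePt (j i : ℕ) : Pt := pt (j + 1 / 2) (-(i + 1 / 2)) 1

/-- The edges in the slab `j ≤ x ≤ j + 1`, which holds the letter `σ_i` (`positive = true`) or
`σ_i⁻¹` (`positive = false`) of a braid word on `n` strands. The strands in positions `i` and `i + 1`
are interchanged: for `σ_i` the strand that leaves position `i` is the upper one (seen from large
`z`, this is a positive crossing), for `σ_i⁻¹` it is the lower one. All others go straight. -/
def letterEdges (n j i : ℕ) (positive : Bool) : Set (Pt × Pt) :=
  {e | ∃ k : ℕ, 1 ≤ k ∧ k ≤ n ∧ k ≠ i ∧ k ≠ i + 1 ∧ e = (gridPt j k, gridPt (j + 1) k)} ∪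
  (if positive then
    {(gridPt j i, bridgePt j i), (bridgePt j i, gridPt (j + 1) (i + 1)),
      (gridPt j (i + 1), gridPt (j + 1) i)}
  else
    {(gridPt j i, gridPt (j + 1) (i + 1)),
      (gridPt j (i + 1), bridgePt j i), (bridgePt j i, gridPt (j + 1) i)})

/-- The closing arcs of a braid word of length `l` on `n` strands. The `k`-th arc joins the end of
position `k` to its beginning, behind the braid and inside the vertical plane `y = -k`, so that the
`n` arcs are parallel and the closed braid winds around an axis parallel to the `y`-axis. -/
def closingEdges (n l : ℕ) : Set (Pt × Pt) :=
  {e | ∃ k : ℕ, 1 ≤ k ∧ k ≤ n ∧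
    (e = (gridPt l k, pt (l + 1) (-k) (-1)) ∨
      e = (pt (l + 1) (-k) (-1), pt (-1) (-k) (-1)) ∨
      e = (pt (-1) (-k) (-1), gridPt 0 k))}

/-- The standard closure of a braid word, as an oriented polygonal link. -/
def closedBraid {n : ℕ} (w : BraidWord n) : Set (Pt × Pt) :=
  {e | ∃ (j : ℕ) (hj : j < w.length), e ∈ letterEdges n j (w[j].1 : ℕ) w[j].2} ∪
    closingEdges n w.length

/-- The braids `β ∈ B_m` and `β' ∈ B_n` have the same closure: the closures of any braid words that
represent them are the same oriented link. -/
def SameClosure {m n : ℕ} (β : BraidGroup m) (β' : BraidGroup n) : Prop :=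
  ∀ (w : BraidWord m) (w' : BraidWord n), w.toBraid = β → w'.toBraid = β' →
    PolyIsotopic (closedBraid w) (closedBraid w')

/-! ### T-links -/

/-- The number of strands `r_k` of the T-link `T((r_1,s_1), …, (r_k,s_k))`,
where `r_1 ≤ ⋯ ≤ r_k`. -/
def tStrands (l : List (ℕ × ℕ)) : ℕ := (l.getLastD (1, 0)).1

/-- The braid `[1,r_1]^{s_1} ⋯ [1,r_k]^{s_k}` in `B_{r_k}`, whose closure is the T-link
`T((r_1,s_1), …, (r_k,s_k))`. For one pair, this is the torus link `T(r_1,s_1)`. -/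
def tBraid (l : List (ℕ × ℕ)) : BraidGroup (tStrands l) :=
  (l.map fun p => bracket (tStrands l) 1 p.1 ^ p.2).prod

/-! ### Triangle moves on polygonal links -/

namespace IsPolygonalLink

variable {E : Set (Pt × Pt)}

/-! The proof has a topological and an algebraic half. The topological half is the easy direction of
Markov's theorem for polygonal closures: two words for the same braid have isotopic closures,
conjugation does not change the closure (`sameClosure_conj`), and neither does passing from `β` on
`m` strands to `β σ_m` on `m + 1` strands (`sameClosure_stab`).

Nearly all isotopies come from one principle, `isotopic_of_convex`: on a convex set of vertex
positions, all of which give simple disjoint polygons, the isotopy class is locally constant, since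
a small motion of the vertices is a sequence of triangle moves. Closed braids are placed in an open
book. If, between any two consecutive pages, each pair of strands is separated in two configurations
by a common linear functional, then the straight-line interpolation stays embedded
(`isotopic_cfgEdges`). Cancellation of inverse letters and the Artin relations follow because both
sides can be pulled apart into the same layers (`isotopic_of_layered`). In a conjugate, the two
extra letters are undone together across the closing arcs. Stabilization is undone by removing
explicit vertices of the added strand.

The algebraic half starts from the fact that conjugation by `[1,k]` shifts the generators. This
gives the formula for `[1,n]^d` by induction on `d` (`bracket_pow`); reversing words gives the
formula for `[n,1]^d`. By that formula `[1,m+1]^ρ` can be written with `σ_m` occurring only once, so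
after a cyclic permutation the last strand can be removed, at the price of a factor `[ρ,1]`;
iterating this reduces `m + x` strands to `m`. The first statement on T-links is the case `γ =
[1,m]^y`.

The other two use the full twist, `[k,1]^k = [1,k]^k` (`bracket_pow_self`). If `m` divides `n`, it
turns `[m,1]^{n-m}` into `[1,m]^{n-m}`. For `T((2,y),(n,ρ))` with `ρ ≤ n` it gives the closure of
`[1,2]^y [ρ,1]^n`, and a braid built from the half twist commutes with `σ_1` and conjugates `[ρ,1]`
to `[1,ρ]` (`exists_semiconj`). -/

theorem eq_of_fst (h : IsPolygonalLink E) {e f : Pt × Pt} (he : e ∈ E) (hf : f ∈ E)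
    (hef : e.1 = f.1) : e = f := by
  obtain ⟨g, ⟨hg, hge⟩, -⟩ := h.prev e he
  obtain ⟨k, -, hk⟩ := h.next g hg
  rw [hk e ⟨he, hge.symm⟩, hk f ⟨hf, by rw [← hef, hge]⟩]

theorem eq_of_snd (h : IsPolygonalLink E) {e f : Pt × Pt} (he : e ∈ E) (hf : f ∈ E)
    (hef : e.2 = f.2) : e = f := by
  obtain ⟨g, ⟨hg, hge⟩, -⟩ := h.next e he
  obtain ⟨k, -, hk⟩ := h.prev g hg
  rw [hk e ⟨he, hge.symm⟩, hk f ⟨hf, by rw [← hef, hge]⟩]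

theorem of_inj (finite : E.Finite) (ne : ∀ e ∈ E, e.1 ≠ e.2)
    (next : ∀ e ∈ E, ∃ f ∈ E, f.1 = e.2) (prev : ∀ e ∈ E, ∃ f ∈ E, f.2 = e.1)
    (fst : ∀ e ∈ E, ∀ f ∈ E, e.1 = f.1 → e = f) (snd : ∀ e ∈ E, ∀ f ∈ E, e.2 = f.2 → e = f)
    (inter : ∀ e ∈ E, ∀ f ∈ E, e ≠ f → ∀ z ∈ segment ℝ e.1 e.2, z ∈ segment ℝ f.1 f.2 →
      (z = e.1 ∨ z = e.2) ∧ (z = f.1 ∨ z = f.2)) : IsPolygonalLink E where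
  finite := finite
  ne := ne
  next e he := by
    obtain ⟨f, hf, hfe⟩ := next e he
    exact ⟨f, ⟨hf, hfe⟩, fun g hg => fst g hg.1 f hf (hg.2.trans hfe.symm)⟩
  prev e he := by
    obtain ⟨f, hf, hfe⟩ := prev e he
    exact ⟨f, ⟨hf, hfe⟩, fun g hg => snd g hg.1 f hf (hg.2.trans hfe.symm)⟩
  inter e he f hf hef z hz := by
    have := inter e he f hf hef z hz.1 hz.2
    simpa using this

theorem mem_ends (h : IsPolygonalLink E) {e f : Pt × Pt} (he : e ∈ E) (hf : f ∈ E) (hef : e ≠ f)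
    {z : Pt} (hz : z ∈ segment ℝ e.1 e.2) (hz' : z ∈ segment ℝ f.1 f.2) :
    (z = e.1 ∨ z = e.2) ∧ (z = f.1 ∨ z = f.2) := by
  simpa using h.inter e he f hf hef ⟨hz, hz'⟩

end IsPolygonalLink

theorem mem_polySupport {E : Set (Pt × Pt)} {z : Pt} :
    z ∈ polySupport E ↔ ∃ e ∈ E, z ∈ segment ℝ e.1 e.2 := by
  simp [polySupport]

theorem segment_subset_triangle_left (a b c : Pt) : segment ℝ a c ⊆ convexHull ℝ {a, b, c} :=
  segment_subset_convexHull (by simp) (by simp)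

theorem segment_subset_triangle_right (a b c : Pt) : segment ℝ c b ⊆ convexHull ℝ {a, b, c} :=
  segment_subset_convexHull (by simp) (by simp)

theorem segment_subset_triangle_base (a b c : Pt) : segment ℝ a b ⊆ convexHull ℝ {a, b, c} :=
  segment_subset_convexHull (by simp) (by simp)

namespace PolyIsotopic

theorem refl {E : Set (Pt × Pt)} (h : IsPolygonalLink E) : PolyIsotopic E E :=
  ⟨h, h, Relation.EqvGen.refl E⟩

theorem symm {E F : Set (Pt × Pt)} (h : PolyIsotopic E F) : PolyIsotopic F E :=
  ⟨h.2.1, h.1, h.2.2.symm⟩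

theorem trans {E F G : Set (Pt × Pt)} (h : PolyIsotopic E F) (h' : PolyIsotopic F G) :
    PolyIsotopic E G :=
  ⟨h.1, h'.2.1, h.2.2.trans _ _ _ h'.2.2⟩

theorem of_move {E F : Set (Pt × Pt)} (h : TriangleMove E F) : PolyIsotopic E F :=
  ⟨h.1, h.2.1, Relation.EqvGen.rel _ _ h⟩

end PolyIsotopic

/-- A vertex may be inserted in an edge if the triangle it spans meets the link in that edge
only. -/
theorem insertVertex {E : Set (Pt × Pt)} {a b c : Pt} (hE : IsPolygonalLink E) (hab : (a, b) ∈ E)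
    (hull : ∀ f ∈ E, f ≠ (a, b) → ∀ z ∈ convexHull ℝ {a, b, c}, z ∈ segment ℝ f.1 f.2 →
      z ∈ segment ℝ a b)
    (hac : segment ℝ a c ∩ segment ℝ c b ⊆ {c}) (hca : c ≠ a) (hcb : c ≠ b) :
    PolyIsotopic E ((E \ {(a, b)}) ∪ {(a, c), (c, b)}) := by
  -- Distinct edges meet only in common end points, so every other edge can touch the triangle only
  -- in `a` or `b`.
  have key : ∀ f ∈ E, f ≠ (a, b) → ∀ z ∈ convexHull ℝ {a, b, c}, z ∈ segment ℝ f.1 f.2 →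
      (z = a ∨ z = b) ∧ (z = f.1 ∨ z = f.2) := fun f hf hne z hz hzf =>
    hE.mem_ends hab hf hne.symm (hull f hf hne z hz hzf) hzf
  have hcm : c ∈ convexHull ℝ {a, b, c} := subset_convexHull _ _ (by simp)
  have hc1 : ∀ e ∈ E, e.1 ≠ c := by
    rintro e he rfl
    by_cases h : e = (a, b)
    · subst h; exact hca rfl
    · rcases (key e he h _ hcm (left_mem_segment _ _ _)).1 with h | h
      exacts [hca h, hcb h]
  have hc2 : ∀ e ∈ E, e.2 ≠ c := by
    rintro e he rfl
    by_cases h : e = (a, b)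
    · subst h; exact hcb rfl
    · rcases (key e he h _ hcm (right_mem_segment _ _ _)).1 with h | h
      exacts [hca h, hcb h]
  have hl := segment_subset_triangle_left a b c
  have hr := segment_subset_triangle_right a b c
  have hb : b ∉ segment ℝ a c := fun h => hcb (hac ⟨h, right_mem_segment _ _ _⟩).symm
  have ha : a ∉ segment ℝ c b := fun h => hca (hac ⟨left_mem_segment _ _ _, h⟩).symm
  have hF : IsPolygonalLink ((E \ {(a, b)}) ∪ {(a, c), (c, b)}) := by
    refine IsPolygonalLink.of_inj ?_ ?_ ?_ ?_ ?_ ?_ ?_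
    · exact (hE.finite.subset Set.sdiff_subset).union (by simp)
    · rintro e (⟨he, -⟩ | rfl | rfl)
      exacts [hE.ne e he, hca.symm, hcb]
    · rintro e (⟨he, -⟩ | rfl | rfl)
      · obtain ⟨f, ⟨hf, hfe⟩, -⟩ := hE.next e he
        by_cases h : f = (a, b)
        · subst h; exact ⟨(a, c), by simp, hfe⟩
        · exact ⟨f, Or.inl ⟨hf, h⟩, hfe⟩
      · exact ⟨(c, b), by simp, rfl⟩
      · obtain ⟨f, ⟨hf, hfe⟩, -⟩ := hE.next _ hab
        by_cases h : f = (a, b)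
        · subst h; exact ⟨(a, c), by simp, hfe⟩
        · exact ⟨f, Or.inl ⟨hf, h⟩, hfe⟩
    · rintro e (⟨he, -⟩ | rfl | rfl)
      · obtain ⟨f, ⟨hf, hfe⟩, -⟩ := hE.prev e he
        by_cases h : f = (a, b)
        · subst h; exact ⟨(c, b), by simp, hfe⟩
        · exact ⟨f, Or.inl ⟨hf, h⟩, hfe⟩
      · obtain ⟨f, ⟨hf, hfe⟩, -⟩ := hE.prev _ hab
        by_cases h : f = (a, b)
        · subst h; exact ⟨(c, b), by simp, hfe⟩
        · exact ⟨f, Or.inl ⟨hf, h⟩, hfe⟩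
      · exact ⟨(a, c), by simp, rfl⟩
    · rintro e (⟨he, hne⟩ | rfl | rfl) f (⟨hf, hnf⟩ | rfl | rfl) hef
      · exact hE.eq_of_fst he hf hef
      · exact absurd (hE.eq_of_fst he hab hef) hne
      · exact absurd hef (hc1 e he)
      · exact absurd (hE.eq_of_fst hab hf hef).symm hnf
      · rfl
      · exact absurd hef hca.symm
      · exact absurd hef.symm (hc1 f hf)
      · exact absurd hef hca
      · rfl
    · rintro e (⟨he, hne⟩ | rfl | rfl) f (⟨hf, hnf⟩ | rfl | rfl) hef
      · exact hE.eq_of_snd he hf hef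
      · exact absurd hef (hc2 e he)
      · exact absurd (hE.eq_of_snd he hab hef) hne
      · exact absurd hef.symm (hc2 f hf)
      · rfl
      · exact absurd hef hcb
      · exact absurd (hE.eq_of_snd hab hf hef).symm hnf
      · exact absurd hef hcb.symm
      · rfl
    · have k1 : ∀ f ∈ E, f ≠ (a, b) → ∀ z ∈ segment ℝ a c, z ∈ segment ℝ f.1 f.2 →
          (z = a ∨ z = c) ∧ (z = f.1 ∨ z = f.2) := by
        intro f hf hne z hz hzf
        obtain ⟨h1 | h1, h2⟩ := key f hf hne z (hl hz) hzf
        · exact ⟨Or.inl h1, h2⟩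
        · exact absurd (h1 ▸ hz) hb
      have k2 : ∀ f ∈ E, f ≠ (a, b) → ∀ z ∈ segment ℝ c b, z ∈ segment ℝ f.1 f.2 →
          (z = c ∨ z = b) ∧ (z = f.1 ∨ z = f.2) := by
        intro f hf hne z hz hzf
        obtain ⟨h1 | h1, h2⟩ := key f hf hne z (hr hz) hzf
        · exact absurd (h1 ▸ hz) ha
        · exact ⟨Or.inr h1, h2⟩
      rintro e (⟨he, hne⟩ | rfl | rfl) f (⟨hf, hnf⟩ | rfl | rfl) hef z hze hzf
      · exact hE.mem_ends he hf hef hze hzf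
      · exact (k1 e he hne z hzf hze).symm
      · exact (k2 e he hne z hzf hze).symm
      · exact k1 f hf hnf z hze hzf
      · exact absurd rfl hef
      · have : z = c := hac ⟨hze, hzf⟩
        exact ⟨Or.inr this, Or.inl this⟩
      · exact k2 f hf hnf z hze hzf
      · have : z = c := hac ⟨hzf, hze⟩
        exact ⟨Or.inl this, Or.inr this⟩
      · exact absurd rfl hef
  refine PolyIsotopic.of_move ⟨hE, hF, a, b, c, hab, ?_, rfl⟩
  apply Set.Subset.antisymm
  · rintro z ⟨hz, hzE⟩
    obtain ⟨f, hf, hzf⟩ := mem_polySupport.1 hzE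
    by_cases h : f = (a, b)
    · subst h; exact hzf
    · exact hull f hf h z hz hzf
  · exact fun z hz => ⟨segment_subset_triangle_base a b c hz, mem_polySupport.2 ⟨_, hab, hz⟩⟩

/-- A vertex may be removed if the triangle it spans with its neighbours meets the link in the two
edges at that vertex only. -/
theorem removeVertex {E : Set (Pt × Pt)} {a b c : Pt} (hE : IsPolygonalLink E) (hac : (a, c) ∈ E)
    (hcb : (c, b) ∈ E)
    (hull : ∀ f ∈ E, f ≠ (a, c) → f ≠ (c, b) → ∀ z ∈ convexHull ℝ {a, b, c},
      z ∈ segment ℝ f.1 f.2 → z ∈ segment ℝ a c ∨ z ∈ segment ℝ c b) :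
    PolyIsotopic E ((E \ {(a, c), (c, b)}) ∪ {(a, b)}) := by
  have hne1 : a ≠ c := hE.ne _ hac
  have hne2 : c ≠ b := hE.ne _ hcb
  have hne12 : ((a, c) : Pt × Pt) ≠ (c, b) := fun h => hne1 (congrArg Prod.fst h)
  -- If `a = b`, the two edges would share their midpoint, which is not an end point.
  have habc : a ≠ b := by
    rintro rfl
    have := hE.mem_ends hac hcb hne12 (z := midpoint ℝ a c) (midpoint_mem_segment _ _)
      (by rw [midpoint_comm]; exact midpoint_mem_segment _ _)
    rcases this.1 with h | h
    · exact hne1 ((midpoint_eq_left_iff ℝ).1 h)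
    · exact hne1 ((midpoint_eq_right_iff ℝ).1 h)
  have key : ∀ f ∈ E, f ≠ (a, c) → f ≠ (c, b) → ∀ z ∈ convexHull ℝ {a, b, c},
      z ∈ segment ℝ f.1 f.2 → (z = a ∨ z = b) ∧ (z = f.1 ∨ z = f.2) := by
    intro f hf h1 h2 z hz hzf
    -- Only the two given edges have `c` as an end point.
    have hc : ¬ (z = c ∧ (z = f.1 ∨ z = f.2)) := by
      rintro ⟨rfl, h | h⟩
      · exact h2 (hE.eq_of_fst hf hcb h.symm)
      · exact h1 (hE.eq_of_snd hf hac h.symm)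
    rcases hull f hf h1 h2 z hz hzf with h | h
    · obtain ⟨h3, h4⟩ := hE.mem_ends hac hf h1.symm h hzf
      rcases h3 with h3 | h3
      · exact ⟨Or.inl h3, h4⟩
      · exact absurd ⟨h3, h4⟩ hc
    · obtain ⟨h3, h4⟩ := hE.mem_ends hcb hf h2.symm h hzf
      rcases h3 with h3 | h3
      · exact absurd ⟨h3, h4⟩ hc
      · exact ⟨Or.inr h3, h4⟩
  have hbase := segment_subset_triangle_base a b c
  have hF : IsPolygonalLink ((E \ {(a, c), (c, b)}) ∪ {(a, b)}) := by
    refine IsPolygonalLink.of_inj ?_ ?_ ?_ ?_ ?_ ?_ ?_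
    · exact (hE.finite.subset Set.sdiff_subset).union (by simp)
    · rintro e (⟨he, -⟩ | rfl)
      exacts [hE.ne e he, habc]
    · have : ∀ e ∈ E, e.2 ≠ c → ∃ f ∈ (E \ {(a, c), (c, b)}) ∪ {(a, b)}, f.1 = e.2 := by
        intro e he hec
        obtain ⟨f, ⟨hf, hfe⟩, -⟩ := hE.next e he
        by_cases h : f = (a, c)
        · subst h; exact ⟨(a, b), by simp, hfe⟩
        · refine ⟨f, Or.inl ⟨hf, ?_⟩, hfe⟩
          rintro (h' | rfl)
          exacts [h h', hec hfe.symm]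
      rintro e (⟨he, hn⟩ | rfl)
      · exact this e he fun h => hn (Or.inl (hE.eq_of_snd he hac h))
      · exact this (c, b) hcb hne2.symm
    · have : ∀ e ∈ E, e.1 ≠ c → ∃ f ∈ (E \ {(a, c), (c, b)}) ∪ {(a, b)}, f.2 = e.1 := by
        intro e he hec
        obtain ⟨f, ⟨hf, hfe⟩, -⟩ := hE.prev e he
        by_cases h : f = (c, b)
        · subst h; exact ⟨(a, b), by simp, hfe⟩
        · refine ⟨f, Or.inl ⟨hf, ?_⟩, hfe⟩
          rintro (rfl | h')
          exacts [hec hfe.symm, h h']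
      rintro e (⟨he, hn⟩ | rfl)
      · exact this e he fun h => hn (Or.inr (hE.eq_of_fst he hcb h))
      · exact this (a, c) hac hne1
    · rintro e (⟨he, hne⟩ | rfl) f (⟨hf, hnf⟩ | rfl) hef
      · exact hE.eq_of_fst he hf hef
      · exact absurd (Or.inl (hE.eq_of_fst he hac hef)) hne
      · exact absurd (Or.inl (hE.eq_of_fst hf hac hef.symm)) hnf
      · rfl
    · rintro e (⟨he, hne⟩ | rfl) f (⟨hf, hnf⟩ | rfl) hef
      · exact hE.eq_of_snd he hf hef
      · exact absurd (Or.inr (hE.eq_of_snd he hcb hef)) hne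
      · exact absurd (Or.inr (hE.eq_of_snd hf hcb hef.symm)) hnf
      · rfl
    · rintro e (⟨he, hne⟩ | rfl) f (⟨hf, hnf⟩ | rfl) hef z hze hzf
      · exact hE.mem_ends he hf hef hze hzf
      · exact (key e he (fun h => hne (Or.inl h)) (fun h => hne (Or.inr h)) z (hbase hzf) hze).symm
      · exact key f hf (fun h => hnf (Or.inl h)) (fun h => hnf (Or.inr h)) z (hbase hze) hzf
      · exact absurd rfl hef
  -- Since `(a, b)` is a new edge, replacing it by the two old ones gives back exactly `E`; the
  -- removal is the inverse of that triangle move.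
  have hab : (a, b) ∉ E := fun h => hne2 (congrArg Prod.snd (hE.eq_of_fst hac h rfl))
  refine (PolyIsotopic.of_move ⟨hF, hE, a, b, c, by simp, ?_, ?_⟩).symm
  · apply Set.Subset.antisymm
    · rintro z ⟨hz, hzE⟩
      obtain ⟨f, (⟨hf, hnf⟩ | rfl), hzf⟩ := mem_polySupport.1 hzE
      · rcases (key f hf (fun h => hnf (Or.inl h)) (fun h => hnf (Or.inr h)) z hz hzf).1 with
          rfl | rfl
        exacts [left_mem_segment _ _ _, right_mem_segment _ _ _]
      · exact hzf
    · exact fun z hz => ⟨hbase hz, mem_polySupport.2 ⟨(a, b), by simp, hz⟩⟩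
  · ext e
    simp only [Set.mem_union, Set.mem_sdiff, Set.mem_insert_iff, Set.mem_singleton_iff, not_or]
    constructor
    · intro he
      by_cases h1 : e = (a, c)
      · exact Or.inr (Or.inl h1)
      by_cases h2 : e = (c, b)
      · exact Or.inr (Or.inr h2)
      exact Or.inl ⟨Or.inl ⟨he, h1, h2⟩, fun h => hab (h ▸ he)⟩
    · rintro (⟨⟨h, -⟩ | h, h'⟩ | rfl | rfl)
      exacts [h, absurd h h', hac, hcb]

/-- The edges that remain when the vertices in `M` are removed from a link. -/
def mergeEdges (M : Set Pt) (E : Set (Pt × Pt)) : Set (Pt × Pt) :=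
  {e | e ∈ E ∧ e.1 ∉ M ∧ e.2 ∉ M} ∪ {e | ∃ m ∈ M, (e.1, m) ∈ E ∧ (m, e.2) ∈ E}

theorem mem_segment_or_mem_segment {a m b z : Pt} (hm : m ∈ segment ℝ a b)
    (hz : z ∈ segment ℝ a b) : z ∈ segment ℝ a m ∨ z ∈ segment ℝ m b := by
  rw [segment_eq_image_lineMap] at hm hz
  obtain ⟨t, ⟨ht0, ht1⟩, rfl⟩ := hm
  obtain ⟨s, ⟨hs0, hs1⟩, rfl⟩ := hz
  rcases le_total s t with h | h
  · left
    rcases ht0.eq_or_lt with h0 | h0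
    · have : s = 0 := le_antisymm (h.trans h0.symm.le) hs0
      simp [this, left_mem_segment]
    · refine ⟨1 - s / t, s / t, by rw [sub_nonneg, div_le_one h0]; exact h, by positivity,
        by ring, ?_⟩
      ext i
      simp [AffineMap.lineMap_apply]
      field_simp
      ring
  · right
    rcases ht1.eq_or_lt with h0 | h0
    · have : s = 1 := le_antisymm hs1 (h0 ▸ h)
      simp [this, right_mem_segment]
    · have h1 : 0 < 1 - t := by linarith
      refine ⟨(1 - s) / (1 - t), (s - t) / (1 - t), div_nonneg (by linarith) h1.le,
        div_nonneg (by linarith) h1.le, by field_simp; ring, ?_⟩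
      ext i
      simp [AffineMap.lineMap_apply]
      field_simp
      ring

/-- Vertices at which a link goes straight may be removed. -/
theorem isotopic_mergeEdges {E : Set (Pt × Pt)} (hE : IsPolygonalLink E) {M : Set Pt}
    (hM : ∀ a m b, m ∈ M → (a, m) ∈ E → (m, b) ∈ E → m ∈ segment ℝ a b ∧ a ∉ M ∧ b ∉ M) :
    PolyIsotopic E (mergeEdges M E) := by
  -- Only vertices of the link matter, so `M` may be replaced by a finite set, whose points are
  -- removed one at a time. The neighbours of a removed vertex are never removed, so its two edges
  -- survive until its turn comes.
  set S : Set Pt := M ∩ Prod.fst '' E with hS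
  have hfin : S.Finite := (hE.finite.image _).subset Set.inter_subset_right
  have hsnd : ∀ e ∈ E, e.2 ∈ Prod.fst '' E := fun e he => by
    obtain ⟨f, ⟨hf, hfe⟩, -⟩ := hE.next e he
    exact ⟨f, hf, hfe⟩
  have hMS : mergeEdges M E = mergeEdges S E := by
    ext e
    simp only [mergeEdges, Set.mem_union, Set.mem_ofPred_eq, hS, Set.mem_inter_iff, not_and]
    constructor
    · rintro (⟨h1, h2, h3⟩ | ⟨m, hm, h1, h2⟩)
      · exact Or.inl ⟨h1, fun h => absurd h h2, fun h => absurd h h3⟩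
      · exact Or.inr ⟨m, ⟨hm, _, h2, rfl⟩, h1, h2⟩
    · rintro (⟨h1, h2, h3⟩ | ⟨m, hm, h1, h2⟩)
      · exact Or.inl ⟨h1, fun h => h2 h ⟨e, h1, rfl⟩, fun h => h3 h (hsnd e h1)⟩
      · exact Or.inr ⟨m, hm.1, h1, h2⟩
  rw [hMS]
  have hS' : ∀ a m b, m ∈ S → (a, m) ∈ E → (m, b) ∈ E → m ∈ segment ℝ a b ∧ a ∉ S ∧ b ∉ S :=
    fun a m b hm h1 h2 => ⟨(hM a m b hm.1 h1 h2).1, fun h => (hM a m b hm.1 h1 h2).2.1 h.1,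
      fun h => (hM a m b hm.1 h1 h2).2.2 h.1⟩
  have hSE : S ⊆ Prod.fst '' E := Set.inter_subset_right
  clear_value S
  clear hMS hM hS
  induction S, hfin using Set.Finite.induction_on with
  | empty =>
    have : mergeEdges ∅ E = E := by ext; simp [mergeEdges]
    rw [this]
    exact PolyIsotopic.refl hE
  | @insert m S hmS hfin ih =>
    have ih := ih (fun a m' b hm' h1 h2 => by
      obtain ⟨h3, h4, h5⟩ := hS' a m' b (Or.inr hm') h1 h2
      exact ⟨h3, fun h => h4 (Or.inr h), fun h => h5 (Or.inr h)⟩)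
      (fun x hx => hSE (Or.inr hx))
    obtain ⟨⟨m', b⟩, hmb, hm1⟩ := hSE (Set.mem_insert m S)
    obtain rfl : m' = m := hm1
    obtain ⟨⟨a, m''⟩, ⟨ham, hm2⟩, -⟩ := hE.prev _ hmb
    obtain rfl : m'' = m' := hm2
    rename' m'' => m
    obtain ⟨hseg, ha, hb⟩ := hS' a m b (Set.mem_insert m S) ham hmb
    simp only [Set.mem_insert_iff, not_or] at ha hb
    have h1 : (a, m) ∈ mergeEdges S E := Or.inl ⟨ham, ha.2, hmS⟩
    have h2 : (m, b) ∈ mergeEdges S E := Or.inl ⟨hmb, hmS, hb.2⟩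
    -- The triangle degenerates to the segment `ab`, which is covered by the two edges at `m`, so no
    -- other edge causes trouble.
    have hrem := removeVertex ih.2.1 h1 h2 (fun f hf _ _ z hz hzf => by
      refine mem_segment_or_mem_segment hseg ?_
      have : convexHull ℝ {a, b, m} ⊆ segment ℝ a b :=
        convexHull_min (by
          rintro x (rfl | rfl | rfl)
          exacts [left_mem_segment _ _ _, right_mem_segment _ _ _, hseg]) (convex_segment _ _)
      exact this hz)
    have heq : mergeEdges S E \ {(a, m), (m, b)} ∪ {(a, b)} = mergeEdges (insert m S) E := by
      ext ⟨x, y⟩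
      simp only [mergeEdges, Set.mem_union, Set.mem_sdiff, Set.mem_ofPred_eq, Set.mem_insert_iff,
        Set.mem_singleton_iff, Prod.mk.injEq, not_or]
      constructor
      · rintro (⟨⟨k1, k2, k3⟩ | ⟨m', hm', k1, k2⟩, k4, k5⟩ | ⟨rfl, rfl⟩)
        · refine Or.inl ⟨k1, ⟨?_, k2⟩, ⟨?_, k3⟩⟩
          · rintro rfl
            exact k5 ⟨rfl, congrArg Prod.snd (hE.eq_of_fst k1 hmb rfl)⟩
          · rintro rfl
            exact k4 ⟨congrArg Prod.fst (hE.eq_of_snd k1 ham rfl), rfl⟩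
        · exact Or.inr ⟨m', Or.inr hm', k1, k2⟩
        · exact Or.inr ⟨m, Or.inl rfl, ham, hmb⟩
      · rintro (⟨k1, ⟨k2, k3⟩, ⟨k4, k5⟩⟩ | ⟨m', rfl | hm', k1, k2⟩)
        · exact Or.inl ⟨Or.inl ⟨k1, k3, k5⟩, fun h => k4 h.2, fun h => k2 h.1⟩
        · exact Or.inr ⟨congrArg Prod.fst (hE.eq_of_snd k1 ham rfl),
            congrArg Prod.snd (hE.eq_of_fst k2 hmb rfl)⟩
        · refine Or.inl ⟨Or.inr ⟨m', hm', k1, k2⟩, ?_, ?_⟩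
          · rintro ⟨rfl, rfl⟩
            exact (hS' _ _ _ (Or.inr hm') k1 k2).2.2 (Or.inl rfl)
          · rintro ⟨rfl, rfl⟩
            exact (hS' _ _ _ (Or.inr hm') k1 k2).2.1 (Or.inl rfl)
    rw [heq] at hrem
    exact ih.trans hrem

/-! ### Polygonal links with labelled vertices and their deformations -/

section Scheme

variable {V : Type*} (nx : Equiv.Perm V)

/-- The edges of the polygons with vertices `p v`, where `nx v` is the successor of `v`. -/
def schemeEdges (p : V → Pt) : Set (Pt × Pt) := Set.range fun v => (p v, p (nx v))

/-- The polygons with vertices `p v` are simple and disjoint. -/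
structure GoodScheme (p : V → Pt) : Prop where
  ne : ∀ v, p v ≠ p (nx v)
  inter : ∀ v w, v ≠ w → ∀ z ∈ segment ℝ (p v) (p (nx v)), z ∈ segment ℝ (p w) (p (nx w)) →
    (w = nx v ∧ z = p w) ∨ (v = nx w ∧ z = p v)

variable {nx}

theorem GoodScheme.injective {p : V → Pt} (h : GoodScheme nx p) : Function.Injective p := by
  intro v w hvw
  by_contra hne
  rcases h.inter v w hne (p v) (left_mem_segment _ _ _) (hvw ▸ left_mem_segment _ _ _) with h1 | h1
  · exact h.ne v (by rw [← h1.1, hvw])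
  · exact h.ne w (by rw [← h1.1, hvw])

theorem GoodScheme.isPolygonalLink [Finite V] {p : V → Pt} (h : GoodScheme nx p) :
    IsPolygonalLink (schemeEdges nx p) := by
  refine IsPolygonalLink.of_inj (Set.finite_range _) ?_ ?_ ?_ ?_ ?_ ?_
  · rintro _ ⟨v, rfl⟩
    exact h.ne v
  · rintro _ ⟨v, rfl⟩
    exact ⟨_, ⟨nx v, rfl⟩, rfl⟩
  · rintro _ ⟨v, rfl⟩
    exact ⟨_, ⟨nx.symm v, rfl⟩, by simp⟩
  · rintro _ ⟨v, rfl⟩ _ ⟨w, rfl⟩ hvw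
    rw [h.injective hvw]
  · rintro _ ⟨v, rfl⟩ _ ⟨w, rfl⟩ hvw
    rw [nx.injective (h.injective hvw)]
  · rintro _ ⟨v, rfl⟩ _ ⟨w, rfl⟩ hne z hz hz'
    have hvw : v ≠ w := by rintro rfl; exact hne rfl
    rcases h.inter v w hvw z hz hz' with ⟨rfl, rfl⟩ | ⟨rfl, rfl⟩
    · exact ⟨Or.inr rfl, Or.inl rfl⟩
    · exact ⟨Or.inl rfl, Or.inr rfl⟩

/-! ### Openness of the condition that polygons are simple and disjoint. -/

theorem mem_segment_iff_exists {a b z : Pt} :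
    z ∈ segment ℝ a b ↔ ∃ t ∈ Set.Icc (0 : ℝ) 1, z = a + t • (b - a) := by
  rw [segment_eq_image']
  simp only [Set.mem_image, eq_comm]

/-- The tube lemma: a condition that is open in both variables and holds over a compact set persists
under small perturbations. -/
theorem eventually_ne_zero_of_compact {X Y : Type*} [TopologicalSpace X] [TopologicalSpace Y]
    {K : Set Y} (hK : IsCompact K) {f : X → Y → Pt} (hf : Continuous fun q : X × Y => f q.1 q.2)
    {x : X} (hx : ∀ y ∈ K, f x y ≠ 0) : ∀ᶠ x' in nhds x, ∀ y ∈ K, f x' y ≠ 0 :=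
  hK.eventually_forall_of_forall_eventually fun y hy =>
    (isOpen_ne.preimage hf).mem_nhds (show f x y ≠ 0 from hx y hy)

theorem eventually_segment_disjoint [Finite V] {p : V → Pt} {v v' w w' : V}
    (h : ∀ z ∈ segment ℝ (p v) (p v'), z ∉ segment ℝ (p w) (p w')) :
    ∀ᶠ q in nhds p, ∀ z ∈ segment ℝ (q v) (q v'), z ∉ segment ℝ (q w) (q w') := by
  have hI : IsCompact (Set.Icc (0 : ℝ) 1 ×ˢ Set.Icc (0 : ℝ) 1) := isCompact_Icc.prod isCompact_Icc
  have := eventually_ne_zero_of_compact hI (x := p)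
    (f := fun q st => (q v + st.1 • (q v' - q v)) - (q w + st.2 • (q w' - q w)))
    (by fun_prop) (fun y hy h0 => h _ (mem_segment_iff_exists.2 ⟨y.1, hy.1, rfl⟩)
      (mem_segment_iff_exists.2 ⟨y.2, hy.2, sub_eq_zero.1 h0⟩))
  filter_upwards [this] with q hq z hz hz'
  obtain ⟨s, hs, rfl⟩ := mem_segment_iff_exists.1 hz
  obtain ⟨t, ht, he⟩ := mem_segment_iff_exists.1 hz'
  exact hq (s, t) ⟨hs, ht⟩ (sub_eq_zero.2 he)

/-- Adjacent nondegenerate edges meet only in their common vertex exactly when no convex combination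
of the two edge vectors vanishes. In this form the condition is a nonvanishing over the compact
interval, hence open. -/
theorem eventually_segment_inter [Finite V] {p : V → Pt} {u v w : V} (huv : p u ≠ p v)
    (hvw : p v ≠ p w)
    (h : ∀ z ∈ segment ℝ (p u) (p v), z ∈ segment ℝ (p v) (p w) → z = p v) :
    ∀ᶠ q in nhds p, ∀ z ∈ segment ℝ (q u) (q v), z ∈ segment ℝ (q v) (q w) → z = q v := by
  have hI : IsCompact (Set.Icc (0 : ℝ) 1) := isCompact_Icc
  have := eventually_ne_zero_of_compact hI (x := p)
    (f := fun q t => (1 - t) • (q v - q u) + t • (q w - q v))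
    (by fun_prop) (fun t ht h0 => by
      have h1 : p v + (1 - t) • (p u - p v) = p v + t • (p w - p v) := by
        linear_combination (norm := module) -h0
      have h2 := h (p v + (1 - t) • (p u - p v))
        (segment_symm ℝ (p v) (p u) ▸ mem_segment_iff_exists.2 ⟨1 - t, ⟨by linarith [ht.2],
          by linarith [ht.1]⟩, rfl⟩) (mem_segment_iff_exists.2 ⟨t, ht, h1⟩)
      have h3 : (1 - t) • (p u - p v) = 0 := by simpa using h2
      rcases smul_eq_zero.1 h3 with h4 | h4
      · have h5 : t = 1 := by linarith
        rw [h5] at h1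
        exact hvw (by simpa using h1)
      · exact huv (sub_eq_zero.1 h4))
  filter_upwards [this] with q hq z hz hz'
  obtain ⟨s, hs, hzs⟩ := mem_segment_iff_exists.1 hz
  obtain ⟨t, ht, hzt⟩ := mem_segment_iff_exists.1 hz'
  by_contra hne
  have h0 : 0 < (1 - s) + t := by
    by_contra h0
    have h1 : t = 0 := by linarith [hs.2, ht.1]
    exact hne (by simpa [h1] using hzt)
  -- A second common point gives a relation with coefficients `1 - s` and `t`, not both zero;
  -- dividing by their sum makes it a convex combination.
  refine hq (t / ((1 - s) + t)) ⟨div_nonneg ht.1 h0.le, ?_⟩ ?_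
  · rw [div_le_one h0]; linarith [hs.2]
  · have h1 : (1 - s) • (q v - q u) + t • (q w - q v) = 0 := by
      linear_combination (norm := module) hzs - hzt
    have h2 : 1 - t / ((1 - s) + t) = ((1 - s) + t)⁻¹ * (1 - s) := by field_simp; ring
    have h3 : t / ((1 - s) + t) = ((1 - s) + t)⁻¹ * t := by field_simp
    rw [h2, h3, mul_smul, mul_smul, ← smul_add, h1, smul_zero]

/-- A finite conjunction of open conditions: edges are nondegenerate, adjacent ones meet in their
vertex only, the others are disjoint. Excluding cycles of length two makes the common vertex of
adjacent edges unambiguous. -/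
theorem GoodScheme.eventually [Finite V] (h2 : ∀ v, nx (nx v) ≠ v) {p : V → Pt}
    (h : GoodScheme nx p) : ∀ᶠ q in nhds p, GoodScheme nx q := by
  have hne : ∀ᶠ q in nhds p, ∀ v, q v ≠ q (nx v) := by
    rw [Filter.eventually_all]
    intro v
    exact ((continuous_apply v).continuousAt.ne_iff_eventually_ne
      (continuous_apply (nx v)).continuousAt).1 (h.ne v)
  have hadj : ∀ᶠ q in nhds p, ∀ v, ∀ z ∈ segment ℝ (q v) (q (nx v)),
      z ∈ segment ℝ (q (nx v)) (q (nx (nx v))) → z = q (nx v) := by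
    rw [Filter.eventually_all]
    intro v
    refine eventually_segment_inter (h.ne v) (h.ne _) fun z hz hz' => ?_
    rcases h.inter v (nx v) (fun he => h.ne v (congrArg p he)) z hz hz' with h1 | h1
    exacts [h1.2, absurd h1.1.symm (h2 v)]
  have hdis : ∀ᶠ q in nhds p, ∀ v w, v ≠ w → w ≠ nx v → v ≠ nx w →
      ∀ z ∈ segment ℝ (q v) (q (nx v)), z ∉ segment ℝ (q w) (q (nx w)) := by
    rw [Filter.eventually_all]
    intro v
    rw [Filter.eventually_all]
    intro w
    by_cases hc : v ≠ w ∧ w ≠ nx v ∧ v ≠ nx w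
    · have := eventually_segment_disjoint (p := p) (v := v) (v' := nx v) (w := w) (w' := nx w)
        (fun z hz hz' => by
          rcases h.inter v w hc.1 z hz hz' with h1 | h1
          exacts [hc.2.1 h1.1, hc.2.2 h1.1])
      filter_upwards [this] with q hq _ _ _ using hq
    · exact Filter.Eventually.of_forall fun q a b c => absurd ⟨a, b, c⟩ hc
  filter_upwards [hne, hadj, hdis] with q q1 q2 q3
  refine ⟨q1, fun v w hvw z hz hz' => ?_⟩
  by_cases a : w = nx v
  · subst a
    exact Or.inl ⟨rfl, q2 v z hz hz'⟩
  by_cases b : v = nx w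
  · subst b
    exact Or.inr ⟨rfl, q2 w z hz' hz⟩
  exact absurd hz' (q3 v w hvw a b z hz)

theorem mem_triangle {a b c z : Pt} (hz : z ∈ convexHull ℝ {a, b, c}) :
    ∃ y ∈ segment ℝ b c, z ∈ segment ℝ a y := by
  rw [convexHull_insert (by simp), convexHull_pair, mem_convexJoin] at hz
  simpa using hz

/-! ### Motions of vertices as triangle moves. -/

/-- A vertex may be moved along a segment transverse to the plane of its adjacent edges, if the
polygons stay simple and disjoint. -/
theorem isotopic_update_of_transverse [Finite V] [DecidableEq V] (h2 : ∀ v, nx (nx v) ≠ v)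
    {p : V → Pt} {v : V} {c : Pt} (hgood : ∀ y ∈ segment ℝ (p v) c,
      GoodScheme nx (Function.update p v y)) (φ : Pt →ₗ[ℝ] ℝ) (hu : φ (p (nx.symm v)) = φ (p v))
    (hw : φ (p (nx v)) = φ (p v)) (hc : φ c ≠ φ (p v)) :
    PolyIsotopic (schemeEdges nx p) (schemeEdges nx (Function.update p v c)) := by
  obtain ⟨u, rfl⟩ := nx.surjective v
  rw [Equiv.symm_apply_apply] at hu
  set v := nx u with hv
  set w := nx v with hw'
  have huv : u ≠ v := by
    intro h
    apply h2 u
    rw [← hv, ← h, ← hv, ← h]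
  have hwv : w ≠ v := fun h => huv (nx.injective (by rw [← hv, ← hw', h]))
  have hwu : w ≠ u := h2 u
  set q := Function.update p v c with hq
  have hp : GoodScheme nx p := by simpa using hgood (p v) (left_mem_segment _ _ _)
  have hqg : GoodScheme nx q := hgood c (right_mem_segment _ _ _)
  have hqv : q v = c := by simp [hq]
  have hqu : q u = p u := by simp [hq, huv]
  have hqw : q w = p w := by simp [hq, hwv]
  have hqx : ∀ x, x ≠ v → q x = p x := fun x hx => by simp [hq, hx]
  have hpi := hp.injective
  have hφc : φ c - φ (p v) ≠ 0 := sub_ne_zero.2 hc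
  -- The triangle `p u, p v, c` is swept by the segments from `p u` to the points `y` of the path of
  -- the vertex; that the polygons are simple with the vertex at `y` keeps the other edges away.
  have inter_u : ∀ x, x ≠ u → x ≠ v → ∀ y ∈ segment ℝ (p v) c, ∀ z ∈ segment ℝ (p u) y,
      z ∈ segment ℝ (p x) (p (nx x)) → z = p u := by
    intro x hxu hxv y hy z hz hz'
    have hnx : nx x ≠ v := fun h => hxu (nx.injective (h.trans hv))
    have := (hgood y hy).inter u x hxu.symm z (by simpa [← hv, huv] using hz)
      (by simpa [hxv, hnx] using hz')
    rcases this with h | h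
    · exact absurd h.1 hxv
    · simpa [huv] using h.2
  have inter_v : ∀ x, x ≠ u → x ≠ v → ∀ y ∈ segment ℝ (p v) c, ∀ z ∈ segment ℝ y (p w),
      z ∈ segment ℝ (p x) (p (nx x)) → z = p w := by
    intro x hxu hxv y hy z hz hz'
    have hnx : nx x ≠ v := fun h => hxu (nx.injective (h.trans hv))
    have := (hgood y hy).inter v x hxv.symm z (by simpa [← hw', hwv] using hz)
      (by simpa [hxv, hnx] using hz')
    rcases this with h | h
    · rw [h.2, h.1, Function.update_of_ne hwv]
    · exact absurd h.1.symm hnx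
  -- The motion is done through the polygon with consecutive vertices `p u`, `c`, `p v`, `p w`: it
  -- arises from the old polygon by a detour of `p u, p v` through `c`, and from the new one by a
  -- detour of `c, p w` through `p v`.
  have step1 := insertVertex (a := p u) (b := p v) (c := c) hp.isPolygonalLink ⟨u, rfl⟩
    (by
      rintro _ ⟨x, rfl⟩ hxu z hz hz'
      have hxu : x ≠ u := by rintro rfl; exact hxu rfl
      obtain ⟨y, hy, hzy⟩ := mem_triangle hz
      by_cases hxv : x = v
      · subst hxv
        obtain ⟨t, ht, rfl⟩ := mem_segment_iff_exists.1 hy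
        obtain ⟨s, hs, rfl⟩ := mem_segment_iff_exists.1 hzy
        obtain ⟨r, hr, he⟩ := mem_segment_iff_exists.1 hz'
        -- The next edge `p v, p w` lies in the level plane of `φ`, and the triangle meets this
        -- plane in its base only, as `c` is off it.
        have h1 := congrArg φ he
        simp only [map_add, map_smul, map_sub, hu, smul_eq_mul] at h1
        simp only [← hw'] at h1
        rw [hw] at h1
        have h1 : s * t * (φ c - φ (p v)) = 0 := by linarith
        have h1 : s * t = 0 := by simpa [hφc] using h1
        refine mem_segment_iff_exists.2 ⟨s, hs, ?_⟩
        have h2 : s • t • (c - p v) = 0 := by rw [smul_smul, h1, zero_smul]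
        linear_combination (norm := module) h2
      · rw [inter_u x hxu hxv y hy z hzy hz']
        exact left_mem_segment _ _ _)
    (by
      rintro z ⟨hz, hz'⟩
      obtain ⟨s, hs, rfl⟩ := mem_segment_iff_exists.1 hz
      obtain ⟨r, hr, he⟩ := mem_segment_iff_exists.1 hz'
      have h1 := congrArg φ he
      simp only [map_add, map_smul, map_sub, hu, smul_eq_mul] at h1
      have h1 : (s - (1 - r)) * (φ c - φ (p v)) = 0 := by linarith
      have h1 : s = 1 - r := by
        rcases mul_eq_zero.1 h1 with h | h
        exacts [sub_eq_zero.1 h, absurd h hφc]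
      have h3 : (1 - s) • (p u - p v) = 0 := by
        rw [h1] at he ⊢
        linear_combination (norm := module) he
      rcases smul_eq_zero.1 h3 with h4 | h4
      · have : s = 1 := by linarith
        simp [this]
      · exact absurd (sub_eq_zero.1 h4) (hp.ne u))
    (fun h => by rw [h, hu] at hc; exact hc rfl) (fun h => hc (congrArg φ h))
  have step2 := insertVertex (a := c) (b := p w) (c := p v) hqg.isPolygonalLink
    ⟨v, by simp only [← hw', hqv, hqw]⟩
    (by
      rintro _ ⟨x, rfl⟩ hxv z hz hz'
      have hxv : x ≠ v := by rintro rfl; exact hxv (by simp only [← hw', hqv, hqw])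
      have hz : z ∈ convexHull ℝ {p w, p v, c} := by
        convert hz using 2
        ext; simp; tauto
      obtain ⟨y, hy, hzy⟩ := mem_triangle hz
      by_cases hxu : x = u
      · obtain rfl : u = x := hxu.symm
        simp only [← hv, hqu, hqv] at hz'
        obtain ⟨t, ht, rfl⟩ := mem_segment_iff_exists.1 hy
        obtain ⟨s, hs, rfl⟩ := mem_segment_iff_exists.1 hzy
        obtain ⟨r, hr, he⟩ := mem_segment_iff_exists.1 hz'
        have h1 := congrArg φ he
        simp only [map_add, map_smul, map_sub, hu, hw, smul_eq_mul] at h1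
        have h1 : (s * t - r) * (φ c - φ (p v)) = 0 := by linarith
        have h1 : r = s * t := by
          rcases mul_eq_zero.1 h1 with h | h
          exacts [(sub_eq_zero.1 h).symm, absurd h hφc]
        rcases hr.2.eq_or_lt with hr1 | hr1
        · rw [he, hr1]
          have : p u + (1 : ℝ) • (c - p u) = c := by simp
          rw [this]
          exact left_mem_segment _ _ _
        · exfalso
          -- Otherwise the intersection point would put `p u` on the edge `p v, p w`.
          have h3 : (1 - r) • p u = (1 - s) • p w + (s - r) • p v := by
            have h4 : (s * t) • (c - p v) = r • (c - p v) := by rw [h1]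
            rw [mul_smul] at h4
            linear_combination (norm := module) h4 - he
          have h5 : 0 < 1 - r := by linarith
          have h6 : p u ∈ segment ℝ (p v) (p w) := by
            refine mem_segment_iff_exists.2 ⟨(1 - s) / (1 - r),
              ⟨div_nonneg (by linarith [hs.2]) h5.le, ?_⟩, ?_⟩
            · rw [div_le_one h5]
              nlinarith [hs.1, ht.2]
            · have h7 := congrArg (fun x => (1 - r)⁻¹ • x) h3
              simp only [smul_smul, smul_add] at h7
              rw [inv_mul_cancel₀ h5.ne', one_smul] at h7
              have h8 : (1 - r)⁻¹ * (s - r) = 1 - (1 - s) / (1 - r) := by field_simp; ring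
              have h9 : (1 - r)⁻¹ * (1 - s) = (1 - s) / (1 - r) := by field_simp
              rw [h8, h9] at h7
              linear_combination (norm := module) h7
          rcases hp.inter u v huv (p u) (left_mem_segment _ _ _) h6 with h | h
          · exact huv (hpi h.2)
          · exact hwu h.1.symm
      · have hnx : nx x ≠ v := fun h => hxu (nx.injective (h.trans hv))
        simp only [hqx x hxv, hqx _ hnx] at hz'
        rw [segment_symm] at hzy
        rw [inter_v x hxu hxv y hy z hzy hz']
        exact right_mem_segment _ _ _)
    (by
      rintro z ⟨hz, hz'⟩
      obtain ⟨s, hs, rfl⟩ := mem_segment_iff_exists.1 hz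
      obtain ⟨r, hr, he⟩ := mem_segment_iff_exists.1 hz'
      have h1 := congrArg φ he
      simp only [map_add, map_smul, map_sub, hw, smul_eq_mul] at h1
      have h1 : (1 - s) * (φ c - φ (p v)) = 0 := by linarith
      have h1 : s = 1 := by
        rcases mul_eq_zero.1 h1 with h | h
        exacts [(sub_eq_zero.1 h).symm, absurd h hφc]
      simp [h1])
    (fun h => hc (congrArg φ h.symm)) (hp.ne v)
  have heq : schemeEdges nx p \ {(p u, p v)} ∪ {(p u, c), (c, p v)} =
      schemeEdges nx q \ {(c, p w)} ∪ {(c, p v), (p v, p w)} := by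
    have hqi := hqg.injective
    ext e
    simp only [schemeEdges, Set.mem_union, Set.mem_sdiff, Set.mem_range, Set.mem_insert_iff,
      Set.mem_singleton_iff]
    constructor
    · rintro (⟨⟨x, rfl⟩, hx⟩ | rfl | rfl)
      · have hxu : x ≠ u := by rintro rfl; exact hx rfl
        by_cases hxv : x = v
        · subst hxv; exact Or.inr (Or.inr rfl)
        · have hnx : nx x ≠ v := fun h => hxu (nx.injective (h.trans hv))
          refine Or.inl ⟨⟨x, by rw [hqx x hxv, hqx _ hnx]⟩, fun h => hxv (hqi ?_)⟩
          rw [hqx x hxv, hqv]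
          exact congrArg Prod.fst h
      · refine Or.inl ⟨⟨u, by rw [← hv, hqu, hqv]⟩, fun h => ?_⟩
        have : c = p w := congrArg Prod.snd h
        exact hc (by rw [this, hw])
      · exact Or.inr (Or.inl rfl)
    · rintro (⟨⟨x, rfl⟩, hx⟩ | rfl | rfl)
      · have hxv : x ≠ v := by rintro rfl; exact hx (by rw [← hw', hqv, hqw])
        by_cases hxu : x = u
        · subst hxu; exact Or.inr (Or.inl (by rw [← hv, hqu, hqv]))
        · have hnx : nx x ≠ v := fun h => hxu (nx.injective (h.trans hv))
          refine Or.inl ⟨⟨x, by rw [hqx x hxv, hqx _ hnx]⟩, fun h => hxu (hpi ?_)⟩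
          rw [← hqx x hxv]
          exact congrArg Prod.fst h
      · exact Or.inr (Or.inr rfl)
      · refine Or.inl ⟨⟨v, by rw [← hw']⟩, fun h => huv (hpi ?_)⟩
        exact (congrArg Prod.fst h).symm
  rw [heq] at step1
  exact step1.trans step2.symm

/-- Dimension count: two linear conditions on the three-dimensional dual space have a nonzero
solution. -/
theorem exists_linear_eq (u v w : Pt) : ∃ φ : Pt →ₗ[ℝ] ℝ, φ ≠ 0 ∧ φ u = φ v ∧ φ w = φ v := by
  let F : Module.Dual ℝ Pt →ₗ[ℝ] ℝ × ℝ :=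
    (Module.Dual.eval ℝ Pt (u - v)).prod (Module.Dual.eval ℝ Pt (w - v))
  have hF : LinearMap.ker F ≠ ⊥ := F.ker_ne_bot_of_finrank_lt (by simp [Subspace.dual_finrank_eq])
  obtain ⟨φ, hφ, h0⟩ := (Submodule.ne_bot_iff _).1 hF
  have : φ (u - v) = 0 ∧ φ (w - v) = 0 := by simpa [F] using hφ
  exact ⟨φ, h0, by simpa [sub_eq_zero] using this.1, by simpa [sub_eq_zero] using this.2⟩

theorem dense_linear_ne {φ : Pt →ₗ[ℝ] ℝ} (h : φ ≠ 0) (k : ℝ) :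
    Dense {x | φ x ≠ k} ∧ IsOpen {x | φ x ≠ k} := by
  have hs : Function.Surjective φ := LinearMap.surjective h
  have hc : Continuous φ := φ.continuous_of_finiteDimensional
  exact ⟨(dense_compl_singleton k).preimage (φ.isOpenMap_of_finiteDimensional hs),
    isOpen_ne.preimage hc⟩

/-- A generic point `y` of `U` lies off the planes in question through the two neighbours and the
old, respectively the new, position. Both positions can be moved to `y` transversally. -/
theorem isotopic_update [Finite V] [DecidableEq V] (h2 : ∀ v, nx (nx v) ≠ v) {p : V → Pt} {v : V}
    {c : Pt} {U : Set Pt} (hU : IsOpen U) (hUc : Convex ℝ U) (hpU : p v ∈ U) (hcU : c ∈ U)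
    (hgood : ∀ y ∈ U, GoodScheme nx (Function.update p v y)) :
    PolyIsotopic (schemeEdges nx p) (schemeEdges nx (Function.update p v c)) := by
  obtain ⟨φ, h0, hu, hw⟩ := exists_linear_eq (p (nx.symm v)) (p v) (p (nx v))
  obtain ⟨ψ, h0', hu', hw'⟩ := exists_linear_eq (p (nx.symm v)) c (p (nx v))
  obtain ⟨d1, o1⟩ := dense_linear_ne h0 (φ (p v))
  obtain ⟨d2, o2⟩ := dense_linear_ne h0' (ψ c)
  obtain ⟨y, hyU, hy1, hy2⟩ := (d1.inter_of_isOpen_left d2 o1).inter_open_nonempty U hU ⟨_, hpU⟩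
  have hnv : nx v ≠ v := fun h => h2 v (by rw [h, h])
  have hnv' : nx.symm v ≠ v := fun h => hnv (by conv_lhs => rw [← h, Equiv.apply_symm_apply])
  have s1 := isotopic_update_of_transverse h2 (p := p) (v := v) (c := y)
    (fun z hz => hgood z (hUc.segment_subset hpU hyU hz)) φ hu hw hy1
  have s2 := isotopic_update_of_transverse h2 (p := Function.update p v c) (v := v) (c := y)
    (fun z hz => by
      rw [Function.update_idem]
      rw [Function.update_self] at hz
      exact hgood z (hUc.segment_subset hcU hyU hz)) ψ (by simp [hnv', hu'])
      (by simp [hnv, hw']) (by simpa using hy2)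
  rw [Function.update_idem] at s2
  exact s1.trans s2.symm

/-- A ball in the supremum metric is a product of balls, so the vertices can be moved one after
another without leaving the neighbourhood in which all polygons are simple and disjoint. -/
theorem GoodScheme.eventually_isotopic [Finite V] (h2 : ∀ v, nx (nx v) ≠ v) {p : V → Pt}
    (h : GoodScheme nx p) :
    ∀ᶠ q in nhds p, PolyIsotopic (schemeEdges nx p) (schemeEdges nx q) := by
  classical
  have := Fintype.ofFinite V
  obtain ⟨ε, hε, hball⟩ := Metric.eventually_nhds_iff_ball.1 (h.eventually h2)
  filter_upwards [Metric.ball_mem_nhds p hε] with q hq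
  have hmem : ∀ (r : V → Pt), (∀ v, r v ∈ Metric.ball (p v) ε) → GoodScheme nx r := fun r hr =>
    hball r (by simpa [dist_pi_lt_iff hε] using hr)
  have hq' : ∀ v, q v ∈ Metric.ball (p v) ε := by simpa [dist_pi_lt_iff hε] using hq
  have key : ∀ s : Finset V, PolyIsotopic (schemeEdges nx p) (schemeEdges nx (s.piecewise q p)) := by
    intro s
    induction s using Finset.induction_on with
    | empty =>
      rw [Finset.piecewise_empty]
      exact PolyIsotopic.refl h.isPolygonalLink
    | insert v s hv ih =>
      refine ih.trans ?_
      rw [Finset.piecewise_insert]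
      refine isotopic_update h2 (U := Metric.ball (p v) ε) Metric.isOpen_ball (convex_ball _ _)
        (by simp [hv, hε]) (hq' v) fun y hy => hmem _ fun w => ?_
      by_cases hwv : w = v
      · subst hwv; simpa using hy
      · by_cases hws : w ∈ s <;> simp [hwv, hws, hε] ; simpa using hq' w
  simpa using key Finset.univ

/-- Two systems of polygons in a convex set of systems of simple disjoint polygons are isotopic. -/
theorem isotopic_of_convex [Finite V] (h2 : ∀ v, nx (nx v) ≠ v) {K : Set (V → Pt)}
    (hK : Convex ℝ K) (hgood : ∀ p ∈ K, GoodScheme nx p) {p q : V → Pt} (hp : p ∈ K) (hq : q ∈ K) :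
    PolyIsotopic (schemeEdges nx p) (schemeEdges nx q) :=
  -- The isotopy class is locally constant, and a convex set is connected.
  hK.isPreconnected.induction₂ (fun p q => PolyIsotopic (schemeEdges nx p) (schemeEdges nx q))
    (fun p hp => ((hgood p hp).eventually_isotopic h2).filter_mono nhdsWithin_le_nhds)
    (fun _ _ _ _ _ _ => PolyIsotopic.trans) (fun _ _ _ _ => PolyIsotopic.symm) hp hq

end Scheme

/-! ### Closed polygonal braids -/

theorem segment_disjoint_of_lt (φ : Pt →ₗ[ℝ] ℝ) {u v u' v' : Pt} (h1 : φ u < φ u')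
    (h2 : φ u < φ v') (h3 : φ v < φ u') (h4 : φ v < φ v') {z : Pt} (hz : z ∈ segment ℝ u v) :
    z ∉ segment ℝ u' v' := by
  rintro ⟨s, t, hs, ht, hst, rfl⟩
  obtain ⟨s', t', hs', ht', hst', he⟩ := hz
  have := congrArg φ he
  simp only [map_add, map_smul, smul_eq_mul] at this
  have hm : s' * φ u + t' * φ v ≤ max (φ u) (φ v) := by
    have e : (s' + t') * max (φ u) (φ v) = max (φ u) (φ v) := by rw [hst', one_mul]
    linarith [mul_le_mul_of_nonneg_left (le_max_left (φ u) (φ v)) hs',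
      mul_le_mul_of_nonneg_left (le_max_right (φ u) (φ v)) ht']
  have hm' : min (φ u') (φ v') ≤ s * φ u' + t * φ v' := by
    have e : (s + t) * min (φ u') (φ v') = min (φ u') (φ v') := by rw [hst, one_mul]
    linarith [mul_le_mul_of_nonneg_left (min_le_left (φ u') (φ v')) hs,
      mul_le_mul_of_nonneg_left (min_le_right (φ u') (φ v')) ht]
  have : max (φ u) (φ v) < min (φ u') (φ v') := by
    rw [max_lt_iff, lt_min_iff, lt_min_iff]; exact ⟨⟨h1, h2⟩, h3, h4⟩
  linarith

/-- One segment lies below a level of `φ` and the other above it, and each touches the level at a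
single end. -/
theorem segment_corner (φ : Pt →ₗ[ℝ] ℝ) {u v u' v' : Pt} (h1 : φ u < φ v) (h2 : φ v = φ u')
    (h3 : φ u' < φ v') {z : Pt} (hz : z ∈ segment ℝ u v) (hz' : z ∈ segment ℝ u' v') :
    z = v ∧ z = u' := by
  obtain ⟨s, hs, h⟩ := mem_segment_iff_exists.1 hz
  obtain ⟨t, ht, h'⟩ := mem_segment_iff_exists.1 hz'
  have e1 := congrArg φ h
  have e2 := congrArg φ h'
  simp only [map_add, map_smul, map_sub, smul_eq_mul] at e1 e2
  have k1 : t = 0 := by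
    by_contra h0
    have : 0 < t := lt_of_le_of_ne ht.1 (Ne.symm h0)
    nlinarith [hs.2, mul_pos this (sub_pos.2 h3)]
  have k2 : s = 1 := by
    by_contra h0
    have : s < 1 := lt_of_le_of_ne hs.2 h0
    rw [k1] at e2
    nlinarith [mul_pos (sub_pos.2 this) (sub_pos.2 h1)]
  constructor
  · rw [h, k2]; simp
  · rw [h', k1]; simp

/-- A common point has the same `ψ`-value on both segments, hence the same parameter; but at equal
parameters `φ` is strictly ordered. -/
theorem segment_disjoint_of_sync (ψ φ : Pt →ₗ[ℝ] ℝ) {u v u' v' : Pt} (h1 : ψ u = ψ u')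
    (h2 : ψ v = ψ v') (h3 : ψ u < ψ v) (h4 : φ u < φ u') (h5 : φ v < φ v') {z : Pt}
    (hz : z ∈ segment ℝ u v) : z ∉ segment ℝ u' v' := by
  intro hz'
  obtain ⟨s, hs, h⟩ := mem_segment_iff_exists.1 hz
  obtain ⟨t, ht, h'⟩ := mem_segment_iff_exists.1 hz'
  have e1 := congrArg ψ h
  have e2 := congrArg ψ h'
  have e3 := congrArg φ h
  have e4 := congrArg φ h'
  simp only [map_add, map_smul, map_sub, smul_eq_mul] at e1 e2 e3 e4
  rw [← h1, ← h2, e1] at e2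
  have : s = t := by
    have : (s - t) * (ψ v - ψ u) = 0 := by linarith
    rcases mul_eq_zero.1 this with k | k <;> linarith
  subst this
  rcases hs.1.eq_or_lt with h0 | h0
  · subst h0; linarith
  · nlinarith [hs.2, mul_pos h0 (sub_pos.2 h5), mul_nonneg (sub_nonneg.2 hs.2) (sub_pos.2 h4).le]

/-- The linear functional with coefficients `a`, `b`, `c`. -/
def linFun (a b c : ℝ) : Pt →ₗ[ℝ] ℝ :=
  a • LinearMap.proj 0 + b • LinearMap.proj 1 + c • LinearMap.proj 2

@[simp] theorem linFun_pt (a b c x y z : ℝ) : linFun a b c (pt x y z) = a * x + b * y + c * z := by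
  simp [linFun, pt]

theorem pt_inj {x y z x' y' z' : ℝ} : pt x y z = pt x' y' z' ↔ x = x' ∧ y = y' ∧ z = z' := by
  constructor
  · intro h
    exact ⟨congrFun h 0, congrFun h 1, congrFun h 2⟩
  · rintro ⟨rfl, rfl, rfl⟩; rfl

/-- The point with coordinates `q` of the `j`-th page of an open book; the pages `0, …, L` are
the half-planes over the lines `x = x_j`, and the pages `L + 1`, `L + 2` lie behind. The page
`L + 3` is the page `0` again. The first coordinate is along the axis of the book, the second one is
radial. -/
def place (x : ℕ → ℝ) (L j : ℕ) (q : ℝ × ℝ) : Pt :=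
  if j ≤ L then pt (x j) q.1 q.2
  else if j = L + 1 then pt (x L + 1 + 2 * q.2) q.1 (-1 - q.2)
  else if j = L + 2 then pt (x 0 - 1 - 2 * q.2) q.1 (-1 - q.2)
  else pt (x 0) q.1 q.2

section place

variable (x : ℕ → ℝ) {L j : ℕ} (q : ℝ × ℝ)

theorem place_of_le (h : j ≤ L) : place x L j q = pt (x j) q.1 q.2 := if_pos h

theorem place_right : place x L (L + 1) q = pt (x L + 1 + 2 * q.2) q.1 (-1 - q.2) := by
  simp [place]

theorem place_left : place x L (L + 2) q = pt (x 0 - 1 - 2 * q.2) q.1 (-1 - q.2) := by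
  simp [place]

theorem place_last : place x L (L + 3) q = pt (x 0) q.1 q.2 := by
  simp [place]

theorem place_zero : place x L 0 q = pt (x 0) q.1 q.2 := by
  simp [place]

theorem place_injective : Function.Injective (place x L j) := by
  intro q q' h
  unfold place at h
  split_ifs at h <;> simp only [pt_inj] at h <;> refine Prod.ext ?_ ?_ <;> linarith [h.1, h.2.1, h.2.2]

/-- The position is affine in the page positions and the coordinates together, so interpolating
configurations interpolates the vertices. -/
theorem place_combo (x x' : ℕ → ℝ) (q q' : ℝ × ℝ) {s t : ℝ} (hst : s + t = 1) :
    place (s • x + t • x') L j (s • q + t • q') = s • place x L j q + t • place x' L j q' := by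
  unfold place
  split_ifs <;> ext i <;> fin_cases i <;> simp [pt] <;> (try linear_combination (-1) * hst) <;>
    linear_combination hst

end place

/-- The value at `q` of the functional with coefficients `a`. -/
def dot (a q : ℝ × ℝ) : ℝ := a.1 * q.1 + a.2 * q.2

section Cfg

variable {K : Type*}

/-- The closed braid which meets the `j`-th page in the points `c j k`. -/
def cfgEdges (L : ℕ) (x : ℕ → ℝ) (c : ℕ → K → ℝ × ℝ) : Set (Pt × Pt) :=
  {e | ∃ j k, j < L + 3 ∧ e = (place x L j (c j k), place x L (j + 1) (c (j + 1) k))}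

/-- The conditions on the pages of a closed braid; its strands close up by `π`. -/
structure IsCfg (L : ℕ) (π : Equiv.Perm K) (x : ℕ → ℝ) (c : ℕ → K → ℝ × ℝ) : Prop where
  lt : ∀ j < L, x j < x (j + 1)
  nonneg : ∀ j k, 0 ≤ (c j k).2
  wrap : ∀ k, c (L + 3) k = c 0 (π k)

/-- The functional `a` separates the strands `k`, `k'` between the pages `j` and `j + 1`. -/
def CellSep (L j : ℕ) (a : ℝ × ℝ) (c : ℕ → K → ℝ × ℝ) (k k' : K) : Prop :=
  (dot a (c j k) < dot a (c j k') ∧ dot a (c (j + 1) k) < dot a (c (j + 1) k')) ∧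
    (L ≤ j → dot a (c j k) < dot a (c (j + 1) k') ∧ dot a (c (j + 1) k) < dot a (c j k'))

/-- The successor of a vertex of a closed braid. -/
def cfgNext (L : ℕ) (π : Equiv.Perm K) : Equiv.Perm (Fin (L + 3) × K) where
  toFun v := (v.1 + 1, if v.1 = Fin.last _ then π v.2 else v.2)
  invFun v := (v.1 - 1, if v.1 = 0 then π.symm v.2 else v.2)
  left_inv v := by
    rcases v with ⟨i, k⟩
    by_cases h : i = Fin.last (L + 2)
    · have : (-1 : Fin (L + 3)) = Fin.last (L + 2) := by
        rw [eq_comm, eq_neg_iff_add_eq_zero, Fin.last_add_one]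
      simp [h, this]
    · have : i + 1 ≠ 0 := fun h' => h (by
        rw [← Fin.last_add_one] at h'; exact add_right_cancel h')
      simp [h, this]
  right_inv v := by
    rcases v with ⟨i, k⟩
    by_cases h : i = 0
    · have : (0 : Fin (L + 3)) - 1 = Fin.last (L + 2) := by
        rw [sub_eq_iff_eq_add, Fin.last_add_one]
      simp [h, this]
    · have : i - 1 ≠ Fin.last (L + 2) := fun h' => h (by
        rw [sub_eq_iff_eq_add, Fin.last_add_one] at h'; exact h')
      simp [h, this]

theorem cfgNext_ne (L : ℕ) (π : Equiv.Perm K) (v : Fin (L + 3) × K) :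
    cfgNext L π (cfgNext L π v) ≠ v := by
  intro h
  have h1 : v.1 + 1 + 1 = v.1 := congrArg Prod.fst h
  have h2 : (1 + 1 : Fin (L + 3)) = 0 := by
    rw [add_assoc] at h1; simpa using h1
  have := congrArg Fin.val h2
  simp [Fin.val_add, Nat.mod_eq_of_lt (show 2 < L + 3 by omega)] at this

variable {L : ℕ} {π : Equiv.Perm K} {x : ℕ → ℝ} {c : ℕ → K → ℝ × ℝ}

/-- The position of a vertex of a closed braid. -/
def cfgVertex (L : ℕ) (x : ℕ → ℝ) (c : ℕ → K → ℝ × ℝ) (v : Fin (L + 3) × K) : Pt :=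
  place x L v.1 (c v.1 v.2)

theorem IsCfg.vertex_next (h : IsCfg L π x c) (v : Fin (L + 3) × K) :
    cfgVertex L x c (cfgNext L π v) = place x L (v.1 + 1) (c (v.1 + 1) v.2) := by
  rcases v with ⟨i, k⟩
  by_cases hi : i = Fin.last (L + 2)
  · subst hi
    simp [cfgVertex, cfgNext, Fin.last_add_one, place_zero, place_last, h.wrap]
  · have : ((i + 1 : Fin (L + 3)) : ℕ) = i + 1 := Fin.val_add_one_of_lt (Fin.lt_last_iff_ne_last.2 hi)
    simp [cfgVertex, cfgNext, hi, this]

theorem IsCfg.schemeEdges_eq (h : IsCfg L π x c) :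
    schemeEdges (cfgNext L π) (cfgVertex L x c) = cfgEdges L x c := by
  ext e
  simp only [schemeEdges, cfgEdges, Set.mem_range, Set.mem_ofPred_eq, h.vertex_next]
  constructor
  · rintro ⟨v, rfl⟩
    exact ⟨v.1, v.2, v.1.2, rfl⟩
  · rintro ⟨j, k, hj, rfl⟩
    exact ⟨(⟨j, hj⟩, k), rfl⟩

theorem IsCfg.x_le (h : IsCfg L π x c) {i j : ℕ} (hij : i ≤ j) (hj : j ≤ L) : x i ≤ x j := by
  induction j, hij using Nat.le_induction with
  | base => exact le_rfl
  | succ j hij ih => exact (ih (by omega)).trans (h.lt j (by omega)).le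

theorem IsCfg.x_lt (h : IsCfg L π x c) {i j : ℕ} (hij : i < j) (hj : j ≤ L) : x i < x j :=
  (h.lt i (by omega)).trans_le (h.x_le hij hj)

/-- For `j < L` the pages are parallel and both strands advance at the same rate in `x`, so
comparing them on each page suffices. The remaining pages are not parallel; there a functional is
chosen that restricts to `dot a` plus the same constant on both pages, and the cross comparisons in
`CellSep` make it separate the segments. -/
theorem IsCfg.cell_disjoint (h : IsCfg L π x c) {j : ℕ} (hj : j < L + 3) {k k' : K} {a : ℝ × ℝ}
    (hs : CellSep L j a c k k') {z : Pt}
    (hz : z ∈ segment ℝ (place x L j (c j k)) (place x L (j + 1) (c (j + 1) k))) :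
    z ∉ segment ℝ (place x L j (c j k')) (place x L (j + 1) (c (j + 1) k')) := by
  obtain ⟨⟨h1, h2⟩, h3⟩ := hs
  simp only [dot] at h1 h2 h3
  rcases lt_or_ge j L with hjL | hjL
  · rw [place_of_le _ _ hjL.le, place_of_le _ _ (show j + 1 ≤ L from hjL)] at hz ⊢
    refine segment_disjoint_of_sync (linFun 1 0 0) (linFun 0 a.1 a.2) ?_ ?_ ?_ ?_ ?_ hz <;>
      simp only [linFun_pt] <;> linarith [h.lt j hjL]
  · obtain ⟨h4, h5⟩ := h3 hjL
    obtain rfl | rfl | rfl : j = L ∨ j = L + 1 ∨ j = L + 2 := by omega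
    · rw [place_of_le _ _ le_rfl, place_right] at hz ⊢
      refine segment_disjoint_of_lt (linFun a.2 a.1 a.2) ?_ ?_ ?_ ?_ hz <;>
        simp only [linFun_pt] <;> linarith
    · rw [place_right, place_left] at hz ⊢
      refine segment_disjoint_of_lt (linFun 0 a.1 (-a.2)) ?_ ?_ ?_ ?_ hz <;>
        simp only [linFun_pt] <;> linarith
    · rw [place_left, place_last] at hz ⊢
      refine segment_disjoint_of_lt (linFun (-a.2) a.1 a.2) ?_ ?_ ?_ ?_ hz <;>
        simp only [linFun_pt] <;> linarith

/-- Different cells occupy different sectors of the book, because radial coordinates are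
nonnegative; they can meet only on a common page. The condition `1 ≤ L` gives `x 0 < x L`, keeping
the two ends of the braid apart. -/
theorem IsCfg.cell_inter (h : IsCfg L π x c) (hL : 1 ≤ L) {i j : ℕ} (hij : i < j) (hj : j < L + 3)
    {k k' : K} {z : Pt}
    (hz : z ∈ segment ℝ (place x L i (c i k)) (place x L (i + 1) (c (i + 1) k)))
    (hz' : z ∈ segment ℝ (place x L j (c j k')) (place x L (j + 1) (c (j + 1) k'))) :
    (j = i + 1 ∧ z = place x L j (c j k) ∧ z = place x L j (c j k')) ∨
      (i = 0 ∧ j = L + 2 ∧ z = place x L 0 (c 0 k) ∧ z = place x L 0 (c 0 (π k'))) := by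
  have r0 := h.nonneg
  have hx0 := h.x_lt (show 0 < L from hL) le_rfl
  obtain hjL | rfl | rfl | rfl : j < L ∨ j = L ∨ j = L + 1 ∨ j = L + 2 := by omega
  · obtain hij' | rfl : i + 1 < j ∨ j = i + 1 := by omega
    · rw [place_of_le _ _ (by omega), place_of_le _ _ (by omega)] at hz hz'
      refine absurd hz' (segment_disjoint_of_lt (linFun 1 0 0) ?_ ?_ ?_ ?_ hz) <;>
        simp only [linFun_pt] <;>
        linarith [h.lt i (by omega), h.lt j hjL, h.x_lt hij' hjL.le]
    · left
      rw [place_of_le x _ (show i + 1 ≤ L by omega)] at hz hz' ⊢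
      rw [place_of_le x _ (show i + 1 ≤ L by omega)]
      rw [place_of_le x _ (by omega)] at hz hz'
      have := segment_corner (linFun 1 0 0)
        (by simp only [linFun_pt]; linarith [h.lt i (by omega)]) (by simp only [linFun_pt]; ring)
        (by simp only [linFun_pt]; linarith [h.lt (i + 1) hjL]) hz hz'
      exact ⟨rfl, this⟩
  · rw [place_of_le x _ le_rfl, place_right] at hz'
    rw [place_of_le _ _ (by omega), place_of_le _ _ (by omega)] at hz
    obtain hij' | rfl : i + 1 < j ∨ j = i + 1 := by omega
    · refine absurd hz' (segment_disjoint_of_lt (linFun 1 0 0) ?_ ?_ ?_ ?_ hz) <;>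
        simp only [linFun_pt] <;>
        linarith [h.lt i (by omega), h.x_lt hij' le_rfl, r0 (j + 1) k']
    · left
      rw [place_of_le x _ le_rfl, place_of_le x _ le_rfl]
      have := segment_corner (linFun 1 0 0)
        (by simp only [linFun_pt]; linarith [h.lt i (by omega)]) (by simp only [linFun_pt]; ring)
        (by simp only [linFun_pt]; linarith [r0 (i + 1 + 1) k']) hz hz'
      exact ⟨rfl, this⟩
  · rw [place_right, place_left] at hz'
    obtain hiL | rfl : i < L ∨ i = L := by omega
    · rw [place_of_le _ _ (by omega), place_of_le _ _ (by omega)] at hz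
      refine absurd hz (segment_disjoint_of_lt (linFun 0 0 1) ?_ ?_ ?_ ?_ hz') <;>
        simp only [linFun_pt] <;>
        linarith [r0 (L + 1) k', r0 (L + 1 + 1) k', r0 i k, r0 (i + 1) k]
    · rw [place_right, place_of_le _ _ le_rfl] at hz
      left
      rw [place_right, place_right]
      have := segment_corner (linFun (-1) 0 (-2))
        (by simp only [linFun_pt]; linarith [r0 i k]) (by simp only [linFun_pt]; ring)
        (by simp only [linFun_pt]; linarith [r0 (i + 1 + 1) k']) hz hz'
      exact ⟨rfl, this⟩
  · rw [place_left, place_last] at hz'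
    obtain hiL | rfl | rfl : i < L ∨ i = L ∨ i = L + 1 := by omega
    · rw [place_of_le _ _ (by omega), place_of_le _ _ (by omega)] at hz
      obtain rfl | hi : i = 0 ∨ 0 < i := by omega
      · right
        rw [place_zero, place_zero]
        have := segment_corner (linFun 1 0 0)
          (by simp only [linFun_pt]; linarith [r0 (L + 2) k']) (by simp only [linFun_pt]; ring)
          (by simp only [linFun_pt]; linarith [h.lt 0 (by omega)]) hz' hz
        exact ⟨rfl, rfl, this.2, by rw [this.1, h.wrap]⟩
      · refine absurd hz (segment_disjoint_of_lt (linFun 1 0 0) ?_ ?_ ?_ ?_ hz') <;>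
          simp only [linFun_pt] <;>
          linarith [r0 (L + 2) k', h.x_lt hi hiL.le, h.lt i hiL]
    · rw [place_right, place_of_le _ _ le_rfl] at hz
      refine absurd hz (segment_disjoint_of_lt (linFun 1 0 0) ?_ ?_ ?_ ?_ hz') <;>
          simp only [linFun_pt] <;>
          linarith [r0 (i + 2) k', r0 (i + 1) k]
    · rw [place_right, place_left] at hz
      left
      rw [place_left, place_left]
      have := segment_corner (linFun (-1) 0 2)
        (by simp only [linFun_pt]; linarith [r0 (L + 1) k, r0 (L + 1 + 1) k])
        (by simp only [linFun_pt]; ring)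
        (by simp only [linFun_pt]; linarith [r0 (L + 2 + 1) k']) hz hz'
      exact ⟨rfl, this⟩

/-- Within a cell the functionals keep the strands disjoint. They also make the points on every page
distinct, so edges of different cells that meet on a page belong to consecutive edges of one strand.
-/
theorem IsCfg.goodScheme (h : IsCfg L π x c) (hL : 1 ≤ L)
    (hs : ∀ j < L + 3, ∀ k k', k ≠ k' → ∃ a, CellSep L j a c k k') :
    GoodScheme (cfgNext L π) (cfgVertex L x c) := by
  have page : ∀ j ≤ L + 3, ∀ k k', place x L j (c j k) = place x L j (c j k') → k = k' := by
    intro j hj k k' he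
    by_contra hne
    have he := place_injective x he
    rcases Nat.eq_zero_or_pos j with rfl | hj0
    · obtain ⟨a, h1, -⟩ := hs 0 (by omega) k k' hne
      rw [he] at h1
      exact lt_irrefl _ h1.1
    · obtain ⟨a, h1, -⟩ := hs (j - 1) (by omega) k k' hne
      rw [Nat.sub_add_cancel hj0, he] at h1
      exact lt_irrefl _ h1.2
  have key : ∀ v w : Fin (L + 3) × K, v.1 < w.1 → ∀ z ∈ segment ℝ (cfgVertex L x c v)
      (cfgVertex L x c (cfgNext L π v)), z ∈ segment ℝ (cfgVertex L x c w)
      (cfgVertex L x c (cfgNext L π w)) → (w = cfgNext L π v ∧ z = cfgVertex L x c w) ∨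
      (v = cfgNext L π w ∧ z = cfgVertex L x c v) := by
    rintro ⟨i, k⟩ ⟨j, k'⟩ hij z hz hz'
    simp only at hij
    rw [h.vertex_next] at hz hz'
    rcases h.cell_inter hL (Fin.lt_def.1 hij) j.2 hz hz' with ⟨h1, h2, h3⟩ | ⟨h1, h2, h3, h4⟩
    · left
      have := page j (by omega) k k' (h2 ▸ h3)
      subst this
      have hi : i ≠ Fin.last (L + 2) := (hij.trans_le (Fin.le_last _)).ne
      refine ⟨Prod.ext ?_ ?_, h2⟩
      · exact Fin.ext (h1.trans (Fin.val_add_one_of_lt (Fin.lt_last_iff_ne_last.2 hi)).symm)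
      · simp [cfgNext, hi]
    · right
      have := page 0 (by omega) k (π k') (h3 ▸ h4)
      subst this
      have hi : i = 0 := Fin.ext h1
      have hj : j = Fin.last (L + 2) := Fin.ext h2
      subst hi hj
      exact ⟨Prod.ext (by simp [cfgNext, Fin.last_add_one]) (by simp [cfgNext]), h3⟩
  refine ⟨fun v hv => ?_, fun v w hvw z hz hz' => ?_⟩
  · rw [h.vertex_next] at hv
    rcases v with ⟨i, k⟩
    simp only [cfgVertex] at hv
    rcases lt_or_ge (i : ℕ) L with hi | hi
    · rw [place_of_le _ _ hi.le, place_of_le _ _ (by omega), pt_inj] at hv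
      exact (h.lt i hi).ne hv.1
    · obtain hi | hi | hi : (i : ℕ) = L ∨ (i : ℕ) = L + 1 ∨ (i : ℕ) = L + 2 := by omega
      · rw [hi, place_of_le _ _ le_rfl, place_right, pt_inj] at hv
        linarith [h.nonneg (L + 1) k, hv.1]
      · rw [hi, place_right, place_left, pt_inj] at hv
        linarith [h.nonneg (L + 1) k, hv.1, h.x_le (Nat.zero_le L) le_rfl,
          h.nonneg (L + 1 + 1) k]
      · rw [hi, place_left, place_last, pt_inj] at hv
        linarith [h.nonneg (L + 2) k, hv.1]
  · rcases lt_trichotomy v.1 w.1 with h1 | h1 | h1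
    · exact key v w h1 z hz hz'
    · rcases v with ⟨i, k⟩
      rcases w with ⟨j, k'⟩
      obtain rfl : i = j := h1
      rw [h.vertex_next] at hz hz'
      obtain ⟨a, ha⟩ := hs i i.2 k k' (fun hk => hvw (by rw [hk]))
      exact absurd hz' (h.cell_disjoint i.2 ha hz)
    · exact (key w v h1 z hz' hz).symm

theorem IsCfg.isPolygonalLink [Finite K] (h : IsCfg L π x c) (hL : 1 ≤ L)
    (hs : ∀ j < L + 3, ∀ k k', k ≠ k' → ∃ a, CellSep L j a c k k') :
    IsPolygonalLink (cfgEdges L x c) :=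
  h.schemeEdges_eq ▸ (h.goodScheme hL hs).isPolygonalLink

theorem dot_combo (a q q' : ℝ × ℝ) (s t : ℝ) : dot a (s • q + t • q') = s * dot a q + t * dot a q' := by
  simp [dot]; ring

theorem combo_lt {s t a b a' b' : ℝ} (hs : 0 ≤ s) (ht : 0 ≤ t) (hst : s + t = 1) (h : a < b)
    (h' : a' < b') : s * a + t * a' < s * b + t * b' := by
  rcases hs.eq_or_lt with rfl | hs
  · obtain rfl : t = 1 := by linarith
    linarith
  · nlinarith [mul_pos hs (sub_pos.2 h), mul_nonneg ht (sub_pos.2 h').le]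

/-- Closed braids are isotopic if each pair of strands is separated in both braids by the same
functionals. -/
theorem isotopic_cfgEdges [Finite K] (hL : 1 ≤ L) {x' : ℕ → ℝ} {c' : ℕ → K → ℝ × ℝ}
    (h : IsCfg L π x c) (h' : IsCfg L π x' c')
    (hs : ∀ j < L + 3, ∀ k k', k ≠ k' → ∃ a, CellSep L j a c k k' ∧ CellSep L j a c' k k') :
    PolyIsotopic (cfgEdges L x c) (cfgEdges L x' c') := by
  choose! a ha using hs
  -- One functional is fixed for each cell and each pair. The configurations separated by these are
  -- cut out by linear inequalities, so they form a convex set containing both given ones.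
  set S : Set (Fin (L + 3) × K → Pt) := {p | ∃ x c, IsCfg L π x c ∧
    (∀ j < L + 3, ∀ k k', k ≠ k' → CellSep L j (a j k k') c k k') ∧ p = cfgVertex L x c} with hS
  have hconv : Convex ℝ S := by
    rintro _ ⟨x, c, h, hc, rfl⟩ _ ⟨x', c', h', hc', rfl⟩ s t hs ht hst
    refine ⟨s • x + t • x', s • c + t • c', ⟨?_, ?_, ?_⟩, ?_, ?_⟩
    · intro j hj
      simpa using combo_lt hs ht hst (h.lt j hj) (h'.lt j hj)
    · intro j k
      simp only [Pi.add_apply, Pi.smul_apply, Prod.snd_add, Prod.smul_snd, smul_eq_mul]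
      have := h.nonneg j k
      have := h'.nonneg j k
      positivity
    · intro k
      simp [h.wrap, h'.wrap]
    · intro j hj k k' hk
      obtain ⟨⟨h1, h2⟩, h3⟩ := hc j hj k k' hk
      obtain ⟨⟨h1', h2'⟩, h3'⟩ := hc' j hj k k' hk
      simp only [CellSep, Pi.add_apply, Pi.smul_apply, dot_combo]
      exact ⟨⟨combo_lt hs ht hst h1 h1', combo_lt hs ht hst h2 h2'⟩, fun hj =>
        ⟨combo_lt hs ht hst (h3 hj).1 (h3' hj).1, combo_lt hs ht hst (h3 hj).2 (h3' hj).2⟩⟩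
    · funext v
      simp only [cfgVertex, Pi.add_apply, Pi.smul_apply, place_combo x x' _ _ hst]
  have := isotopic_of_convex (nx := cfgNext L π) (cfgNext_ne L π) hconv
    (by
      rintro _ ⟨x, c, h, hc, rfl⟩
      exact h.goodScheme hL fun j hj k k' hk => ⟨_, hc j hj k k' hk⟩)
    (p := cfgVertex L x c) (q := cfgVertex L x' c')
    ⟨x, c, h, fun j hj k k' hk => (ha j hj k k' hk).1, rfl⟩
    ⟨x', c', h', fun j hj k k' hk => (ha j hj k k' hk).2, rfl⟩
  rwa [h.schemeEdges_eq, h'.schemeEdges_eq] at this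

theorem CellSep.neg {a : ℝ × ℝ} {j : ℕ} {k k' : K} (h : CellSep L j a c k k') :
    CellSep L j (-a) c k' k := by
  have : ∀ q, dot (-a) q = -dot a q := fun q => by simp [dot]; ring
  obtain ⟨⟨h1, h2⟩, h3⟩ := h
  simp only [CellSep, this, neg_lt_neg_iff]
  exact ⟨⟨h1, h2⟩, fun hj => ⟨(h3 hj).2, (h3 hj).1⟩⟩

end Cfg

/-! ### Closed braids from words -/

section Words

variable {n : ℕ}

/-- A letter of a braid word, or `none`, which leaves all strands straight. -/
abbrev GLetter (n : ℕ) : Type := Option (BraidGen n × Bool)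

/-- The left one of the positions that are interchanged by a generator. -/
def BraidGen.lo (i : BraidGen n) : Fin n := ⟨i.1 - 1, by have := i.2; omega⟩

/-- The right one of the positions that are interchanged by a generator. -/
def BraidGen.hi (i : BraidGen n) : Fin n := ⟨i.1, i.2.2⟩

/-- The position which the upper strand of a letter leaves. -/
def overPos (a : BraidGen n × Bool) : Fin n := if a.2 then a.1.lo else a.1.hi

/-- The position which the lower strand of a letter leaves. -/
def underPos (a : BraidGen n × Bool) : Fin n := if a.2 then a.1.hi else a.1.lo

theorem overPos_ne_underPos (a : BraidGen n × Bool) : overPos a ≠ underPos a := by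
  rcases a with ⟨⟨i, h1, h2⟩, _ | _⟩ <;>
    simp [overPos, underPos, BraidGen.lo, BraidGen.hi] <;> omega

/-- The permutation of the positions by a letter. -/
def letterPerm : GLetter n → Equiv.Perm (Fin n)
  | none => 1
  | some a => Equiv.swap (overPos a) (underPos a)

/-- The permutation of the positions by a word. -/
def wordPerm : List (GLetter n) → Equiv.Perm (Fin n)
  | [] => 1
  | a :: w => wordPerm w * letterPerm a

theorem wordPerm_append (u v : List (GLetter n)) :
    wordPerm (u ++ v) = wordPerm v * wordPerm u := by
  induction u with
  | nil => simp [wordPerm]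
  | cons a u ih => simp [wordPerm, ih, mul_assoc]

/-- The `y`-coordinate of a position. -/
def gridY (k : Fin n) : ℝ := -((k : ℕ) + 1 : ℝ)

/-- The configuration of the strands in the middle of a letter. -/
noncomputable def letterMid : GLetter n → Fin n → ℝ × ℝ
  | none, k => (gridY k, 0)
  | some a, k => if k = overPos a then (-(a.1.1 + 1 / 2 : ℝ), 1)
      else if k = underPos a then (-(a.1.1 + 1 / 2 : ℝ), 0) else (gridY k, 0)

/-- The configurations of the strands of a word, with two steps for each letter. Strands are
labelled by their positions at the beginning. -/
noncomputable def wordC : List (GLetter n) → ℕ → Fin n → ℝ × ℝ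
  | [], _, k => (gridY k, 0)
  | _ :: _, 0, k => (gridY k, 0)
  | a :: _, 1, k => letterMid a k
  | a :: w, j + 2, k => wordC w j (letterPerm a k)

@[simp] theorem wordC_zero (w : List (GLetter n)) (k : Fin n) : wordC w 0 k = (gridY k, 0) := by
  cases w <;> rfl

theorem wordC_append_left (u v : List (GLetter n)) {j : ℕ} (hj : j ≤ 2 * u.length) (k : Fin n) :
    wordC (u ++ v) j k = wordC u j k := by
  induction u generalizing j k with
  | nil =>
    obtain rfl : j = 0 := by simpa using hj
    simp
  | cons a u ih =>
    match j with
    | 0 => rfl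
    | 1 => rfl
    | j + 2 => exact ih (by simp at hj; omega) _

theorem wordC_append_right (u v : List (GLetter n)) (j : ℕ) (k : Fin n) :
    wordC (u ++ v) (2 * u.length + j) k = wordC v j (wordPerm u k) := by
  induction u generalizing k with
  | nil => simp [wordPerm]
  | cons a u ih =>
    rw [show 2 * (a :: u).length + j = (2 * u.length + j) + 2 by simp; ring]
    exact ih _

theorem wordC_ge (w : List (GLetter n)) {j : ℕ} (hj : 2 * w.length ≤ j) (k : Fin n) :
    wordC w j k = (gridY (wordPerm w k), 0) := by
  obtain ⟨i, rfl⟩ := Nat.exists_eq_add_of_le hj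
  have := wordC_append_right w [] i k
  rwa [List.append_nil] at this

theorem letterMid_snd (a : GLetter n) (k : Fin n) :
    0 ≤ (letterMid a k).2 ∧ (letterMid a k).2 ≤ 1 := by
  rcases a with _ | a
  · simp [letterMid]
  · simp only [letterMid]; split_ifs <;> simp

theorem wordC_snd (w : List (GLetter n)) (j : ℕ) (k : Fin n) :
    0 ≤ (wordC w j k).2 ∧ (wordC w j k).2 ≤ 1 := by
  induction w generalizing j k with
  | nil => simp [wordC]
  | cons a w ih =>
    match j with
    | 0 => simp
    | 1 => exact letterMid_snd a k
    | j + 2 => exact ih _ _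

theorem gridY_injective : Function.Injective (gridY (n := n)) := by
  intro k k' h
  simp only [gridY, neg_inj, add_left_inj, Nat.cast_inj] at h
  exact Fin.ext h

theorem gridY_lt {k k' : Fin n} : gridY k < gridY k' ↔ k' < k := by
  simp only [gridY, neg_lt_neg_iff, add_lt_add_iff_right, Nat.cast_lt, Fin.lt_def]

theorem isCfg_wordC (w : List (GLetter n)) {x : ℕ → ℝ} (hx : StrictMono x) :
    IsCfg (2 * w.length) (wordPerm w) x (wordC w) where
  lt _ _ := hx (Nat.lt_succ_self _)
  nonneg j k := (wordC_snd w j k).1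
  wrap k := by rw [wordC_ge w (by omega), wordC_zero]

/-- The functional `a` puts the strand `k'` before `k` on the pages `j` and `j + 1`. -/
def SlabSep (a : ℝ × ℝ) (c : ℕ → Fin n → ℝ × ℝ) (j : ℕ) (k k' : Fin n) : Prop :=
  dot a (c j k) < dot a (c j k') ∧ dot a (c (j + 1) k) < dot a (c (j + 1) k')

theorem SlabSep.neg {a : ℝ × ℝ} {c : ℕ → Fin n → ℝ × ℝ} {j : ℕ} {k k' : Fin n}
    (h : SlabSep a c j k k') : SlabSep (-a) c j k' k := by
  have : ∀ q, dot (-a) q = -dot a q := fun q => by simp [dot]; ring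
  simpa [SlabSep, this] using h

theorem SlabSep.cellSep {a : ℝ × ℝ} {c : ℕ → Fin n → ℝ × ℝ} {j : ℕ} {k k' : Fin n} {L : ℕ}
    (h : SlabSep a c j k k') (hj : j < L) : CellSep L j a c k k' :=
  ⟨h, fun h' => absurd hj (by omega)⟩

/-- Apart from the two strands that cross, the order in the `y`-direction is the same at the
beginning, in the middle and at the end of a letter. -/
theorem letter_lt (a : BraidGen n × Bool) {k k' : Fin n} (hkk : k' < k)
    (h : ¬(k = overPos a ∧ k' = underPos a)) (h' : ¬(k = underPos a ∧ k' = overPos a)) :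
    (letterMid (some a) k).1 < (letterMid (some a) k').1 ∧
      gridY (letterPerm (some a) k) < gridY (letterPerm (some a) k') := by
  rcases a with ⟨⟨i, h1, h2⟩, b⟩
  rw [gridY_lt]
  have hcast : ∀ {p q : ℕ}, p + 1 ≤ q → (p : ℝ) + 1 ≤ q := fun h => by exact_mod_cast h
  -- Positions in `Fin n` start at `0`, so `σ_i` exchanges `i - 1` and `i`; this is encoded
  -- symmetrically in the two strands by `o + u + 1 = 2 * i`, to serve both signs.
  have key : ∀ o u : Fin n, (o : ℕ) + u + 1 = 2 * i → (o : ℕ) ≠ u → ((o : ℕ) = i ∨ (o : ℕ) + 1 = i) →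
      ¬(k = o ∧ k' = u) → ¬(k = u ∧ k' = o) →
      (if k = o then ((-(i + 1 / 2 : ℝ), 1) : ℝ × ℝ) else if k = u then (-(i + 1 / 2 : ℝ), 0)
        else (gridY k, 0)).1 < (if k' = o then ((-(i + 1 / 2 : ℝ), 1) : ℝ × ℝ)
        else if k' = u then (-(i + 1 / 2 : ℝ), 0) else (gridY k', 0)).1 ∧
      Equiv.swap o u k' < Equiv.swap o u k := by
    intro o u hou hne ho n1 n2
    have e : ((o : ℕ) : ℝ) + (u : ℕ) + 1 = 2 * i := by exact_mod_cast hou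
    simp only [Equiv.swap_apply_def]
    simp only [Fin.ext_iff] at *
    rw [Fin.lt_def] at hkk
    constructor
    · split_ifs <;> simp only [gridY] <;> first
        | omega
        | (rw [neg_lt_neg_iff]
           first
            | (have := hcast (p := k') (q := k) (by omega); linarith)
            | (have := hcast (p := k' + 1) (q := i) (by omega); push_cast at this; linarith)
            | (have := hcast (p := i) (q := k) (by omega); linarith))
    · split_ifs <;> rw [Fin.lt_def] <;> omega
  cases b
  · exact key _ _ (by simp [overPos, underPos, BraidGen.lo, BraidGen.hi]; omega)
      (by simp [overPos, underPos, BraidGen.lo, BraidGen.hi]; omega)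
      (by simp [overPos, BraidGen.hi]) h h'
  · exact key _ _ (by simp [overPos, underPos, BraidGen.lo, BraidGen.hi]; omega)
      (by simp [overPos, underPos, BraidGen.lo, BraidGen.hi]; omega)
      (by simp [overPos, BraidGen.lo]; omega) h h'

/-- In the middle of a crossing both strands have the same `y` and are told apart by height; before
and after it they are told apart by `y`. A tilted functional `(±1, 1)` handles each half. All other
pairs need only the `y`-order. The sign condition `0 ≤ d.2` permits raising the upper strand later.
-/
theorem letter_slabSep (a : GLetter n) (w : List (GLetter n)) {k k' : Fin n} (hkk : k ≠ k')
    (h : ∀ b, a = some b → ¬(k = overPos b ∧ k' = underPos b)) {j : ℕ} (hj : j < 2) :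
    ∃ d : ℝ × ℝ, 0 ≤ d.2 ∧ SlabSep d (wordC (a :: w)) j k k' := by
  have e0 : ∀ k, wordC (a :: w) 0 k = (gridY k, 0) := fun _ => rfl
  have e1 : ∀ k, wordC (a :: w) 1 k = letterMid a k := fun _ => rfl
  have e2 : ∀ k, wordC (a :: w) 2 k = (gridY (letterPerm a k), 0) := fun k => wordC_zero w _
  by_cases hc : ∃ b, a = some b ∧ k = underPos b ∧ k' = overPos b
  · obtain ⟨⟨⟨i, h1, h2⟩, b⟩, rfl, rfl, rfl⟩ := hc
    have hi : ((i - 1 : ℕ) : ℝ) = i - 1 := by push_cast [h1]; ring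
    have hne : (⟨i - 1, by omega⟩ : Fin n) ≠ ⟨i, h2⟩ := by simp; omega
    obtain rfl | rfl : j = 0 ∨ j = 1 := by omega
    · cases b
      · refine ⟨(-1, 1), by simp, ?_, ?_⟩
        · rw [e0, e0]; simp [dot, gridY, overPos, underPos, BraidGen.lo, BraidGen.hi, hi]
        · rw [e1, e1]
          simp [dot, letterMid, overPos, underPos, BraidGen.lo, BraidGen.hi, hne]
      · refine ⟨(1, 1), by simp, ?_, ?_⟩
        · rw [e0, e0]; simp [dot, gridY, overPos, underPos, BraidGen.lo, BraidGen.hi, hi]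
        · rw [e1, e1]
          simp [dot, letterMid, overPos, underPos, BraidGen.lo, BraidGen.hi, hne.symm]
    · cases b
      · refine ⟨(1, 1), by simp, ?_, ?_⟩
        · rw [e1, e1]
          simp [dot, letterMid, overPos, underPos, BraidGen.lo, BraidGen.hi, hne]
        · rw [e2, e2]
          simp [dot, letterPerm, gridY, overPos, underPos, BraidGen.lo, BraidGen.hi, hi]
      · refine ⟨(-1, 1), by simp, ?_, ?_⟩
        · rw [e1, e1]
          simp [dot, letterMid, overPos, underPos, BraidGen.lo, BraidGen.hi, hne.symm]
        · rw [e2, e2]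
          simp [dot, letterPerm, gridY, overPos, underPos, BraidGen.lo, BraidGen.hi, hi]
  · push Not at hc
    have key : ∀ k k' : Fin n, k' < k → (∀ b, a = some b → ¬(k = overPos b ∧ k' = underPos b)) →
        (∀ b, a = some b → ¬(k = underPos b ∧ k' = overPos b)) →
        SlabSep (1, 0) (wordC (a :: w)) j k k' := by
      intro k k' hlt n1 n2
      have f1 : (letterMid a k).1 < (letterMid a k').1 ∧
          gridY (letterPerm a k) < gridY (letterPerm a k') := by
        rcases a with _ | b
        · simpa [letterMid, letterPerm, gridY_lt] using hlt
        · exact letter_lt b hlt (n1 b rfl) (n2 b rfl)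
      obtain rfl | rfl : j = 0 ∨ j = 1 := by omega
      · exact ⟨by rw [e0, e0]; simpa [dot, gridY_lt] using hlt,
          by rw [e1, e1]; simpa [dot] using f1.1⟩
      · exact ⟨by rw [e1, e1]; simpa [dot] using f1.1,
          by rw [e2, e2]; simpa [dot] using f1.2⟩
    rcases lt_or_gt_of_ne hkk with hlt | hlt
    · refine ⟨-(1, 0), by simp, (key k' k hlt ?_ ?_).neg⟩
      · exact fun b hb h3 => hc b hb h3.2 h3.1
      · exact fun b hb h3 => h b hb ⟨h3.2, h3.1⟩
    · exact ⟨(1, 0), le_rfl, key k k' hlt h fun b hb h3 => hc b hb h3.1 h3.2⟩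

theorem grid_sep {k k' : Fin n} (h : k ≠ k') :
    ∃ a : ℝ × ℝ, a.2 = 0 ∧ dot a (gridY k, 0) < dot a (gridY k', 0) := by
  rcases lt_or_gt_of_ne h with h | h
  · exact ⟨(-1, 0), rfl, by simpa [dot, gridY_lt] using h⟩
  · exact ⟨(1, 0), rfl, by simpa [dot, gridY_lt] using h⟩

theorem wordC_slabSep (w : List (GLetter n)) (j : ℕ) {k k' : Fin n} (h : k ≠ k') :
    ∃ a, SlabSep a (wordC w) j k k' := by
  induction w generalizing j k k' with
  | nil =>
    obtain ⟨a, -, ha⟩ := grid_sep h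
    exact ⟨a, ha, ha⟩
  | cons b w ih =>
    rcases lt_or_ge j 2 with hj | hj
    · by_cases hc : ∃ b', b = some b' ∧ k = overPos b' ∧ k' = underPos b'
      · obtain ⟨b', rfl, rfl, rfl⟩ := hc
        obtain ⟨d, -, hd⟩ := letter_slabSep (some b') w h.symm
          (by rintro _ ⟨⟩ ⟨h1, -⟩; exact h h1.symm) hj
        exact ⟨-d, hd.neg⟩
      · push Not at hc
        obtain ⟨d, -, hd⟩ := letter_slabSep b w h (fun b' hb h3 => hc b' hb h3.1 h3.2) hj
        exact ⟨d, hd⟩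
    · obtain ⟨j, rfl⟩ := Nat.exists_eq_add_of_le' hj
      exact ih j (k := letterPerm b k) (k' := letterPerm b k') (by simpa using h)

/-! ### Layered words and their replacement. -/

/-- At each crossing of the word, the value of `h` is larger for the upper strand. -/
def Layered (h : Fin n → ℝ) : List (GLetter n) → Prop
  | [] => True
  | none :: w => Layered h w
  | some a :: w => h (underPos a) < h (overPos a) ∧
      Layered (fun k => h (Equiv.swap (overPos a) (underPos a) k)) w

/-- The higher strand is the upper one whenever the pair crosses, so every functional can be taken
nondecreasing in the height. -/
theorem Layered.slabSep {h : Fin n → ℝ} {w : List (GLetter n)} (hw : Layered h w) (j : ℕ)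
    {k k' : Fin n} (hk : h k < h k') : ∃ a : ℝ × ℝ, 0 ≤ a.2 ∧ SlabSep a (wordC w) j k k' := by
  have hkk : k ≠ k' := by rintro rfl; exact lt_irrefl _ hk
  induction w generalizing h j k k' with
  | nil =>
    obtain ⟨a, ha0, ha⟩ := grid_sep hkk
    exact ⟨a, ha0.ge, ha, ha⟩
  | cons b w ih =>
    rcases lt_or_ge j 2 with hj | hj
    · refine letter_slabSep b w hkk ?_ hj
      rintro b' rfl ⟨rfl, rfl⟩
      exact lt_asymm hw.1 hk
    · obtain ⟨j, rfl⟩ := Nat.exists_eq_add_of_le' hj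
      rcases b with _ | b
      · exact ih (h := h) hw j hk hkk
      · exact ih hw.2 j (k := letterPerm (some b) k) (k' := letterPerm (some b) k')
          (by simpa [letterPerm] using hk) (by simpa using hkk)

/-- The closure of a word, with two steps for each letter. -/
def wordLink (w : List (GLetter n)) : Set (Pt × Pt) :=
  cfgEdges (2 * w.length) (fun j => (j : ℝ) / 2) (wordC w)

theorem strictMono_half : StrictMono fun j : ℕ => (j : ℝ) / 2 := by
  intro i j h
  have : (i : ℝ) < j := by exact_mod_cast h
  simp only
  linarith

theorem wordC_cellSep_of_ge (w : List (GLetter n)) {L j : ℕ} (hj : 2 * w.length ≤ j)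
    {k k' : Fin n} (h : k ≠ k') : ∃ a, CellSep L j a (wordC w) k k' := by
  obtain ⟨a, -, ha⟩ := grid_sep ((wordPerm w).injective.ne h)
  refine ⟨a, ?_⟩
  simp only [CellSep, wordC_ge w hj, wordC_ge w (show 2 * w.length ≤ j + 1 by omega)]
  exact ⟨⟨ha, ha⟩, fun _ => ⟨ha, ha⟩⟩

theorem wordC_cellSep (w : List (GLetter n)) (j : ℕ) {k k' : Fin n} (h : k ≠ k') :
    ∃ a, CellSep (2 * w.length) j a (wordC w) k k' := by
  rcases lt_or_ge j (2 * w.length) with hj | hj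
  · obtain ⟨a, ha⟩ := wordC_slabSep w j h
    exact ⟨a, ha.cellSep hj⟩
  · exact wordC_cellSep_of_ge w hj h

theorem isPolygonalLink_wordLink {w : List (GLetter n)} (hw : w ≠ []) :
    IsPolygonalLink (wordLink w) :=
  (isCfg_wordC w strictMono_half).isPolygonalLink
    (by have := List.length_pos_iff.2 hw; omega) fun j _ _ _ h => wordC_cellSep w j h

/-- The configurations `c`, with radial coordinates replaced by `h` on the pages strictly between
`i` and `i'`. -/
noncomputable def raise (i i' : ℕ) (h : Fin n → ℝ) (c : ℕ → Fin n → ℝ × ℝ) (j : ℕ) (k : Fin n) :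
    ℝ × ℝ :=
  if i < j ∧ j < i' then ((c j k).1, h k) else c j k

/-- The number `α` has the sign of `d` and is so small that `α * e` and `α * e'` exceed `-1`. The
functional `(α, 1)` then separates two strands at height zero by their `y`-coordinates, and on the
adjacent page by a height gap of at least `1`. -/
theorem exists_tilt {d : ℝ} (hd : d ≠ 0) (e e' : ℝ) :
    ∃ α : ℝ, 0 < α * d ∧ -1 < α * e ∧ -1 < α * e' := by
  have hp : 0 < 1 + |d * e| + |d * e'| := by positivity
  have key : ∀ e : ℝ, |d * e| < 1 + |d * e| →
      |d * e| < 1 + |d * e'| + |d * e| := fun e _ => by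
    linarith [abs_nonneg (d * e')]
  refine ⟨d / (1 + |d * e| + |d * e'|), ?_, ?_, ?_⟩
  · rw [div_mul_eq_mul_div]
    exact div_pos (mul_self_pos.2 hd) hp
  · rw [div_mul_eq_mul_div, lt_div_iff₀ hp]
    linarith [neg_abs_le (d * e), abs_nonneg (d * e')]
  · rw [div_mul_eq_mul_div, lt_div_iff₀ hp]
    linarith [neg_abs_le (d * e'), abs_nonneg (d * e)]

theorem exists_cellSep_of_symm {L : ℕ} {c c' : ℕ → Fin n → ℝ × ℝ} {g : Fin n → ℝ}
    (hg : Function.Injective g) {j : ℕ}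
    (h : ∀ k k', g k < g k' → ∃ a, CellSep L j a c k k' ∧ CellSep L j a c' k k') {k k' : Fin n}
    (hk : k ≠ k') : ∃ a, CellSep L j a c k k' ∧ CellSep L j a c' k k' := by
  rcases lt_or_gt_of_ne (hg.ne hk) with h1 | h1
  · exact h k k' h1
  · obtain ⟨a, h2, h3⟩ := h k' k h1
    exact ⟨-a, h2.neg, h3.neg⟩

/-- Each strand of the layered word is lifted to its own constant height. The functionals that
separate the original strands still do so after lifting. -/
theorem isotopic_raise {h : Fin n → ℝ} (h0 : ∀ k, 0 ≤ h k)
    (h1 : ∀ k k', k ≠ k' → h k + 1 ≤ h k' ∨ h k' + 1 ≤ h k) (u w v : List (GLetter n))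
    (hw : Layered h w) (hne : w ≠ []) :
    PolyIsotopic (wordLink (u ++ (w ++ v))) (cfgEdges (2 * (u ++ (w ++ v)).length)
      (fun j => (j : ℝ) / 2) (raise (2 * u.length) (2 * u.length + 2 * w.length)
        (fun k => h (wordPerm u k)) (wordC (u ++ (w ++ v))))) := by
  have hlen := List.length_pos_iff.2 hne
  have hin : Function.Injective fun k => h (wordPerm u k) := by
    intro k k' he
    by_contra hkk
    have he : h (wordPerm u k) = h (wordPerm u k') := he
    rcases h1 _ _ ((wordPerm u).injective.ne hkk) with h2 | h2 <;> linarith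
  have hcfg := isCfg_wordC (u ++ (w ++ v)) strictMono_half
  refine isotopic_cfgEdges (by simp only [List.length_append]; omega) hcfg
    ⟨hcfg.lt, fun j k => ?_, fun k => ?_⟩ ?_
  · unfold raise
    split_ifs
    exacts [h0 _, (wordC_snd _ _ _).1]
  · have := hcfg.wrap k
    simp only [List.length_append] at this ⊢
    rw [raise, raise, if_neg (by omega), if_neg (by omega), this]
  · intro j hj k k' hkk
    by_cases hc : 2 * u.length ≤ j ∧ j < 2 * u.length + 2 * w.length
    · refine exists_cellSep_of_symm hin (fun k k' hlt => ?_) hkk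
      obtain ⟨i, rfl⟩ := Nat.exists_eq_add_of_le hc.1
      have hwi : ∀ i ≤ 2 * w.length, ∀ k, wordC (u ++ (w ++ v)) (2 * u.length + i) k =
          wordC w i (wordPerm u k) := fun i hi k => by
        rw [wordC_append_right, wordC_append_left _ _ hi]
      obtain ⟨a, ha0, ha1, ha2⟩ := hw.slabSep i hlt
      have hgap : h (wordPerm u k) + 1 ≤ h (wordPerm u k') := by
        rcases h1 (wordPerm u k) (wordPerm u k') (fun he => by
          have hlt : h (wordPerm u k) < h (wordPerm u k') := hlt
          rw [he] at hlt; exact lt_irrefl _ hlt) with h2 | h2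
        · exact h2
        · have hlt : h (wordPerm u k) < h (wordPerm u k') := hlt
          linarith
      -- Heights within a word lie in `[0, 1]`, while the layers differ by at least `1`; the height
      -- difference does not decrease, and its coefficient is nonnegative.
      have up : ∀ i ≤ 2 * w.length, dot a (wordC w i (wordPerm u k)) <
          dot a (wordC w i (wordPerm u k')) →
          dot a (raise (2 * u.length) (2 * u.length + 2 * w.length) (fun k => h (wordPerm u k))
            (wordC (u ++ (w ++ v))) (2 * u.length + i) k) <
          dot a (raise (2 * u.length) (2 * u.length + 2 * w.length) (fun k => h (wordPerm u k))
            (wordC (u ++ (w ++ v))) (2 * u.length + i) k') := by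
        intro i hi hlt
        simp only [raise, hwi i hi]
        split_ifs with hs
        · have r1 := (wordC_snd w i (wordPerm u k)).1
          have r2 := (wordC_snd w i (wordPerm u k')).2
          simp only [dot] at hlt ⊢
          have := mul_le_mul_of_nonneg_left (show (wordC w i (wordPerm u k')).2 -
            (wordC w i (wordPerm u k)).2 ≤ h (wordPerm u k') - h (wordPerm u k) by linarith) ha0
          linarith
        · exact hlt
      have hjL : 2 * u.length + i < 2 * (u ++ (w ++ v)).length := by
        simp only [List.length_append]; omega
      refine ⟨a, SlabSep.cellSep ⟨?_, ?_⟩ hjL, SlabSep.cellSep ⟨?_, ?_⟩ hjL⟩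
      · rw [hwi i (by omega), hwi i (by omega)]; exact ha1
      · rw [add_assoc, hwi _ (by omega), hwi _ (by omega)]; exact ha2
      · exact up i (by omega) ha1
      · exact up (i + 1) (by omega) ha2
    · obtain ⟨a, ha⟩ := wordC_cellSep (u ++ (w ++ v)) j hkk
      refine ⟨a, ha, ?_⟩
      unfold CellSep at ha ⊢
      simp only [raise, if_neg (show ¬(2 * u.length < j ∧ j < 2 * u.length + 2 * w.length) by omega),
        if_neg (show ¬(2 * u.length < j + 1 ∧ j + 1 < 2 * u.length + 2 * w.length) by omega)]
      exact ha

/-- Two words of the same length with the same permutation may replace each other if the strands of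
both can be put in the same layers. -/
theorem isotopic_of_layered {h : Fin n → ℝ} (h0 : ∀ k, 0 ≤ h k)
    (h1 : ∀ k k', k ≠ k' → h k + 1 ≤ h k' ∨ h k' + 1 ≤ h k) (u : List (GLetter n))
    {w w' : List (GLetter n)} (v : List (GLetter n)) (hw : Layered h w) (hw' : Layered h w')
    (hne : w ≠ []) (hlen : w.length = w'.length) (hperm : wordPerm w = wordPerm w') :
    PolyIsotopic (wordLink (u ++ (w ++ v))) (wordLink (u ++ (w' ++ v))) := by
  have hl := List.length_pos_iff.2 hne
  have hne' : w' ≠ [] := List.length_pos_iff.1 (hlen ▸ hl)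
  have s1 := isotopic_raise h0 h1 u w v hw hne
  have s3 := isotopic_raise h0 h1 u w' v hw' hne'
  -- Both words are raised into the same layers; it remains to compare the two raised
  -- configurations.
  refine s1.trans (PolyIsotopic.trans ?_ s3.symm)
  have hin : Function.Injective fun k => h (wordPerm u k) := by
    intro k k' he
    by_contra hkk
    have he : h (wordPerm u k) = h (wordPerm u k') := he
    rcases h1 _ _ ((wordPerm u).injective.ne hkk) with h2 | h2 <;> linarith
  have hcfg := isCfg_wordC (u ++ (w ++ v)) strictMono_half
  have hcfg' := isCfg_wordC (u ++ (w' ++ v)) strictMono_half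
  have hpp : wordPerm (u ++ (w' ++ v)) = wordPerm (u ++ (w ++ v)) := by
    simp only [wordPerm_append, hperm]
  have hll : (u ++ (w' ++ v)).length = (u ++ (w ++ v)).length := by
    simp only [List.length_append, hlen]
  rw [hpp, hll] at hcfg'
  rw [hll, ← hlen]
  set L := (u ++ (w ++ v)).length with hL
  have hLval : L = u.length + (w.length + v.length) := by simp [hL]
  have hraise : ∀ (c : ℕ → Fin n → ℝ × ℝ), IsCfg (2 * L) (wordPerm (u ++ (w ++ v)))
      (fun j => (j : ℝ) / 2) c → IsCfg (2 * L) (wordPerm (u ++ (w ++ v))) (fun j => (j : ℝ) / 2)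
        (raise (2 * u.length) (2 * u.length + 2 * w.length) (fun k => h (wordPerm u k)) c) := by
    intro c hc
    refine ⟨hc.lt, fun j k => ?_, fun k => ?_⟩
    · unfold raise
      split_ifs
      exacts [h0 _, hc.nonneg _ _]
    · rw [raise, raise, if_neg (by omega), if_neg (by omega), hc.wrap]
  refine isotopic_cfgEdges (by omega) (hraise _ hcfg) (hraise _ hcfg') ?_
  intro j hj k k' hkk
  by_cases hc : 2 * u.length ≤ j ∧ j < 2 * u.length + 2 * w.length
  · refine exists_cellSep_of_symm hin (fun k k' hlt => ?_) hkk
    have hkk' : wordPerm u k ≠ wordPerm u k' := fun he => by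
      have hlt : h (wordPerm u k) < h (wordPerm u k') := hlt
      rw [he] at hlt; exact lt_irrefl _ hlt
    have hgap : h (wordPerm u k) + 1 ≤ h (wordPerm u k') := by
      have hlt : h (wordPerm u k) < h (wordPerm u k') := hlt
      rcases h1 _ _ hkk' with h2 | h2 <;> linarith
    have hjL : j < 2 * L := by omega
    have bot : ∀ k, wordC (u ++ (w ++ v)) (2 * u.length) k = (gridY (wordPerm u k), 0) ∧
        wordC (u ++ (w' ++ v)) (2 * u.length) k = (gridY (wordPerm u k), 0) := fun k =>
      ⟨by simpa using wordC_append_right u (w ++ v) 0 k,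
        by simpa using wordC_append_right u (w' ++ v) 0 k⟩
    have top : ∀ k, wordC (u ++ (w ++ v)) (2 * u.length + 2 * w.length) k =
        (gridY (wordPerm w (wordPerm u k)), 0) ∧
        wordC (u ++ (w' ++ v)) (2 * u.length + 2 * w.length) k =
        (gridY (wordPerm w (wordPerm u k)), 0) := fun k => by
      constructor
      · rw [wordC_append_right, wordC_append_left _ _ le_rfl, wordC_ge _ le_rfl]
      · rw [wordC_append_right, wordC_append_left _ _ (by omega), wordC_ge _ (by omega), hperm]
    rcases Nat.lt_or_ge (2 * u.length) j with h2 | h2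
    · rcases Nat.lt_or_ge (j + 1) (2 * u.length + 2 * w.length) with h3 | h3
      -- Strictly inside the replaced part the heights alone separate, whatever the horizontal
      -- positions.
      · refine ⟨(0, 1), SlabSep.cellSep ⟨?_, ?_⟩ hjL, SlabSep.cellSep ⟨?_, ?_⟩ hjL⟩ <;>
          simp only [raise, dot] <;> rw [if_pos (by omega), if_pos (by omega)] <;>
          linarith
      -- The last half letter descends from the layers to the grid, where both words end in the same
      -- positions; a tilted functional covers both ends of it.
      · obtain ⟨α, a1, a2, a3⟩ := exists_tilt (d := gridY (wordPerm w (wordPerm u k')) -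
          gridY (wordPerm w (wordPerm u k)))
          (sub_ne_zero.2 (gridY_injective.ne ((wordPerm w).injective.ne hkk'.symm)))
          ((wordC (u ++ (w ++ v)) j k').1 - (wordC (u ++ (w ++ v)) j k).1)
          ((wordC (u ++ (w' ++ v)) j k').1 - (wordC (u ++ (w' ++ v)) j k).1)
        obtain h4 : j + 1 = 2 * u.length + 2 * w.length := by omega
        refine ⟨(α, 1), SlabSep.cellSep ⟨?_, ?_⟩ hjL, SlabSep.cellSep ⟨?_, ?_⟩ hjL⟩
        · simp only [raise, dot]; rw [if_pos (by omega), if_pos (by omega)]; linarith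
        · simp only [raise, dot]; rw [if_neg (by omega), if_neg (by omega), h4, (top k).1, (top k').1]
          simp only; linarith
        · simp only [raise, dot]; rw [if_pos (by omega), if_pos (by omega)]; linarith
        · simp only [raise, dot]; rw [if_neg (by omega), if_neg (by omega), h4, (top k).2, (top k').2]
          simp only; linarith
    · obtain rfl : j = 2 * u.length := by omega
      obtain ⟨α, a1, a2, a3⟩ := exists_tilt (d := gridY (wordPerm u k') - gridY (wordPerm u k))
        (sub_ne_zero.2 (gridY_injective.ne hkk'.symm))
        ((wordC (u ++ (w ++ v)) (2 * u.length + 1) k').1 -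
          (wordC (u ++ (w ++ v)) (2 * u.length + 1) k).1)
        ((wordC (u ++ (w' ++ v)) (2 * u.length + 1) k').1 -
          (wordC (u ++ (w' ++ v)) (2 * u.length + 1) k).1)
      refine ⟨(α, 1), SlabSep.cellSep ⟨?_, ?_⟩ hjL, SlabSep.cellSep ⟨?_, ?_⟩ hjL⟩
      · simp only [raise, dot]; rw [if_neg (by omega), if_neg (by omega), (bot k).1, (bot k').1]
        simp only; linarith
      · simp only [raise, dot]; rw [if_pos (by omega), if_pos (by omega)]; linarith
      · simp only [raise, dot]; rw [if_neg (by omega), if_neg (by omega), (bot k).2, (bot k').2]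
        simp only; linarith
      · simp only [raise, dot]; rw [if_pos (by omega), if_pos (by omega)]; linarith
  -- Outside the replaced part the two configurations coincide, because the words have equal lengths
  -- and permutations.
  · have hsame : ∀ i, (i ≤ 2 * u.length ∨ 2 * u.length + 2 * w.length ≤ i) → ∀ k,
        wordC (u ++ (w' ++ v)) i k = wordC (u ++ (w ++ v)) i k := by
      rintro i (hi | hi) k
      · rw [wordC_append_left _ _ hi, wordC_append_left _ _ hi]
      · obtain ⟨i, rfl⟩ := Nat.exists_eq_add_of_le hi
        rw [add_assoc, wordC_append_right, wordC_append_right, wordC_append_right, hlen,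
          wordC_append_right, hperm]
    obtain ⟨a, ha⟩ := wordC_cellSep (u ++ (w ++ v)) j hkk
    refine ⟨a, ?_, ?_⟩ <;> unfold CellSep at ha ⊢ <;>
      simp only [raise, if_neg (show ¬(2 * u.length < j ∧ j < 2 * u.length + 2 * w.length) by omega),
        if_neg (show ¬(2 * u.length < j + 1 ∧ j + 1 < 2 * u.length + 2 * w.length) by omega)]
    · exact ha
    · simp only [hsame j (by omega), hsame (j + 1) (by omega)]
      exact ha

end Words

/-! ### Removing trivial pages -/

section Dup

variable {K : Type*} {L : ℕ} {π : Equiv.Perm K} {x : ℕ → ℝ} {c : ℕ → K → ℝ × ℝ}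

/-- The configurations `c`, with a new page between the pages `i` and `i + 1`. -/
def insertPage (i : ℕ) (θ : ℝ) (c : ℕ → K → ℝ × ℝ) (j : ℕ) (k : K) : ℝ × ℝ :=
  if j ≤ i then c j k else if j = i + 1 then (1 - θ) • c i k + θ • c (i + 1) k else c (j - 1) k

/-- The configurations `c`, with the page `i` repeated. -/
def dupPage (i : ℕ) (c : ℕ → K → ℝ × ℝ) (j : ℕ) (k : K) : ℝ × ℝ :=
  if j ≤ i then c j k else c (j - 1) k

theorem insertPage_zero (i : ℕ) (c : ℕ → K → ℝ × ℝ) : insertPage i 0 c = dupPage i c := by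
  funext j k
  simp only [insertPage, dupPage]
  split_ifs with h1 h2
  · rfl
  · subst h2; simp
  · rfl

theorem insertPage_one (i : ℕ) (c : ℕ → K → ℝ × ℝ) : insertPage i 1 c = dupPage (i + 1) c := by
  funext j k
  simp only [insertPage, dupPage]
  split_ifs with h1 h2 h3 h4 h5
  · rfl
  · omega
  · subst h3; simp
  · omega
  · omega
  · rfl

theorem IsCfg.insertPage (h : IsCfg L π x c) {i : ℕ} (hi : i < L) {θ : ℝ} (h0 : 0 ≤ θ)
    (h1 : θ ≤ 1) {x' : ℕ → ℝ} (hx' : ∀ j < L + 1, x' j < x' (j + 1)) :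
    IsCfg (L + 1) π x' (insertPage i θ c) where
  lt := hx'
  nonneg j k := by
    unfold _root_.insertPage
    split_ifs
    · exact h.nonneg _ _
    · have := h.nonneg i k
      have := h.nonneg (i + 1) k
      have : 0 ≤ 1 - θ := by linarith
      simp only [Prod.snd_add, Prod.smul_snd, smul_eq_mul]
      positivity
    · exact h.nonneg _ _
  wrap k := by
    unfold _root_.insertPage
    rw [if_neg (by omega), if_neg (by omega), if_pos (by omega)]
    exact h.wrap k

/-- Convex combinations preserve a separation, so a functional for the divided cell serves both
halves, for every position `θ` of the new page. -/
theorem cellSep_insertPage {i : ℕ} (hi : i < L)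
    (hs : ∀ j < L + 3, ∀ k k', k ≠ k' → ∃ a, CellSep L j a c k k') {j : ℕ} (hj : j < L + 1 + 3)
    {k k' : K} (hk : k ≠ k') :
    ∃ a, ∀ θ, 0 ≤ θ → θ ≤ 1 → CellSep (L + 1) j a (insertPage i θ c) k k' := by
  rcases lt_or_ge j i with h1 | h1
  · obtain ⟨a, ⟨h2, h3⟩, -⟩ := hs j (by omega) k k' hk
    refine ⟨a, fun θ _ _ => ⟨?_, fun h => by omega⟩⟩
    simp only [insertPage, if_pos h1.le, if_pos (Nat.succ_le_of_lt h1)]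
    exact ⟨h2, h3⟩
  · rcases lt_or_ge (i + 1) j with h2 | h2
    · obtain ⟨a, h3, h4⟩ := hs (j - 1) (by omega) k k' hk
      refine ⟨a, fun θ _ _ => ?_⟩
      unfold CellSep
      simp only [insertPage, if_neg (show ¬ j ≤ i by omega), if_neg (show ¬ j = i + 1 by omega),
        if_neg (show ¬ j + 1 ≤ i by omega), if_neg (show ¬ j + 1 = i + 1 by omega),
        Nat.add_sub_cancel]
      rw [Nat.sub_add_cancel (by omega)] at h3 h4
      exact ⟨h3, fun h => h4 (by omega)⟩
    · obtain ⟨a, ⟨h3, h4⟩, -⟩ := hs i (by omega) k k' hk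
      refine ⟨a, fun θ h0 h1 => ⟨?_, fun h => by omega⟩⟩
      have hm : dot a ((1 - θ) • c i k + θ • c (i + 1) k) <
          dot a ((1 - θ) • c i k' + θ • c (i + 1) k') := by
        rw [dot_combo, dot_combo]
        exact combo_lt (by linarith) h0 (by ring) h3 h4
      obtain rfl | rfl : j = i ∨ j = i + 1 := by omega
      · simp only [insertPage, if_pos le_rfl, if_neg (show ¬ j + 1 ≤ j by omega), if_true]
        exact ⟨h3, hm⟩
      · simp only [insertPage, if_neg (show ¬ i + 1 ≤ i by omega),
          if_neg (show ¬ i + 1 + 1 ≤ i by omega), if_neg (show ¬ i + 1 + 1 = i + 1 by omega),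
          Nat.add_sub_cancel, if_true]
        exact ⟨hm, h4⟩

/-- The positions `x`, with a new one in the middle between `x i` and `x (i + 1)`. -/
noncomputable def insertPos (i : ℕ) (x : ℕ → ℝ) (j : ℕ) : ℝ :=
  if j ≤ i then x j else if j = i + 1 then (x i + x (i + 1)) / 2 else x (j - 1)

/-- With `θ = 1 / 2` and the new page halfway, the new vertices are midpoints of old edges and can
be removed again. -/
theorem isotopic_insertPage [Finite K] (hL : 1 ≤ L) (h : IsCfg L π x c)
    (hs : ∀ j < L + 3, ∀ k k', k ≠ k' → ∃ a, CellSep L j a c k k') {i : ℕ} (hi : i < L) :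
    PolyIsotopic (cfgEdges (L + 1) (insertPos i x) (insertPage i (1 / 2) c)) (cfgEdges L x c) := by
  have hxi := h.lt i hi
  have hx' : ∀ j < L + 1, insertPos i x j < insertPos i x (j + 1) := by
    intro j hj
    unfold insertPos
    split_ifs with h1 h2 h3 h4 h5 h6 h7
    · exact h.lt j (by omega)
    · obtain rfl : j = i := by omega
      linarith
    · omega
    · omega
    · omega
    · subst h4
      simp only [Nat.add_sub_cancel]; linarith
    · omega
    · omega
    · have := h.lt (j - 1) (by omega)
      rwa [Nat.sub_add_cancel (by omega)] at this
  have hcfg := h.insertPage hi (θ := 1 / 2) (by norm_num) (by norm_num) hx'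
  have hpoly := hcfg.isPolygonalLink (by omega) fun j hj k k' hk => by
    obtain ⟨a, ha⟩ := cellSep_insertPage hi hs hj hk
    exact ⟨a, ha _ (by norm_num) (by norm_num)⟩
  set m : ℝ := (x i + x (i + 1)) / 2 with hm
  -- the old and the new places
  have hlow : ∀ j ≤ i, ∀ k, place (insertPos i x) (L + 1) j (insertPage i (1 / 2) c j k) =
      place x L j (c j k) := by
    intro j hj k
    rw [place_of_le _ _ (by omega), place_of_le _ _ (by omega)]
    simp [insertPos, insertPage, hj]
  have hmid : ∀ k, place (insertPos i x) (L + 1) (i + 1) (insertPage i (1 / 2) c (i + 1) k) =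
      midpoint ℝ (place x L i (c i k)) (place x L (i + 1) (c (i + 1) k)) := by
    intro k
    rw [place_of_le _ _ (by omega), place_of_le _ _ (by omega), place_of_le _ _ (by omega)]
    ext t
    fin_cases t <;> simp [insertPos, insertPage, pt, midpoint_eq_smul_add] <;> ring
  have hhigh : ∀ j, i < j → j ≤ L + 3 → ∀ k, place (insertPos i x) (L + 1) (j + 1)
      (insertPage i (1 / 2) c (j + 1) k) = place x L j (c j k) := by
    intro j hj hjL k
    have e1 : insertPage i (1 / 2) c (j + 1) k = c j k := by
      rw [insertPage, if_neg (by omega), if_neg (by omega), Nat.add_sub_cancel]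
    have e2 : insertPos i x (L + 1) = x L := by
      rw [insertPos, if_neg (by omega), if_neg (by omega), Nat.add_sub_cancel]
    have e3 : insertPos i x 0 = x 0 := by simp [insertPos]
    rw [e1]
    unfold place
    simp only [add_le_add_iff_right, add_left_inj, e2, e3, show L + 1 + 2 = L + 2 + 1 by ring]
    split_ifs with h1
    · rw [insertPos, if_neg (by omega), if_neg (by omega), Nat.add_sub_cancel]
    all_goals rfl
  -- No old vertex lies in the plane of the new page, so this plane singles out the new vertices.
  have hM : ∀ j ≤ L + 3, ∀ k, place x L j (c j k) 0 ≠ m := by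
    intro j hj k
    rcases le_or_gt j L with h1 | h1
    · rw [place_of_le _ _ h1]
      show x j ≠ m
      rcases le_or_gt j i with h2 | h2
      · have := h.x_le h2 hi.le
        intro h3; linarith
      · have := h.x_le (Nat.succ_le_of_lt h2) h1
        intro h3; simp only [Nat.succ_eq_add_one] at this; linarith
    · have k1 := h.x_le (Nat.zero_le i) hi.le
      have k2 := h.x_le (Nat.succ_le_of_lt hi) le_rfl
      simp only [Nat.succ_eq_add_one] at k2
      have k3 := h.nonneg j k
      obtain rfl | rfl | rfl : j = L + 1 ∨ j = L + 2 ∨ j = L + 3 := by omega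
      · rw [place_right]
        show x L + 1 + 2 * _ ≠ m
        intro h3; linarith
      · rw [place_left]
        show x 0 - 1 - 2 * _ ≠ m
        intro h3; linarith
      · rw [place_last]
        show x 0 ≠ m
        intro h3; linarith
  have hMq : ∀ j ≤ L + 3, ∀ k q, q 0 = m → q = place x L j (c j k) → False := by
    rintro j hj k q hq rfl
    exact hM j hj k hq
  have hmidM : ∀ k, (midpoint ℝ (place x L i (c i k)) (place x L (i + 1) (c (i + 1) k))) 0 = m := by
    intro k
    rw [place_of_le _ _ (by omega), place_of_le _ _ (by omega)]
    simp [pt, midpoint_eq_smul_add, hm]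
    ring
  -- the new edges
  have hedge : ∀ e, e ∈ cfgEdges (L + 1) (insertPos i x) (insertPage i (1 / 2) c) ↔
      (∃ j k, j < L + 3 ∧ j ≠ i ∧ e = (place x L j (c j k), place x L (j + 1) (c (j + 1) k))) ∨
      (∃ k, e = (place x L i (c i k),
        midpoint ℝ (place x L i (c i k)) (place x L (i + 1) (c (i + 1) k))) ∨
        e = (midpoint ℝ (place x L i (c i k)) (place x L (i + 1) (c (i + 1) k)),
          place x L (i + 1) (c (i + 1) k))) := by
    intro e
    constructor
    · rintro ⟨j, k, hj, rfl⟩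
      rcases lt_trichotomy j i with h1 | rfl | h1
      · exact Or.inl ⟨j, k, by omega, h1.ne, by rw [hlow j h1.le, hlow (j + 1) (by omega)]⟩
      · exact Or.inr ⟨k, Or.inl (by rw [hlow j le_rfl, hmid])⟩
      · obtain ⟨j, rfl⟩ : ∃ j', j = j' + 1 := ⟨j - 1, by omega⟩
        rcases Nat.lt_or_ge i j with h2 | h2
        · exact Or.inl ⟨j, k, by omega, by omega,
            by rw [hhigh j h2 (by omega), hhigh (j + 1) (by omega) (by omega)]⟩
        · obtain rfl : j = i := by omega
          exact Or.inr ⟨k, Or.inr (by rw [hmid, hhigh (j + 1) (by omega) (by omega)])⟩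
    · rintro (⟨j, k, hj, hji, rfl⟩ | ⟨k, rfl | rfl⟩)
      · rcases lt_or_gt_of_ne hji with h1 | h1
        · exact ⟨j, k, by omega, by rw [hlow j h1.le, hlow (j + 1) (by omega)]⟩
        · exact ⟨j + 1, k, by omega,
            by rw [hhigh j h1 (by omega), hhigh (j + 1) (by omega) (by omega)]⟩
      · exact ⟨i, k, by omega, by rw [hlow i le_rfl, hmid]⟩
      · exact ⟨i + 1, k, by omega, by rw [hmid, hhigh (i + 1) (by omega) (by omega)]⟩
  have hmerge := isotopic_mergeEdges hpoly (M := {q | q 0 = m}) (by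
    intro a q b hq h1 h2
    rw [hedge] at h1 h2
    rcases h1 with ⟨j, k, hj, -, he⟩ | ⟨k, he | he⟩
    · exact (hMq _ (by omega) _ _ hq (congrArg Prod.snd he)).elim
    · obtain ⟨rfl, rfl⟩ := Prod.ext_iff.1 he
      rcases h2 with ⟨j, k', hj, -, he'⟩ | ⟨k', he' | he'⟩
      · exact (hMq _ (by omega) _ _ hq (congrArg Prod.fst he')).elim
      · exact (hMq _ (by omega) _ _ hq (congrArg Prod.fst he')).elim
      · by_cases hkk : k = k'
        · subst hkk
          obtain ⟨-, rfl⟩ := Prod.ext_iff.1 he'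
          exact ⟨midpoint_mem_segment _ _, hM _ (by omega) _, hM _ (by omega) _⟩
        · exfalso
          have h3 : midpoint ℝ (place x L i (c i k)) (place x L (i + 1) (c (i + 1) k)) =
            midpoint ℝ (place x L i (c i k')) (place x L (i + 1) (c (i + 1) k')) :=
            congrArg Prod.fst he'
          have h4 := hpoly.eq_of_snd ((hedge _).2 (Or.inr ⟨k, Or.inl rfl⟩))
            ((hedge _).2 (Or.inr ⟨k', Or.inl rfl⟩)) h3
          obtain ⟨d, h5, -⟩ := hs i (by omega) k k' hkk
          have h6 := place_injective x (congrArg Prod.fst h4)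
          rw [h6] at h5
          exact lt_irrefl _ h5.1
    · exact (hMq _ (by omega) _ _ hq (congrArg Prod.snd he)).elim)
  convert hmerge using 1
  ext e
  simp only [mergeEdges, Set.mem_union, Set.mem_ofPred_eq, hedge]
  constructor
  · rintro ⟨j, k, hj, rfl⟩
    by_cases hji : j = i
    · subst hji
      exact Or.inr ⟨_, hmidM k, Or.inr ⟨k, Or.inl rfl⟩, Or.inr ⟨k, Or.inr rfl⟩⟩
    · exact Or.inl ⟨Or.inl ⟨j, k, hj, hji, rfl⟩, hM _ (by omega) _, hM _ (by omega) _⟩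
  · rintro (⟨⟨j, k, hj, -, rfl⟩ | ⟨k, rfl | rfl⟩, h2, h3⟩ | ⟨q, hq, h1, h2⟩)
    · exact ⟨j, k, hj, rfl⟩
    · exact absurd (hmidM k) h3
    · exact absurd (hmidM k) h2
    · rcases h1 with ⟨j, k, hj, -, he⟩ | ⟨k, he | he⟩
      · exact (hMq _ (by omega) _ _ hq (congrArg Prod.snd he)).elim
      · rcases h2 with ⟨j, k', hj, -, he'⟩ | ⟨k', he' | he'⟩
        · exact (hMq _ (by omega) _ _ hq (congrArg Prod.fst he')).elim
        · exact (hMq _ (by omega) _ _ hq (congrArg Prod.fst he')).elim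
        · have h3 : q = _ := congrArg Prod.snd he
          have h3' : q = _ := congrArg Prod.fst he'
          have h4 := hpoly.eq_of_snd ((hedge _).2 (Or.inr ⟨k, Or.inl rfl⟩))
            ((hedge _).2 (Or.inr ⟨k', Or.inl rfl⟩)) (h3.symm.trans h3')
          have h6 := congrArg Prod.fst h4
          have hkk : k = k' := by
            by_contra hkk
            obtain ⟨d, h5, -⟩ := hs i (by omega) k k' hkk
            have h6 := place_injective x h6
            rw [h6] at h5
            exact lt_irrefl _ h5.1
          subst hkk
          exact ⟨i, k, by omega, Prod.ext (congrArg Prod.fst he :) (congrArg Prod.snd he' :)⟩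
      · exact (hMq _ (by omega) _ _ hq (congrArg Prod.snd he)).elim

/-- The new page slides from the middle to one of its neighbours, and the same functionals separate
the strands throughout. -/
theorem isotopic_dupPage [Finite K] (hL : 1 ≤ L) (h : IsCfg L π x c)
    (hs : ∀ j < L + 3, ∀ k k', k ≠ k' → ∃ a, CellSep L j a c k k') {i : ℕ} (hi : i ≤ L)
    {x' : ℕ → ℝ} (hx' : StrictMono x') :
    PolyIsotopic (cfgEdges L x c) (cfgEdges (L + 1) x' (dupPage i c)) ∧
      IsCfg (L + 1) π x' (dupPage i c) ∧
      ∀ j < L + 1 + 3, ∀ k k', k ≠ k' → ∃ a, CellSep (L + 1) j a (dupPage i c) k k' := by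
  obtain ⟨i', θ, hi', hθ0, hθ1, he⟩ : ∃ i' θ, i' < L ∧ 0 ≤ θ ∧ θ ≤ 1 ∧
      dupPage i c = insertPage i' θ c := by
    -- Pages are inserted only between pages up to `L`, so the page `L` is repeated by inserting a
    -- page before it, with `θ = 1`.
    rcases hi.eq_or_lt with rfl | hi
    · exact ⟨i - 1, 1, by omega, by norm_num, le_rfl, by
        rw [insertPage_one, Nat.sub_add_cancel hL]⟩
    · exact ⟨i, 0, hi, le_rfl, by norm_num, (insertPage_zero i c).symm⟩
  rw [he]
  have s1 := isotopic_insertPage hL h hs hi'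
  have hcfg := h.insertPage hi' hθ0 hθ1 (x' := x') (fun j _ => hx' (Nat.lt_succ_self j))
  have hx2 : ∀ j < L + 1, insertPos i' x j < insertPos i' x (j + 1) := by
    have hxi := h.lt i' hi'
    intro j hj
    unfold insertPos
    split_ifs with h1 h2 h3 h4 h5 h6 h7
    · exact h.lt j (by omega)
    · obtain rfl : j = i' := by omega
      linarith
    · omega
    · omega
    · omega
    · subst h4
      simp only [Nat.add_sub_cancel]; linarith
    · omega
    · omega
    · have := h.lt (j - 1) (by omega)
      rwa [Nat.sub_add_cancel (by omega)] at this
  have hcfg' := h.insertPage hi' (θ := 1 / 2) (by norm_num) (by norm_num) hx2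
  refine ⟨s1.symm.trans (isotopic_cfgEdges (by omega) hcfg' hcfg fun j hj k k' hk => ?_), hcfg,
    fun j hj k k' hk => ?_⟩
  · obtain ⟨a, ha⟩ := cellSep_insertPage hi' hs hj hk
    exact ⟨a, ha _ (by norm_num) (by norm_num), ha _ hθ0 hθ1⟩
  · obtain ⟨a, ha⟩ := cellSep_insertPage hi' hs hj hk
    exact ⟨a, ha _ hθ0 hθ1⟩

end Dup

section Words

variable {n : ℕ}

/-- A trivial letter contributes two pages, both copies of the page at which it is inserted. -/
theorem wordC_none (u v : List (GLetter n)) :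
    wordC (u ++ none :: v) = dupPage (2 * u.length) (dupPage (2 * u.length) (wordC (u ++ v))) := by
  funext j k
  simp only [dupPage]
  rcases le_or_gt j (2 * u.length) with h1 | h1
  · rw [if_pos h1, if_pos h1, wordC_append_left _ _ h1, wordC_append_left _ _ h1]
  · obtain ⟨i, rfl⟩ := Nat.exists_eq_add_of_lt h1
    rw [if_neg (by omega), add_assoc, wordC_append_right]
    rcases i with _ | i
    · rw [if_pos (by omega)]
      have := wordC_append_right u v 0 k
      rw [show 2 * u.length + (0 + 1) - 1 = 2 * u.length + 0 by omega, this]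
      simp [wordC, letterMid]
    · rw [if_neg (by omega), show 2 * u.length + (i + 1 + 1) - 1 - 1 = 2 * u.length + i by omega,
        wordC_append_right]
      rfl

theorem isotopic_none_of_ne_nil (u v : List (GLetter n)) (h : u ++ v ≠ []) :
    PolyIsotopic (wordLink (u ++ none :: v)) (wordLink (u ++ v)) := by
  have hlen := List.length_pos_iff.2 h
  have hlen' : (u ++ v).length = u.length + v.length := List.length_append
  obtain ⟨h1, h2, h3⟩ := isotopic_dupPage (L := 2 * (u ++ v).length) (by omega)
    (isCfg_wordC (u ++ v) strictMono_half) (fun j _ k k' hk => wordC_cellSep (u ++ v) j hk)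
    (i := 2 * u.length) (by omega) strictMono_half
  obtain ⟨h4, -, -⟩ := isotopic_dupPage (by omega) h2 h3 (i := 2 * u.length) (by omega)
    strictMono_half
  have := (h1.trans h4).symm
  rw [← wordC_none] at this
  have e : 2 * (u ++ v).length + 1 + 1 = 2 * (u ++ none :: v).length := by
    simp only [List.length_append, List.length_cons]; ring
  rw [e] at this
  exact this

end Words

/-! ### The empty word -/

section Empty

variable {K : Type*}

/-- Conditions on the coordinates of a quadrilateral which make it convex enough. -/
structure QuadCond (X Z : Fin 4 → ℝ) : Prop where
  x01 : X 0 < X 1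
  x12 : X 1 < X 2
  x30 : X 3 < X 0
  d12 : X 2 + 2 * Z 2 < X 1 + 2 * Z 1
  d23 : X 3 + 2 * Z 3 < X 2 + 2 * Z 2
  e23 : 2 * Z 2 - X 2 < 2 * Z 3 - X 3
  e30 : 2 * Z 3 - X 3 < 2 * Z 0 - X 0
  z20 : Z 2 < Z 0
  z21 : Z 2 < Z 1
  z30 : Z 3 < Z 0
  z31 : Z 3 < Z 1

/-- The vertices of parallel quadrilaterals. -/
def quadVertex (g : K → ℝ) (X Z : Fin 4 → ℝ) (v : Fin (1 + 3) × K) : Pt :=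
  pt (X v.1) (g v.2) (Z v.1)

theorem cfgNext_one (v : Fin (1 + 3) × K) : cfgNext 1 1 v = (v.1 + 1, v.2) := by
  simp [cfgNext]

/-- The inequalities provide a supporting functional for every corner and a separating one for
opposite sides. Since they are linear, such quadrilaterals form a convex set. -/
theorem QuadCond.goodScheme {g : K → ℝ} (hg : Function.Injective g) {X Z : Fin 4 → ℝ}
    (h : QuadCond X Z) : GoodScheme (cfgNext 1 1) (quadVertex g X Z) := by
  obtain ⟨x01, x12, x30, d12, d23, e23, e30, z20, z21, z30, z31⟩ := h
  have key : ∀ (i j : Fin 4) (k : K) (z : Pt), i < j →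
      z ∈ segment ℝ (pt (X i) (g k) (Z i)) (pt (X (i + 1)) (g k) (Z (i + 1))) →
      z ∈ segment ℝ (pt (X j) (g k) (Z j)) (pt (X (j + 1)) (g k) (Z (j + 1))) →
      (j = i + 1 ∧ z = pt (X j) (g k) (Z j)) ∨ (i = j + 1 ∧ z = pt (X i) (g k) (Z i)) := by
    intro i j k z hij hz hz'
    have a1 : (1 : Fin 4) + 1 = 2 := rfl
    have a2 : (2 : Fin 4) + 1 = 3 := rfl
    have a3 : (3 : Fin 4) + 1 = 0 := rfl
    fin_cases i <;> fin_cases j <;> simp [Fin.lt_def] at hij <;>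
      simp only [Fin.zero_eta, Fin.mk_one, Fin.reduceFinMk, zero_add, a1, a2, a3] at hz hz' ⊢
    · exact Or.inl ⟨by trivial, (segment_corner (linFun 1 0 0) (by simpa using x01) rfl
        (by simpa using x12) hz hz').1⟩
    · refine absurd hz (segment_disjoint_of_lt (linFun 0 0 1) ?_ ?_ ?_ ?_ hz') <;> simpa
    · exact Or.inr ⟨by trivial, (segment_corner (linFun 1 0 0) (by simpa using x30) rfl
        (by simpa using x01) hz' hz).1⟩
    · exact Or.inl ⟨by trivial, (segment_corner (linFun (-1) 0 (-2)) (by simp; linarith) rfl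
        (by simp; linarith) hz hz').1⟩
    · refine absurd hz (segment_disjoint_of_lt (linFun 1 0 0) ?_ ?_ ?_ ?_ hz') <;> simp <;> linarith
    · exact Or.inl ⟨by trivial, (segment_corner (linFun (-1) 0 2) (by simp; linarith) rfl
        (by simp; linarith) hz hz').1⟩
  refine ⟨?_, ?_⟩
  · rintro ⟨i, k⟩ he
    rw [cfgNext_one, quadVertex, quadVertex, pt_inj] at he
    obtain ⟨h1, -, h2⟩ := he
    have a1 : (1 : Fin 4) + 1 = 2 := rfl
    have a2 : (2 : Fin 4) + 1 = 3 := rfl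
    have a3 : (3 : Fin 4) + 1 = 0 := rfl
    fin_cases i <;>
      simp only [Fin.zero_eta, Fin.mk_one, Fin.reduceFinMk, zero_add, a1, a2, a3] at h1 h2 <;>
      linarith
  · rintro ⟨i, k⟩ ⟨j, k'⟩ hne z hz hz'
    simp only [cfgNext_one, quadVertex] at hz hz' ⊢
    by_cases hk : k = k'
    · subst hk
      rcases lt_trichotomy i j with h1 | rfl | h1
      · rcases key i j k z h1 hz hz' with ⟨h2, h3⟩ | ⟨h2, h3⟩
        · exact Or.inl ⟨by rw [h2], h3⟩
        · exact Or.inr ⟨by rw [← h2], h3⟩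
      · exact absurd rfl hne
      · rcases key j i k z h1 hz' hz with ⟨h2, h3⟩ | ⟨h2, h3⟩
        · exact Or.inr ⟨by rw [h2], h3⟩
        · exact Or.inl ⟨by rw [← h2], h3⟩
    · exfalso
      rcases lt_or_gt_of_ne (hg.ne hk) with h1 | h1
      · exact segment_disjoint_of_lt (linFun 0 1 0) (by simpa) (by simpa) (by simpa) (by simpa)
          hz hz'
      · exact segment_disjoint_of_lt (linFun 0 1 0) (by simpa) (by simpa) (by simpa) (by simpa)
          hz' hz

theorem isotopic_quad [Finite K] {g : K → ℝ} (hg : Function.Injective g) {X Z X' Z' : Fin 4 → ℝ}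
    (h : QuadCond X Z) (h' : QuadCond X' Z') :
    PolyIsotopic (schemeEdges (cfgNext 1 1) (quadVertex g X Z))
      (schemeEdges (cfgNext 1 1) (quadVertex g X' Z')) := by
  refine isotopic_of_convex (cfgNext_ne 1 1)
    (K := {p | ∃ X Z, QuadCond X Z ∧ p = quadVertex g X Z}) ?_ ?_ ⟨X, Z, h, rfl⟩ ⟨X', Z', h', rfl⟩
  · rintro _ ⟨X, Z, h, rfl⟩ _ ⟨X', Z', h', rfl⟩ s t hs ht hst
    have lt : ∀ {a b a' b' : ℝ}, a < b → a' < b' → s * a + t * a' < s * b + t * b' :=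
      fun h h' => combo_lt hs ht hst h h'
    refine ⟨s • X + t • X', s • Z + t • Z', ?_, ?_⟩
    · constructor <;> simp only [Pi.add_apply, Pi.smul_apply, smul_eq_mul]
      · exact lt h.x01 h'.x01
      · exact lt h.x12 h'.x12
      · exact lt h.x30 h'.x30
      · linarith [lt h.d12 h'.d12]
      · linarith [lt h.d23 h'.d23]
      · linarith [lt h.e23 h'.e23]
      · linarith [lt h.e30 h'.e30]
      · exact lt h.z20 h'.z20
      · exact lt h.z21 h'.z21
      · exact lt h.z30 h'.z30
      · exact lt h.z31 h'.z31
    · funext v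
      ext i
      fin_cases i <;> simp [quadVertex, pt]
      linear_combination (g v.2) * hst
  · rintro _ ⟨X, Z, h, rfl⟩
    exact h.goodScheme hg

/-- The open book argument requires `1 ≤ L`. For the empty word each strand closes to a triangle; it
is reached from the quadrilateral with `L = 1` by moving one vertex onto a side of the triangle and
removing it. -/
theorem isotopic_cfgEdges_zero [Finite K] {g : K → ℝ} (hg : Function.Injective g) {x : ℕ → ℝ}
    (hx : x 0 = 0) :
    PolyIsotopic (cfgEdges 1 (fun j => (j : ℝ)) fun _ k => (g k, 0))
      (cfgEdges 0 x fun _ k => (g k, 0)) := by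
  have h1 : QuadCond ![0, 1, 2, -1] ![0, 0, -1, -1] := by
    constructor <;> norm_num [Matrix.cons_val_two, Matrix.cons_val_three]
  -- Vertex `1` is the midpoint of vertices `0` and `2`.
  have h0 : QuadCond ![0, 1 / 2, 1, -1] ![0, -1 / 2, -1, -1] := by
    constructor <;> norm_num [Matrix.cons_val_two, Matrix.cons_val_three]
  have hs := isotopic_quad hg h1 h0
  have e1 : schemeEdges (cfgNext 1 1) (quadVertex g ![0, 1, 2, -1] ![0, 0, -1, -1]) =
      cfgEdges 1 (fun j => (j : ℝ)) fun _ k => (g k, 0) := by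
    have hcfg : IsCfg 1 1 (fun j => (j : ℝ)) fun _ (k : K) => ((g k, 0) : ℝ × ℝ) :=
      ⟨fun j _ => by simp, fun _ _ => le_rfl, fun _ => rfl⟩
    rw [← hcfg.schemeEdges_eq]
    congr 1
    funext ⟨i, k⟩
    fin_cases i <;> simp [quadVertex, cfgVertex, place] <;> norm_num
  rw [e1] at hs
  refine hs.trans ?_
  have hedge : ∀ e, e ∈ schemeEdges (cfgNext 1 1)
      (quadVertex g ![0, 1 / 2, 1, -1] ![0, -1 / 2, -1, -1]) ↔
      ∃ k, e = (pt 0 (g k) 0, pt (1 / 2) (g k) (-1 / 2)) ∨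
        e = (pt (1 / 2) (g k) (-1 / 2), pt 1 (g k) (-1)) ∨
        e = (pt 1 (g k) (-1), pt (-1) (g k) (-1)) ∨ e = (pt (-1) (g k) (-1), pt 0 (g k) 0) := by
    intro e
    constructor
    · rintro ⟨⟨i, k⟩, rfl⟩
      refine ⟨k, ?_⟩
      simp only [cfgNext_one]
      fin_cases i
      · exact Or.inl rfl
      · exact Or.inr (Or.inl rfl)
      · exact Or.inr (Or.inr (Or.inl rfl))
      · exact Or.inr (Or.inr (Or.inr rfl))
    · rintro ⟨k, rfl | rfl | rfl | rfl⟩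
      · exact ⟨(0, k), by simp only [cfgNext_one]; rfl⟩
      · exact ⟨(1, k), by simp only [cfgNext_one]; rfl⟩
      · exact ⟨(2, k), by simp only [cfgNext_one]; rfl⟩
      · exact ⟨(3, k), by simp only [cfgNext_one]; rfl⟩
  have hmem : ∀ a b c : ℝ, pt a b c ∈ {q : Pt | q 0 = 1 / 2} ↔ a = 1 / 2 := fun _ _ _ => Iff.rfl
  have hmerge := isotopic_mergeEdges hs.2.1 (M := {q | q 0 = 1 / 2}) (by
    intro a m b hm ha hb
    obtain ⟨k, he⟩ := (hedge _).1 ha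
    obtain ⟨k', he'⟩ := (hedge _).1 hb
    simp only [Prod.mk.injEq] at he he'
    rcases he with ⟨rfl, rfl⟩ | ⟨rfl, rfl⟩ | ⟨rfl, rfl⟩ | ⟨rfl, rfl⟩ <;>
      rw [hmem] at hm <;> norm_num at hm
    simp only [pt_inj] at he'
    norm_num at he'
    obtain ⟨hk, rfl⟩ := he'
    rw [← hk]
    refine ⟨⟨1 / 2, 1 / 2, by norm_num, by norm_num, by norm_num, ?_⟩, ?_, ?_⟩
    · ext i
      fin_cases i <;> simp [pt] <;> ring
    · rw [hmem]; norm_num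
    · rw [hmem]; norm_num)
  convert hmerge using 1
  ext ⟨a, b⟩
  simp only [mergeEdges, Set.mem_union, Set.mem_ofPred_eq, hedge]
  constructor
  · rintro ⟨j, k, hj, he⟩
    obtain rfl | rfl | rfl : j = 0 ∨ j = 1 ∨ j = 2 := by omega
    · right
      simp [place, hx] at he
      refine ⟨pt (1 / 2) (g k) (-1 / 2), rfl, ⟨k, Or.inl ?_⟩, ⟨k, Or.inr (Or.inl ?_)⟩⟩
      · rw [he.1]
      · rw [he.2]
    · left
      simp [place, hx] at he
      refine ⟨⟨k, Or.inr (Or.inr (Or.inl ?_))⟩, ?_, ?_⟩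
      · rw [he.1, he.2]
      · rw [he.1]; simp [pt]
      · rw [he.2]; simp [pt]; norm_num
    · left
      simp [place, hx] at he
      refine ⟨⟨k, Or.inr (Or.inr (Or.inr ?_))⟩, ?_, ?_⟩
      · rw [he.1, he.2]
      · rw [he.1]; simp [pt]; norm_num
      · rw [he.2]; simp [pt]
  · rintro (⟨⟨k, he⟩, h2, h3⟩ | ⟨m, hm, ⟨k, he⟩, ⟨k', he'⟩⟩)
    · simp only [Prod.mk.injEq] at he
      rcases he with ⟨rfl, rfl⟩ | ⟨rfl, rfl⟩ | ⟨rfl, rfl⟩ | ⟨rfl, rfl⟩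
      · exact absurd rfl h3
      · exact absurd rfl h2
      · exact ⟨1, k, by omega, by simp [place, hx]⟩
      · exact ⟨2, k, by omega, by simp [place, hx]⟩
    · simp only [Prod.mk.injEq] at he he'
      rcases he with ⟨rfl, rfl⟩ | ⟨rfl, rfl⟩ | ⟨rfl, rfl⟩ | ⟨rfl, rfl⟩ <;>
        simp [pt] at hm <;> norm_num at hm
      simp only [pt_inj] at he'
      norm_num at he'
      obtain ⟨hk, rfl⟩ := he'
      exact ⟨0, k, by omega, by simp [place, hx, hk]⟩

end Empty

section Words

variable {n : ℕ}

theorem isotopic_none_nil : PolyIsotopic (wordLink ([none] : List (GLetter n)))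
    (wordLink ([] : List (GLetter n))) := by
  have h0 := isotopic_cfgEdges_zero (gridY_injective (n := n)) (x := fun j => (j : ℝ) / 2) (by simp)
  have hcfg : IsCfg 1 1 (fun j => (j : ℝ)) (fun _ (k : Fin n) => ((gridY k, 0) : ℝ × ℝ)) :=
    ⟨fun j _ => by simp, fun _ _ => le_rfl, fun _ => rfl⟩
  obtain ⟨h1, -, -⟩ := isotopic_dupPage le_rfl hcfg (fun j _ k k' hk => by
    obtain ⟨a, -, ha⟩ := grid_sep hk
    exact ⟨a, ⟨ha, ha⟩, fun _ => ⟨ha, ha⟩⟩) (i := 0) (by omega) strictMono_half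
  have e1 : dupPage 0 (fun _ (k : Fin n) => ((gridY k, 0) : ℝ × ℝ)) = wordC [none] := by
    funext j k
    rcases j with _ | _ | j <;> simp [dupPage, wordC, letterMid, letterPerm]
  rw [e1] at h1
  have e2 : (fun _ (k : Fin n) => ((gridY k, 0) : ℝ × ℝ)) = wordC [] := by
    funext j k; simp [wordC]
  have := h1.symm.trans h0
  rw [e2] at this
  exact this

theorem isotopic_none (u v : List (GLetter n)) :
    PolyIsotopic (wordLink (u ++ none :: v)) (wordLink (u ++ v)) := by
  by_cases h : u ++ v = []
  · obtain ⟨rfl, rfl⟩ := List.append_eq_nil_iff.1 h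
    exact isotopic_none_nil
  · exact isotopic_none_of_ne_nil u v h

end Words

/-! ### The standard closure of a word -/

section Words

variable {n : ℕ}

/-- The edges of the slab `j ≤ x ≤ j + 1` in the closure of a word which has the letter `a`
there. -/
def gEdges (n j : ℕ) : GLetter n → Set (Pt × Pt)
  | none => {e | ∃ k : ℕ, 1 ≤ k ∧ k ≤ n ∧ e = (gridPt j k, gridPt (j + 1) k)}
  | some a => letterEdges n j a.1.1 a.2

/-- The standard closure of a word which may have trivial letters. -/
def gClosed (w : List (GLetter n)) : Set (Pt × Pt) :=
  {e | ∃ (j : ℕ) (hj : j < w.length), e ∈ gEdges n j w[j]} ∪ closingEdges n w.length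

theorem closedBraid_eq_gClosed (w : BraidWord n) : closedBraid w = gClosed (w.map some) := by
  simp [closedBraid, gClosed, gEdges]

/-- The point in which the strand in position `k` meets the page `j`. -/
def gridPos (j : ℕ) (k : Fin n) : Pt := pt j (gridY k) 0

theorem gridPt_eq (j : ℕ) (k : Fin n) : gridPt j (k + 1) = gridPos j k := by
  simp [gridPt, gridPos, gridY]

/-- The point of the strand in position `k` in the middle of a letter. -/
noncomputable def midPos (j : ℕ) (a : GLetter n) (k : Fin n) : Pt :=
  pt (j + 1 / 2) (letterMid a k).1 (letterMid a k).2

/-- The strand in position `k` is the upper one at the letter. -/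
def IsOver (a : GLetter n) (k : Fin n) : Prop := ∃ b, a = some b ∧ k = overPos b

theorem letterMid_snd_eq_zero {a : GLetter n} {k : Fin n} : (letterMid a k).2 = 0 ↔ ¬IsOver a k := by
  rcases a with _ | a
  · simp [letterMid, IsOver]
  · simp only [letterMid, IsOver, Option.some.injEq, exists_eq_left']
    split_ifs <;> simp_all

theorem letterMid_fst {a : GLetter n} {k : Fin n} (h : ¬IsOver a k) :
    (letterMid a k).1 = (gridY k + gridY (letterPerm a k)) / 2 := by
  rcases a with _ | ⟨⟨i, h1, h2⟩, b⟩
  · simp [letterMid, letterPerm]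
  · have ho : k ≠ overPos (⟨i, h1, h2⟩, b) := fun hk => h ⟨_, rfl, hk⟩
    have hi : ((i - 1 : ℕ) : ℝ) = i - 1 := by push_cast [h1]; ring
    simp only [letterMid, if_neg ho, letterPerm]
    by_cases hu : k = underPos (⟨i, h1, h2⟩, b)
    · rw [if_pos hu, hu, Equiv.swap_apply_right]
      cases b <;> simp [gridY, underPos, overPos, BraidGen.lo, BraidGen.hi, hi] <;> ring
    · rw [if_neg hu, Equiv.swap_apply_of_ne_of_ne ho hu]
      ring

theorem bridgePt_eq (j : ℕ) (a : BraidGen n × Bool) :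
    bridgePt j a.1.1 = midPos j (some a) (overPos a) := by
  simp [bridgePt, midPos, letterMid]

theorem mem_gEdges {j : ℕ} {a : GLetter n} {e : Pt × Pt} : e ∈ gEdges n j a ↔
    (∃ k, ¬IsOver a k ∧ e = (gridPos j k, gridPos (j + 1) (letterPerm a k))) ∨
    ∃ k, IsOver a k ∧ (e = (gridPos j k, midPos j a k) ∨
      e = (midPos j a k, gridPos (j + 1) (letterPerm a k))) := by
  have grid : ∀ (P : ℕ → Prop), (∃ k, 1 ≤ k ∧ k ≤ n ∧ P k) ↔ ∃ k : Fin n, P (k + 1) := by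
    intro P
    constructor
    · rintro ⟨k, h1, h2, h3⟩
      exact ⟨⟨k - 1, by omega⟩, by simpa [Nat.sub_add_cancel h1] using h3⟩
    · rintro ⟨k, hk⟩
      exact ⟨k + 1, by omega, by omega, hk⟩
  rcases a with _ | ⟨i, b⟩
  · simp only [gEdges, Set.mem_ofPred_eq]
    rw [grid fun k => e = (gridPt j k, gridPt (j + 1) k)]
    simp [gridPt_eq, IsOver, letterPerm]
  · have hlo : (i.lo : ℕ) + 1 = i.1 := by have := i.2; simp only [BraidGen.lo]; omega
    have hhi : (i.hi : ℕ) + 1 = i.1 + 1 := rfl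
    have glo : ∀ j, gridPt j i.1 = gridPos j i.lo := fun j => by rw [← gridPt_eq, hlo]
    have ghi : ∀ j, gridPt j (i.1 + 1) = gridPos j i.hi := fun j => by rw [← gridPt_eq, hhi]
    have hne : i.lo ≠ i.hi := by
      rw [Ne, Fin.ext_iff]; omega
    have hover : ∀ k, IsOver (some (i, b)) k ↔ k = overPos (i, b) := fun k => by simp [IsOver]
    have hout : (∃ k : ℕ, 1 ≤ k ∧ k ≤ n ∧ k ≠ i.1 ∧ k ≠ i.1 + 1 ∧
        e = (gridPt j k, gridPt (j + 1) k)) ↔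
        ∃ k : Fin n, k ≠ i.lo ∧ k ≠ i.hi ∧ e = (gridPos j k, gridPos (j + 1) k) := by
      rw [grid fun k => k ≠ i.1 ∧ k ≠ i.1 + 1 ∧ e = (gridPt j k, gridPt (j + 1) k)]
      simp only [gridPt_eq, Ne, Fin.ext_iff]
      refine exists_congr fun k => ?_
      rw [← hhi, ← hlo]
      simp
    simp only [gEdges, letterEdges, Set.mem_union, Set.mem_ofPred_eq, hout, hover]
    have hbr := bridgePt_eq j (i, b)
    -- Both signs are treated at once, with `o` the upper and `u` the lower strand.
    have hsplit : ∀ o u : Fin n, (o = i.lo ∧ u = i.hi ∨ o = i.hi ∧ u = i.lo) →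
        (((∃ k : Fin n, k ≠ i.lo ∧ k ≠ i.hi ∧ e = (gridPos j k, gridPos (j + 1) k)) ∨
          (e = (gridPos j o, midPos j (some (i, b)) o) ∨
            e = (midPos j (some (i, b)) o, gridPos (j + 1) u) ∨
            e = (gridPos j u, gridPos (j + 1) o))) ↔
        (∃ k, ¬k = o ∧ e = (gridPos j k, gridPos (j + 1) (Equiv.swap o u k))) ∨
          ∃ k, k = o ∧ (e = (gridPos j k, midPos j (some (i, b)) k) ∨
            e = (midPos j (some (i, b)) k, gridPos (j + 1) (Equiv.swap o u k)))) := by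
      intro o u hou
      have hou' : u ≠ o := by
        rcases hou with ⟨rfl, rfl⟩ | ⟨rfl, rfl⟩
        exacts [hne.symm, hne]
      simp only [exists_eq_left, Equiv.swap_apply_left]
      constructor
      · rintro (⟨k, h1, h2, h3⟩ | h | h | h)
        · have k1 : k ≠ o := by rcases hou with ⟨rfl, rfl⟩ | ⟨rfl, rfl⟩ <;> assumption
          have k2 : k ≠ u := by rcases hou with ⟨rfl, rfl⟩ | ⟨rfl, rfl⟩ <;> assumption
          exact Or.inl ⟨k, k1, by rw [Equiv.swap_apply_of_ne_of_ne k1 k2]; exact h3⟩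
        · exact Or.inr (Or.inl h)
        · exact Or.inr (Or.inr h)
        · exact Or.inl ⟨u, hou', by rw [Equiv.swap_apply_right]; exact h⟩
      · rintro (⟨k, h1, h2⟩ | h | h)
        · by_cases h3 : k = u
          · subst h3
            rw [Equiv.swap_apply_right] at h2
            exact Or.inr (Or.inr (Or.inr h2))
          · rw [Equiv.swap_apply_of_ne_of_ne h1 h3] at h2
            refine Or.inl ⟨k, ?_, ?_, h2⟩ <;> rcases hou with ⟨rfl, rfl⟩ | ⟨rfl, rfl⟩ <;> assumption
        · exact Or.inr (Or.inl h)
        · exact Or.inr (Or.inr (Or.inl h))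
    cases b
    · have := hsplit i.hi i.lo (Or.inr ⟨rfl, rfl⟩)
      simp only [overPos] at hbr
      simp only [hbr, glo, ghi, letterPerm, overPos, underPos, Bool.false_eq_true, if_false,
        Set.mem_insert_iff, Set.mem_singleton_iff]
      rw [← this]
      refine or_congr_right ⟨?_, ?_⟩
      · rintro (h | h | h)
        exacts [Or.inr (Or.inr h), Or.inl h, Or.inr (Or.inl h)]
      · rintro (h | h | h)
        exacts [Or.inr (Or.inl h), Or.inr (Or.inr h), Or.inl h]
    · have := hsplit i.lo i.hi (Or.inl ⟨rfl, rfl⟩)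
      simp only [overPos] at hbr
      simp only [hbr, glo, ghi, letterPerm, overPos, underPos, if_true,
        Set.mem_insert_iff, Set.mem_singleton_iff]
      rw [← this]

theorem mem_closingEdges {l : ℕ} {e : Pt × Pt} : e ∈ closingEdges n l ↔
    ∃ k : Fin n, e = (gridPos l k, pt (l + 1) (gridY k) (-1)) ∨
      e = (pt (l + 1) (gridY k) (-1), pt (-1) (gridY k) (-1)) ∨
      e = (pt (-1) (gridY k) (-1), gridPos 0 k) := by
  simp only [closingEdges, Set.mem_ofPred_eq]
  constructor
  · rintro ⟨k, h1, h2, h⟩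
    refine ⟨⟨k - 1, by omega⟩, ?_⟩
    have hk : gridY (⟨k - 1, by omega⟩ : Fin n) = -(k : ℝ) := by
      simp [gridY, h1]
    simpa [← gridPt_eq, hk, Nat.sub_add_cancel h1] using h
  · rintro ⟨k, h⟩
    refine ⟨k + 1, by omega, by omega, ?_⟩
    rw [gridPt_eq, gridPt_eq]
    simpa [gridY] using h

theorem wordC_even (w : List (GLetter n)) {i : ℕ} (hi : i ≤ w.length) (k : Fin n) :
    wordC w (2 * i) k = (gridY (wordPerm (w.take i) k), 0) := by
  have := wordC_append_right (w.take i) (w.drop i) 0 k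
  rwa [List.take_append_drop, List.length_take_of_le hi, wordC_zero] at this

theorem wordC_odd (w : List (GLetter n)) {i : ℕ} (hi : i < w.length) (k : Fin n) :
    wordC w (2 * i + 1) k = letterMid w[i] (wordPerm (w.take i) k) := by
  have := wordC_append_right (w.take i) (w.drop i) 1 k
  rw [List.take_append_drop, List.length_take_of_le hi.le, List.drop_eq_getElem_cons hi] at this
  exact this

theorem wordPerm_take_succ (w : List (GLetter n)) {i : ℕ} (hi : i < w.length) (k : Fin n) :
    wordPerm (w.take (i + 1)) k = letterPerm w[i] (wordPerm (w.take i) k) := by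
  rw [← List.take_append_getElem hi, wordPerm_append]
  simp [wordPerm]

theorem mem_wordLink {w : List (GLetter n)} {e : Pt × Pt} : e ∈ wordLink w ↔
    (∃ (i : ℕ) (hi : i < w.length) (k : Fin n), e = (gridPos i k, midPos i w[i] k) ∨
      e = (midPos i w[i] k, gridPos (i + 1) (letterPerm w[i] k))) ∨
    e ∈ closingEdges n w.length := by
  have half : ∀ i : ℕ, ((2 * i : ℕ) : ℝ) / 2 = i := fun i => by push_cast; ring
  have half' : ∀ i : ℕ, ((2 * i + 1 : ℕ) : ℝ) / 2 = i + 1 / 2 := fun i => by push_cast; ring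
  have even : ∀ i ≤ w.length, ∀ k, place (fun j => (j : ℝ) / 2) (2 * w.length) (2 * i)
      (wordC w (2 * i) k) = gridPos i (wordPerm (w.take i) k) := by
    intro i hi k
    rw [place_of_le _ _ (by omega), wordC_even w hi, half, gridPos]
  have odd : ∀ i, ∀ hi : i < w.length, ∀ k, place (fun j => (j : ℝ) / 2) (2 * w.length) (2 * i + 1)
      (wordC w (2 * i + 1) k) = midPos i w[i] (wordPerm (w.take i) k) := by
    intro i hi k
    rw [place_of_le _ _ (by omega), wordC_odd w hi, half', midPos]
  have even' : ∀ i, ∀ hi : i < w.length, ∀ k, place (fun j => (j : ℝ) / 2) (2 * w.length)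
      (2 * i + 1 + 1) (wordC w (2 * i + 1 + 1) k) =
        gridPos (i + 1) (letterPerm w[i] (wordPerm (w.take i) k)) := by
    intro i hi k
    rw [show 2 * i + 1 + 1 = 2 * (i + 1) by ring, even (i + 1) hi, wordPerm_take_succ w hi]
  have pL : ∀ k, place (fun j => (j : ℝ) / 2) (2 * w.length) (2 * w.length)
      (wordC w (2 * w.length) k) = gridPos w.length (wordPerm w k) := fun k => by
    rw [even _ le_rfl, List.take_length]
  have pA : ∀ k, place (fun j => (j : ℝ) / 2) (2 * w.length) (2 * w.length + 1)
      (wordC w (2 * w.length + 1) k) = pt (w.length + 1) (gridY (wordPerm w k)) (-1) := fun k => by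
    rw [place_right, wordC_ge w (by omega)]; simp
  have pB : ∀ k, place (fun j => (j : ℝ) / 2) (2 * w.length) (2 * w.length + 2)
      (wordC w (2 * w.length + 2) k) = pt (-1) (gridY (wordPerm w k)) (-1) := fun k => by
    rw [place_left, wordC_ge w (by omega)]; simp
  have pC : ∀ k, place (fun j => (j : ℝ) / 2) (2 * w.length) (2 * w.length + 3)
      (wordC w (2 * w.length + 3) k) = gridPos 0 (wordPerm w k) := fun k => by
    rw [place_last, wordC_ge w (by omega)]; simp [gridPos]
  rw [mem_closingEdges]
  constructor
  · rintro ⟨j, k, hj, rfl⟩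
    rcases lt_or_ge j (2 * w.length) with h | h
    · left
      obtain ⟨i, rfl | rfl⟩ := Nat.even_or_odd' j
      · exact ⟨i, by omega, _, Or.inl (by rw [even i (by omega), odd i (by omega)])⟩
      · exact ⟨i, by omega, _, Or.inr (by rw [odd i (by omega), even' i (by omega)])⟩
    · right
      refine ⟨wordPerm w k, ?_⟩
      obtain rfl | rfl | rfl : j = 2 * w.length ∨ j = 2 * w.length + 1 ∨ j = 2 * w.length + 2 := by
        omega
      · left; rw [pL, pA]
      · right; left; rw [pA, pB]
      · right; right; rw [pB, pC]
  · rintro (⟨i, hi, k, h⟩ | ⟨k, h⟩)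
    · obtain ⟨k, rfl⟩ := (wordPerm (w.take i)).surjective k
      rcases h with rfl | rfl
      · exact ⟨2 * i, k, by omega, by rw [even i (by omega), odd i (by omega)]⟩
      · exact ⟨2 * i + 1, k, by omega, by rw [odd i (by omega), even' i (by omega)]⟩
    · obtain ⟨k, rfl⟩ := (wordPerm w).surjective k
      rcases h with rfl | rfl | rfl
      · exact ⟨2 * w.length, k, by omega, by rw [pL, pA]⟩
      · exact ⟨2 * w.length + 1, k, by omega, by rw [pA, pB]⟩
      · exact ⟨2 * w.length + 2, k, by omega, by rw [pB, pC]⟩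

/-- Equal first coordinates force the same letter, and within one letter the strands are separated
in the middle. -/
theorem midPos_injective {i j : ℕ} {w : List (GLetter n)} (hi : i < w.length) (hj : j < w.length)
    {k k' : Fin n} (h : midPos i w[i] k = midPos j w[j] k') : i = j ∧ k = k' := by
  simp only [midPos, pt_inj] at h
  obtain ⟨h1, h2, h3⟩ := h
  have hij : i = j := by
    have : (i : ℝ) = j := by linarith
    exact_mod_cast this
  subst hij
  refine ⟨rfl, ?_⟩
  by_contra hk
  obtain ⟨d, -, hd⟩ := wordC_slabSep [w[i]] 0 hk
  have e : ∀ k, wordC [w[i]] 1 k = letterMid w[i] k := fun _ => rfl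
  rw [e, e, Prod.ext h2 h3] at hd
  exact lt_irrefl _ hd

/-- The two links differ only by the vertices in the middle of those strands that go straight
through a letter. -/
theorem isotopic_gClosed (w : List (GLetter n)) : PolyIsotopic (gClosed w) (wordLink w) := by
  have hpoly : IsPolygonalLink (wordLink w) := by
    rcases w with _ | ⟨a, w⟩
    · exact isotopic_none_nil.2.1
    · exact isPolygonalLink_wordLink (by simp)
  -- Half-integral `x` singles out the middles of letters, and height `0` excludes the bridges.
  set M : Set Pt := {q | q 2 = 0 ∧ ∃ j : ℕ, q 0 = j + 1 / 2} with hM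
  have mem_pt : ∀ {a b c : ℝ}, pt a b c ∈ M ↔ c = 0 ∧ ∃ j : ℕ, a = j + 1 / 2 := Iff.rfl
  have hint : ∀ i j : ℕ, (i : ℝ) ≠ j + 1 / 2 := by
    intro i j h
    have : ((2 * i : ℕ) : ℝ) = (2 * j + 1 : ℕ) := by push_cast; linarith
    have : 2 * i = 2 * j + 1 := by exact_mod_cast this
    omega
  have hgrid : ∀ (i : ℕ) (k : Fin n), gridPos i k ∉ M := by
    rintro i k ⟨-, j, hj⟩
    exact hint i j hj
  have hmid : ∀ (i : ℕ) (a : GLetter n) (k : Fin n), midPos i a k ∈ M ↔ ¬IsOver a k := by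
    intro i a k
    rw [midPos, mem_pt, letterMid_snd_eq_zero]
    exact and_iff_left ⟨i, rfl⟩
  have hback : ∀ x y : ℝ, pt x y (-1) ∉ M := by
    intro x y h
    rw [mem_pt] at h
    norm_num at h
  have hclose : ∀ {e}, e ∈ closingEdges n w.length → e.1 ∉ M ∧ e.2 ∉ M := by
    intro e he
    obtain ⟨k, rfl | rfl | rfl⟩ := mem_closingEdges.1 he
    exacts [⟨hgrid _ _, hback _ _⟩, ⟨hback _ _, hback _ _⟩, ⟨hback _ _, hgrid _ _⟩]
  have hthrough : ∀ a m b, m ∈ M → (a, m) ∈ wordLink w → (m, b) ∈ wordLink w →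
      ∃ (i : ℕ) (hi : i < w.length) (k : Fin n), ¬IsOver w[i] k ∧ a = gridPos i k ∧
        m = midPos i w[i] k ∧ b = gridPos (i + 1) (letterPerm w[i] k) := by
    intro a m b hm h1 h2
    rw [mem_wordLink] at h1 h2
    rcases h1 with ⟨i, hi, k, h1 | h1⟩ | h1
    · obtain ⟨rfl, rfl⟩ := Prod.ext_iff.1 h1
      rcases h2 with ⟨j, hj, k', h2 | h2⟩ | h2
      · have e := congrArg Prod.fst h2
        simp only at e hm
        exact absurd (e ▸ hm) (hgrid _ _)
      · have e := congrArg Prod.fst h2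
        obtain ⟨rfl, rfl⟩ := midPos_injective hi hj e
        exact ⟨i, hi, k, (hmid _ _ _).1 hm, rfl, rfl, congrArg Prod.snd h2⟩
      · exact absurd hm (hclose h2).1
    · have e := congrArg Prod.snd h1
      simp only at e
      exact absurd (e ▸ hm) (hgrid _ _)
    · exact absurd hm (hclose h1).2
  have hmerge := isotopic_mergeEdges hpoly (M := M) (by
    intro a m b hm h1 h2
    obtain ⟨i, hi, k, ho, rfl, rfl, rfl⟩ := hthrough a m b hm h1 h2
    refine ⟨⟨1 / 2, 1 / 2, by norm_num, by norm_num, by norm_num, ?_⟩, hgrid _ _, hgrid _ _⟩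
    ext t
    fin_cases t
    · simp [gridPos, midPos, pt]; ring
    · simp [gridPos, midPos, pt, letterMid_fst ho]; ring
    · simp [gridPos, midPos, pt, letterMid_snd_eq_zero.2 ho])
  have heq : mergeEdges M (wordLink w) = gClosed w := by
    ext e
    simp only [mergeEdges, gClosed, Set.mem_union, Set.mem_ofPred_eq, mem_gEdges]
    constructor
    · rintro (⟨h1, h2, h3⟩ | ⟨m, hm, h1, h2⟩)
      · rcases mem_wordLink.1 h1 with ⟨i, hi, k, rfl | rfl⟩ | h1
        · rw [hmid, not_not] at h3
          exact Or.inl ⟨i, hi, Or.inr ⟨k, h3, Or.inl rfl⟩⟩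
        · rw [hmid, not_not] at h2
          exact Or.inl ⟨i, hi, Or.inr ⟨k, h2, Or.inr rfl⟩⟩
        · exact Or.inr h1
      · obtain ⟨i, hi, k, ho, h3, -, h4⟩ := hthrough _ m _ hm h1 h2
        exact Or.inl ⟨i, hi, Or.inl ⟨k, ho, Prod.ext h3 h4⟩⟩
    · rintro (⟨i, hi, ⟨k, ho, rfl⟩ | ⟨k, ho, rfl | rfl⟩⟩ | h)
      · exact Or.inr ⟨midPos i w[i] k, (hmid _ _ _).2 ho,
          mem_wordLink.2 (Or.inl ⟨i, hi, k, Or.inl rfl⟩),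
          mem_wordLink.2 (Or.inl ⟨i, hi, k, Or.inr rfl⟩)⟩
      · exact Or.inl ⟨mem_wordLink.2 (Or.inl ⟨i, hi, k, Or.inl rfl⟩), hgrid _ _,
          fun h => (hmid _ _ _).1 h ho⟩
      · exact Or.inl ⟨mem_wordLink.2 (Or.inl ⟨i, hi, k, Or.inr rfl⟩),
          fun h => (hmid _ _ _).1 h ho, hgrid _ _⟩
      · exact Or.inl ⟨mem_wordLink.2 (Or.inr h), hclose h⟩
  rw [heq] at hmerge
  exact hmerge.symm

end Words

/-! ### Conjugation -/

section Words

variable {n : ℕ}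

/-- The inverse of a letter. -/
def invLetter (a : BraidGen n × Bool) : BraidGen n × Bool := (a.1, !a.2)

theorem overPos_invLetter (a : BraidGen n × Bool) : overPos (invLetter a) = underPos a := by
  rcases a with ⟨i, _ | _⟩ <;> rfl

theorem underPos_invLetter (a : BraidGen n × Bool) : underPos (invLetter a) = overPos a := by
  rcases a with ⟨i, _ | _⟩ <;> rfl

theorem letterPerm_invLetter (a : BraidGen n × Bool) :
    letterPerm (some (invLetter a)) = letterPerm (some a) := by
  simp [letterPerm, overPos_invLetter, underPos_invLetter, Equiv.swap_comm]

/-- An inverse letter runs through the same middle configuration backwards. Hence the last letter of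
a conjugate mirrors the first one. -/
theorem letterMid_invLetter (a : BraidGen n × Bool) (k : Fin n) :
    letterMid (some (invLetter a)) (letterPerm (some a) k) = letterMid (some a) k := by
  have hne := overPos_ne_underPos a
  simp only [letterMid, letterPerm, overPos_invLetter, underPos_invLetter]
  by_cases h1 : k = overPos a
  · subst h1; simp [invLetter]
  by_cases h2 : k = underPos a
  · subst h2; simp [hne, hne.symm, invLetter]
  rw [Equiv.swap_apply_of_ne_of_ne h1 h2]
  simp [h1, h2]

theorem letterPerm_letterPerm (a : BraidGen n × Bool) (k : Fin n) :
    letterPerm (some a) (letterPerm (some a) k) = k := by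
  simp [letterPerm]

/-- The configurations of a word between two letters which interchange the same positions. The
strands pass through the points `f 0`, `f 1` at the beginning, and through `f 1`, `f 0` at the
end. -/
noncomputable def conjC (s : Equiv.Perm (Fin n)) (w : List (GLetter n))
    (f : ℕ → Fin n → ℝ × ℝ) : ℕ → Fin n → ℝ × ℝ
  | 0, k => f 0 k
  | 1, k => f 1 k
  | j + 2, k => if j ≤ 2 * w.length then wordC w j (s k)
      else if j = 2 * w.length + 1 then f 1 (s (wordPerm w (s k)))
      else f 0 (s (wordPerm w (s k)))

/-- Only the two steps before the word, the two after it and the pages behind change with `f`. The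
hypothesis `hA` covers the steps between `f 0` and `f 1` and the pages behind, `hB` the steps
adjacent to the word. As `s` is an involution, both apply at the end as well, to the strand `s
(wordPerm w (s k))`. -/
theorem isotopic_conjC (s : Equiv.Perm (Fin n)) (w : List (GLetter n))
    {f f' : ℕ → Fin n → ℝ × ℝ} (hs : ∀ k, s (s k) = k) (h0 : ∀ i k, 0 ≤ (f i k).2)
    (h0' : ∀ i k, 0 ≤ (f' i k).2)
    (hA : ∀ k k', k ≠ k' → ∃ a, (dot a (f 0 k) < dot a (f 0 k') ∧ dot a (f 1 k) < dot a (f 1 k')) ∧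
      dot a (f' 0 k) < dot a (f' 0 k') ∧ dot a (f' 1 k) < dot a (f' 1 k'))
    (hB : ∀ k k', k ≠ k' → ∃ a, dot a (f 1 k) < dot a (f 1 k') ∧ dot a (f' 1 k) < dot a (f' 1 k') ∧
      dot a (gridY (s k), 0) < dot a (gridY (s k'), 0)) :
    PolyIsotopic (cfgEdges (2 * w.length + 4) (fun j => (j : ℝ) / 2) (conjC s w f))
      (cfgEdges (2 * w.length + 4) (fun j => (j : ℝ) / 2) (conjC s w f')) := by
  have cfg : ∀ f : ℕ → Fin n → ℝ × ℝ, (∀ i k, 0 ≤ (f i k).2) →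
      IsCfg (2 * w.length + 4) (s * wordPerm w * s) (fun j => (j : ℝ) / 2) (conjC s w f) := by
    intro f h0
    refine ⟨fun j _ => strictMono_half (Nat.lt_succ_self j), fun j k => ?_, fun k => ?_⟩
    · match j with
      | 0 => exact h0 _ _
      | 1 => exact h0 _ _
      | j + 2 =>
        simp only [conjC]
        split_ifs
        exacts [(wordC_snd _ _ _).1, h0 _ _, h0 _ _]
    · rw [show 2 * w.length + 4 + 3 = (2 * w.length + 5) + 2 by ring]
      simp only [conjC]
      rw [if_neg (by omega), if_neg (by omega)]
      rfl
  refine isotopic_cfgEdges (by omega) (cfg f h0) (cfg f' h0') fun j hj k k' hk => ?_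
  have hk1 : s k ≠ s k' := s.injective.ne hk
  have hk2 : s (wordPerm w (s k)) ≠ s (wordPerm w (s k')) :=
    s.injective.ne ((wordPerm w).injective.ne hk1)
  match j with
  | 0 =>
    obtain ⟨a, h1, h2⟩ := hA k k' hk
    exact ⟨a, SlabSep.cellSep h1 (by omega), SlabSep.cellSep h2 (by omega)⟩
  | 1 =>
    obtain ⟨a, h1, h2, h3⟩ := hB k k' hk
    refine ⟨a, SlabSep.cellSep ⟨h1, ?_⟩ (by omega), SlabSep.cellSep ⟨h2, ?_⟩ (by omega)⟩ <;>
      simpa [conjC] using h3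
  | j + 2 =>
    rcases lt_trichotomy j (2 * w.length) with h | h | h
    · obtain ⟨a, h1, h2⟩ := wordC_slabSep w j hk1
      have e : ∀ f, SlabSep a (conjC s w f) (j + 2) k k' := fun f => by
        simp only [SlabSep, conjC, if_pos h.le, if_pos (Nat.succ_le_of_lt h)]
        exact ⟨h1, h2⟩
      exact ⟨a, (e f).cellSep (by omega), (e f').cellSep (by omega)⟩
    · obtain ⟨a, h1, h2, h3⟩ := hB _ _ hk2
      simp only [hs] at h3
      have e : ∀ f : ℕ → Fin n → ℝ × ℝ, dot a (f 1 (s (wordPerm w (s k)))) <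
          dot a (f 1 (s (wordPerm w (s k')))) → SlabSep a (conjC s w f) (j + 2) k k' := fun f hf => by
        simp only [SlabSep, conjC, if_pos h.le, if_neg (show ¬ j + 1 ≤ 2 * w.length by omega),
          if_pos (show j + 1 = 2 * w.length + 1 by omega)]
        rw [wordC_ge w h.ge, wordC_ge w h.ge]
        exact ⟨h3, hf⟩
      exact ⟨a, (e f h1).cellSep (by omega), (e f' h2).cellSep (by omega)⟩
    · obtain ⟨a, ⟨h1, h2⟩, h3, h4⟩ := hA _ _ hk2
      rcases Nat.eq_or_lt_of_le (Nat.succ_le_of_lt h) with h | h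
      · have e : ∀ f : ℕ → Fin n → ℝ × ℝ, dot a (f 1 (s (wordPerm w (s k)))) <
            dot a (f 1 (s (wordPerm w (s k')))) → dot a (f 0 (s (wordPerm w (s k)))) <
            dot a (f 0 (s (wordPerm w (s k')))) → SlabSep a (conjC s w f) (j + 2) k k' :=
          fun f hf hf' => by
            simp only [SlabSep, conjC, if_neg (show ¬ j ≤ 2 * w.length by omega),
              if_neg (show ¬ j + 1 ≤ 2 * w.length by omega),
              if_pos (show j = 2 * w.length + 1 by omega),
              if_neg (show ¬ j + 1 = 2 * w.length + 1 by omega)]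
            exact ⟨hf, hf'⟩
        exact ⟨a, (e f h2 h1).cellSep (by omega), (e f' h4 h3).cellSep (by omega)⟩
      · have e : ∀ f : ℕ → Fin n → ℝ × ℝ, dot a (f 0 (s (wordPerm w (s k)))) <
            dot a (f 0 (s (wordPerm w (s k')))) →
            CellSep (2 * w.length + 4) (j + 2) a (conjC s w f) k k' := fun f hf => by
          simp only [CellSep, conjC, if_neg (show ¬ j ≤ 2 * w.length by omega),
            if_neg (show ¬ j + 1 ≤ 2 * w.length by omega),
            if_neg (show ¬ j = 2 * w.length + 1 by omega),
            if_neg (show ¬ j + 1 = 2 * w.length + 1 by omega)]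
          exact ⟨⟨hf, hf⟩, fun _ => ⟨hf, hf⟩⟩
        exact ⟨a, e f h1, e f' h3⟩

theorem wordC_conj (a : BraidGen n × Bool) (w : List (GLetter n)) :
    wordC (some a :: (w ++ [some (invLetter a)])) = conjC (letterPerm (some a)) w
      (fun i k => if i = 0 then (gridY k, 0) else letterMid (some a) k) := by
  funext j k
  match j with
  | 0 => rfl
  | 1 => rfl
  | j + 2 =>
    simp only [conjC, wordC]
    rcases le_or_gt j (2 * w.length) with h | h
    · rw [if_pos h, wordC_append_left _ _ h]
    · obtain ⟨i, rfl⟩ := Nat.exists_eq_add_of_lt h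
      rw [if_neg (by omega), add_assoc, wordC_append_right]
      rcases i with _ | i
      · rw [if_pos (by omega), if_neg one_ne_zero, ← letterMid_invLetter, letterPerm_letterPerm]
        rfl
      · rw [if_neg (by omega), if_pos trivial, ← letterPerm_invLetter]
        rfl

theorem wordC_none_none (s : Equiv.Perm (Fin n)) (hs : ∀ k, s (s k) = k) (w : List (GLetter n)) :
    (fun j k => wordC (none :: (w ++ [none])) j (s k)) = conjC s w (fun _ k => (gridY (s k), 0)) := by
  funext j k
  match j with
  | 0 => rfl
  | 1 => rfl
  | j + 2 =>
    simp only [conjC, wordC, letterPerm, Equiv.Perm.one_apply]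
    rcases le_or_gt j (2 * w.length) with h | h
    · rw [if_pos h, wordC_append_left _ _ h]
    · obtain ⟨i, rfl⟩ := Nat.exists_eq_add_of_lt h
      rw [if_neg (by omega), add_assoc, wordC_append_right, hs]
      rcases i with _ | i
      · simp [wordC, letterMid]
      · simp [wordC, letterPerm]

/-- After the two crossings have been undone, the strands carry labels permuted by the letter; an
edge set does not see labels. -/
theorem cfgEdges_relabel {K : Type*} (L : ℕ) (x : ℕ → ℝ) (c : ℕ → K → ℝ × ℝ) (s : Equiv.Perm K) :
    cfgEdges L x (fun j k => c j (s k)) = cfgEdges L x c := by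
  ext e
  constructor
  · rintro ⟨j, k, hj, rfl⟩
    exact ⟨j, s k, hj, rfl⟩
  · rintro ⟨j, k, hj, rfl⟩
    exact ⟨j, s.symm k, hj, by simp⟩

/-- Only the two strands that cross require a special functional; all other pairs keep their
`y`-order. -/
theorem sep_of_cases (a : BraidGen n × Bool) {P : ℝ × ℝ → Fin n → Fin n → Prop}
    (hneg : ∀ d k k', P d k k' → P (-d) k' k)
    (hlt : ∀ k k', gridY k < gridY k' → (letterMid (some a) k).1 < (letterMid (some a) k').1 →
      gridY (letterPerm (some a) k) < gridY (letterPerm (some a) k') → P (1, 0) k k')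
    (hou : ∃ d, P d (underPos a) (overPos a)) {k k' : Fin n} (hk : k ≠ k') : ∃ d, P d k k' := by
  by_cases h1 : k = underPos a ∧ k' = overPos a
  · rw [h1.1, h1.2]; exact hou
  by_cases h2 : k = overPos a ∧ k' = underPos a
  · rw [h2.1, h2.2]
    obtain ⟨d, hd⟩ := hou
    exact ⟨-d, hneg _ _ _ hd⟩
  rcases lt_or_gt_of_ne hk with h | h
  · obtain ⟨h3, h4⟩ := letter_lt a h (by tauto) (by tauto)
    exact ⟨_, hneg _ _ _ (hlt k' k (gridY_lt.2 h) h3 h4)⟩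
  · obtain ⟨h3, h4⟩ := letter_lt a h (by tauto) (by tauto)
    exact ⟨_, hlt k k' (gridY_lt.2 h) h3 h4⟩

theorem dot_neg (d q : ℝ × ℝ) : dot (-d) q = -dot d q := by
  simp [dot]; ring

theorem isotopic_conjC_letter (a : BraidGen n × Bool) (w : List (GLetter n))
    {p q p' q' : Fin n → ℝ × ℝ} (h0 : ∀ k, 0 ≤ (p k).2 ∧ 0 ≤ (q k).2 ∧ 0 ≤ (p' k).2 ∧ 0 ≤ (q' k).2)
    (hlt : ∀ k k', gridY k < gridY k' → (letterMid (some a) k).1 < (letterMid (some a) k').1 →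
      gridY (letterPerm (some a) k) < gridY (letterPerm (some a) k') →
      (p k).1 < (p k').1 ∧ (q k).1 < (q k').1 ∧ (p' k).1 < (p' k').1 ∧ (q' k).1 < (q' k').1)
    (hA : ∃ d, dot d (p (underPos a)) < dot d (p (overPos a)) ∧
      dot d (q (underPos a)) < dot d (q (overPos a)) ∧
      dot d (p' (underPos a)) < dot d (p' (overPos a)) ∧
      dot d (q' (underPos a)) < dot d (q' (overPos a)))
    (hB : ∃ d, dot d (q (underPos a)) < dot d (q (overPos a)) ∧
      dot d (q' (underPos a)) < dot d (q' (overPos a)) ∧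
      dot d (gridY (overPos a), 0) < dot d (gridY (underPos a), 0)) :
    PolyIsotopic (cfgEdges (2 * w.length + 4) (fun j => (j : ℝ) / 2)
        (conjC (letterPerm (some a)) w fun i k => if i = 0 then p k else q k))
      (cfgEdges (2 * w.length + 4) (fun j => (j : ℝ) / 2)
        (conjC (letterPerm (some a)) w fun i k => if i = 0 then p' k else q' k)) := by
  have hso : letterPerm (some a) (overPos a) = underPos a := by simp [letterPerm]
  have hsu : letterPerm (some a) (underPos a) = overPos a := by simp [letterPerm]
  refine isotopic_conjC _ w (letterPerm_letterPerm a)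
    (fun i k => by split_ifs; exacts [(h0 k).1, (h0 k).2.1])
    (fun i k => by split_ifs; exacts [(h0 k).2.2.1, (h0 k).2.2.2])
    (fun k k' hk => ?_) (fun k k' hk => ?_)
  · simp only [if_true, one_ne_zero, if_false, and_assoc]
    refine sep_of_cases a (P := fun d k k' => dot d (p k) < dot d (p k') ∧
      dot d (q k) < dot d (q k') ∧ dot d (p' k) < dot d (p' k') ∧ dot d (q' k) < dot d (q' k'))
      (fun d k k' h => ?_) (fun k k' h1 h2 h3 => ?_) hA hk
    · simpa only [dot_neg, neg_lt_neg_iff] using h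
    · simpa [dot] using hlt k k' h1 h2 h3
  · simp only [one_ne_zero, if_false]
    refine sep_of_cases a (P := fun d k k' => dot d (q k) < dot d (q k') ∧
      dot d (q' k) < dot d (q' k') ∧ dot d (gridY (letterPerm (some a) k), 0) <
        dot d (gridY (letterPerm (some a) k'), 0))
      (fun d k k' h => ?_) (fun k k' h1 h2 h3 => ?_) (by rwa [hso, hsu]) hk
    · simpa only [dot_neg, neg_lt_neg_iff] using h
    · have := hlt k k' h1 h2 h3
      simpa [dot] using ⟨this.2.1, this.2.2.2, h3⟩

/-- Conjugation by a letter does not change the closure. -/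
theorem isotopic_conj_letter (a : BraidGen n × Bool) (w : List (GLetter n)) :
    PolyIsotopic (wordLink (some a :: (w ++ [some (invLetter a)]))) (wordLink w) := by
  have hso : letterPerm (some a) (overPos a) = underPos a := by simp [letterPerm]
  have hsu : letterPerm (some a) (underPos a) = overPos a := by simp [letterPerm]
  have hne := overPos_ne_underPos a
  have mo : letterMid (some a) (overPos a) = (-(a.1.1 + 1 / 2 : ℝ), 1) := by simp [letterMid]
  have mu : letterMid (some a) (underPos a) = (-(a.1.1 + 1 / 2 : ℝ), 0) := by
    simp [letterMid, hne.symm]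
  obtain ⟨δ, hδ⟩ : ∃ δ, δ = gridY (overPos a) - gridY (underPos a) := ⟨_, rfl⟩
  have hδ0 : 0 < δ * (gridY (overPos a) - gridY (underPos a)) := by
    rw [← hδ, hδ]
    exact mul_self_pos.2 (sub_ne_zero.2 (gridY_injective.ne hne))
  obtain ⟨z, hz⟩ : ∃ z : Fin n → ℝ, z = fun k => if k = overPos a then 1 else 0 := ⟨_, rfl⟩
  have hz0 : ∀ k, 0 ≤ z k := fun k => by simp only [hz]; split_ifs <;> norm_num
  have zo : z (overPos a) = 1 := by simp [hz]
  have zu : z (underPos a) = 0 := by simp [hz, hne.symm]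
  -- The upper strand is lifted to height `1` also on the outer pages, hence along the closing arcs.
  have step1 := isotopic_conjC_letter a w (p := fun k => (gridY k, 0)) (q := letterMid (some a))
    (p' := fun k => (gridY k, z k)) (q' := letterMid (some a))
    (fun k => ⟨le_rfl, (letterMid_snd _ _).1, hz0 k, (letterMid_snd _ _).1⟩)
    (fun k k' h1 h2 h3 => ⟨h1, h2, h1, h2⟩)
    ⟨(δ, 1), by simp only [mo, mu, zo, zu, dot]; refine ⟨?_, ?_, ?_, ?_⟩ <;> linarith⟩
    ⟨(-δ, 1), by simp only [mo, mu, dot]; refine ⟨?_, ?_, ?_⟩ <;> linarith⟩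
  -- Separated by height alone, the two strands exchange their `y`-positions, which undoes both
  -- crossings at once.
  have step2 := isotopic_conjC_letter a w (p := fun k => (gridY k, z k)) (q := letterMid (some a))
    (p' := fun k => (gridY (letterPerm (some a) k), z k))
    (q' := fun k => (gridY (letterPerm (some a) k), z k))
    (fun k => ⟨hz0 k, (letterMid_snd _ _).1, hz0 k, hz0 k⟩)
    (fun k k' h1 h2 h3 => ⟨h1, h2, h3, h3⟩)
    ⟨(0, 1), by simp only [mo, mu, zo, zu, dot]; refine ⟨?_, ?_, ?_, ?_⟩ <;> linarith⟩
    ⟨(-δ, 1), by simp only [mo, mu, zo, zu, hso, hsu, dot]; refine ⟨?_, ?_, ?_⟩ <;> linarith⟩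
  -- The strands are now separated by `y`, so the lifted one can be lowered again.
  have step3 := isotopic_conjC_letter a w (p := fun k => (gridY (letterPerm (some a) k), z k))
    (q := fun k => (gridY (letterPerm (some a) k), z k))
    (p' := fun k => (gridY (letterPerm (some a) k), 0))
    (q' := fun k => (gridY (letterPerm (some a) k), 0))
    (fun k => ⟨hz0 k, hz0 k, le_rfl, le_rfl⟩)
    (fun k k' h1 h2 h3 => ⟨h3, h3, h3, h3⟩)
    ⟨(-δ, 0), by simp only [zo, zu, hso, hsu, dot]; refine ⟨?_, ?_, ?_, ?_⟩ <;> linarith⟩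
    ⟨(-δ, 0), by simp only [zo, zu, hso, hsu, dot]; refine ⟨?_, ?_, ?_⟩ <;> linarith⟩
  have hall := (step1.trans step2).trans step3
  have hif : ∀ f : Fin n → ℝ × ℝ, (fun (i : ℕ) k => if i = 0 then f k else f k) = fun _ k => f k :=
    fun f => by funext i k; exact ite_self _
  rw [hif (fun k => (gridY (letterPerm (some a) k), 0))] at hall
  rw [← wordC_conj, ← wordC_none_none _ (letterPerm_letterPerm a), cfgEdges_relabel] at hall
  have e1 : 2 * w.length + 4 = 2 * (some a :: (w ++ [some (invLetter a)])).length := by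
    simp; ring
  have e2 : 2 * w.length + 4 = 2 * ((none : GLetter n) :: (w ++ [none])).length := by
    simp; ring
  nth_rewrite 1 [e1] at hall
  rw [e2] at hall
  refine PolyIsotopic.trans (F := wordLink (none :: (w ++ [none]))) hall ?_
  have h1 := isotopic_none [] (w ++ [none])
  have h2 := isotopic_none w []
  rw [List.append_nil] at h2
  exact h1.trans h2

end Words

/-! ### Local moves -/

section Words

variable {n : ℕ}

theorem letterPerm_apply_lo (i : BraidGen n) (b : Bool) :
    letterPerm (some (i, b)) = Equiv.swap i.lo i.hi := by
  cases b <;> simp [letterPerm, overPos, underPos, Equiv.swap_comm]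

theorem BraidGen.lo_val (i : BraidGen n) : (i.lo : ℕ) + 1 = i.1 := by
  have := i.2
  simp only [BraidGen.lo]
  omega

theorem BraidGen.hi_val (i : BraidGen n) : (i.hi : ℕ) = i.1 := rfl

/-- Heights of layers in which a strand is the higher the further left it is. -/
def leftHeight (k : Fin n) : ℝ := n - (k : ℕ)

theorem leftHeight_nonneg (k : Fin n) : 0 ≤ leftHeight k := by
  have : ((k : ℕ) : ℝ) ≤ n := by exact_mod_cast k.2.le
  simp only [leftHeight]
  linarith

theorem leftHeight_gap (k k' : Fin n) (h : k ≠ k') :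
    leftHeight k + 1 ≤ leftHeight k' ∨ leftHeight k' + 1 ≤ leftHeight k := by
  simp only [leftHeight]
  rcases lt_or_gt_of_ne h with h | h
  · right
    have : ((k : ℕ) : ℝ) + 1 ≤ (k' : ℕ) := by exact_mod_cast Nat.succ_le_of_lt h
    linarith
  · left
    have : ((k' : ℕ) : ℝ) + 1 ≤ (k : ℕ) := by exact_mod_cast Nat.succ_le_of_lt h
    linarith

theorem leftHeight_lt {k k' : Fin n} : leftHeight k < leftHeight k' ↔ (k' : ℕ) < k := by
  simp [leftHeight]

/-- Heights of layers in which a strand is the higher the further right it is. -/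
def rightHeight (k : Fin n) : ℝ := (k : ℕ)

theorem rightHeight_gap (k k' : Fin n) (h : k ≠ k') :
    rightHeight k + 1 ≤ rightHeight k' ∨ rightHeight k' + 1 ≤ rightHeight k := by
  simp only [rightHeight]
  rcases lt_or_gt_of_ne h with h | h
  · left
    exact_mod_cast Nat.succ_le_of_lt h
  · right
    exact_mod_cast Nat.succ_le_of_lt h

theorem rightHeight_lt {k k' : Fin n} : rightHeight k < rightHeight k' ↔ (k : ℕ) < k' := by
  simp [rightHeight]

/-- Two inverse letters cancel. -/
theorem isotopic_cancel (u v : List (GLetter n)) (a : BraidGen n × Bool) :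
    PolyIsotopic (wordLink (u ++ (some a :: some (invLetter a) :: v))) (wordLink (u ++ v)) := by
  have hp : wordPerm [some a, some (invLetter a)] = wordPerm [none, none] := by
    ext k
    simp [wordPerm, letterPerm_invLetter, letterPerm_letterPerm]
    simp [letterPerm]
  have key : PolyIsotopic (wordLink (u ++ ([some a, some (invLetter a)] ++ v)))
      (wordLink (u ++ ([none, none] ++ v))) := by
    -- The upper strand starts on the right for a negative letter and on the left for a positive
    -- one; the layers are chosen accordingly.
    rcases a with ⟨i, _ | _⟩
    · refine isotopic_of_layered (h := rightHeight) (fun k => Nat.cast_nonneg _) rightHeight_gap u v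
        ?_ ?_ (by simp) rfl hp <;>
      simp [Layered, invLetter, overPos, underPos, rightHeight_lt, BraidGen.lo, BraidGen.hi]
      exact i.2.1
    · refine isotopic_of_layered (h := leftHeight) leftHeight_nonneg leftHeight_gap u v
        ?_ ?_ (by simp) rfl hp <;>
      simp [Layered, invLetter, overPos, underPos, leftHeight_lt, BraidGen.lo, BraidGen.hi]
      exact i.2.1
  refine key.trans ((isotopic_none u (none :: v)).trans (isotopic_none u v))

/-- Far letters commute. -/
theorem isotopic_commute (u v : List (GLetter n)) {i j : BraidGen n} (hij : i.1 + 2 ≤ j.1) :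
    PolyIsotopic (wordLink (u ++ ([some (i, true), some (j, true)] ++ v)))
      (wordLink (u ++ ([some (j, true), some (i, true)] ++ v))) := by
  have hi := i.lo_val
  have hj := j.lo_val
  have hi' := i.hi_val
  have hj' := j.hi_val
  have e1 : i.lo ≠ j.lo := by rw [Ne, Fin.ext_iff]; omega
  have e2 : i.lo ≠ j.hi := by rw [Ne, Fin.ext_iff]; omega
  have e3 : i.hi ≠ j.lo := by rw [Ne, Fin.ext_iff]; omega
  have e4 : i.hi ≠ j.hi := by rw [Ne, Fin.ext_iff]; omega
  -- In a positive word in which any two strands cross at most once, the upper strand of each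
  -- crossing started further left, so both sides fit the layers of `leftHeight`.
  refine isotopic_of_layered leftHeight_nonneg leftHeight_gap u v ?_ ?_ (by simp) rfl ?_
  · simp only [Layered, overPos, underPos, if_true, leftHeight_lt,
      Equiv.swap_apply_of_ne_of_ne e1.symm e3.symm, Equiv.swap_apply_of_ne_of_ne e2.symm e4.symm]
    exact ⟨by omega, by omega, trivial⟩
  · simp only [Layered, overPos, underPos, if_true, leftHeight_lt,
      Equiv.swap_apply_of_ne_of_ne e1 e2, Equiv.swap_apply_of_ne_of_ne e3 e4]
    exact ⟨by omega, by omega, trivial⟩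
  · simp only [wordPerm, letterPerm_apply_lo, one_mul]
    rw [Equiv.swap_mul_eq_mul_swap, Equiv.swap_inv, Equiv.swap_apply_of_ne_of_ne e1.symm e3.symm,
      Equiv.swap_apply_of_ne_of_ne e2.symm e4.symm]

/-- The third Reidemeister move. -/
theorem isotopic_braid (u v : List (GLetter n)) {i j : BraidGen n} (hij : i.1 + 1 = j.1) :
    PolyIsotopic (wordLink (u ++ ([some (i, true), some (j, true), some (i, true)] ++ v)))
      (wordLink (u ++ ([some (j, true), some (i, true), some (j, true)] ++ v))) := by
  have hi := i.lo_val
  have hj := j.lo_val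
  have hi' := i.hi_val
  have hj' := j.hi_val
  have e0 : j.lo = i.hi := by rw [Fin.ext_iff]; omega
  have e1 : i.lo ≠ i.hi := by rw [Ne, Fin.ext_iff]; omega
  have e2 : i.lo ≠ j.hi := by rw [Ne, Fin.ext_iff]; omega
  have e3 : i.hi ≠ j.hi := by rw [Ne, Fin.ext_iff]; omega
  -- Each pair of the three strands crosses exactly once, so both sides are layered by `leftHeight`.
  refine isotopic_of_layered leftHeight_nonneg leftHeight_gap u v ?_ ?_ (by simp) rfl ?_
  · simp only [Layered, overPos, underPos, if_true, leftHeight_lt, e0, Equiv.swap_apply_left,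
      Equiv.swap_apply_right, Equiv.swap_apply_of_ne_of_ne e2.symm e3.symm,
      Equiv.swap_apply_of_ne_of_ne e1 e2]
    exact ⟨by omega, by omega, by omega, trivial⟩
  · simp only [Layered, overPos, underPos, if_true, leftHeight_lt, e0, Equiv.swap_apply_left,
      Equiv.swap_apply_right, Equiv.swap_apply_of_ne_of_ne e2.symm e3.symm,
      Equiv.swap_apply_of_ne_of_ne e1 e2]
    exact ⟨by omega, by omega, by omega, trivial⟩
  · simp only [wordPerm, letterPerm_apply_lo, one_mul, e0]
    rw [Equiv.swap_mul_swap_mul_swap e1 e2, Equiv.swap_comm i.lo i.hi, Equiv.swap_comm i.hi j.hi,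
      Equiv.swap_mul_swap_mul_swap e3.symm e2.symm, Equiv.swap_comm]

end Words

/-! ### Stabilization -/

theorem replace_corner {R : Set (Pt × Pt)} {a b c : Pt}
    (hE : IsPolygonalLink (R ∪ {(a, c), (c, b)})) (hac : (a, c) ∉ R) (hcb : (c, b) ∉ R)
    (hull : ∀ f ∈ R, ∀ z ∈ convexHull ℝ {a, c, b}, z ∈ segment ℝ f.1 f.2 →
      z ∈ segment ℝ a c ∨ z ∈ segment ℝ c b) :
    PolyIsotopic (R ∪ {(a, c), (c, b)}) (R ∪ {(a, b)}) := by
  have key := removeVertex hE (Or.inr (Or.inl rfl)) (Or.inr (Or.inr rfl)) (by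
    rintro f (hf | hf | hf) h1 h2
    · rw [Set.pair_comm b c]
      exact hull f hf
    exacts [absurd hf h1, absurd hf h2])
  convert key using 2
  ext e
  constructor
  · intro he
    refine ⟨Or.inl he, ?_⟩
    rintro (rfl | rfl)
    exacts [hac he, hcb he]
  · rintro ⟨he | he, h⟩
    exacts [he, absurd he h]

theorem segment_coords {a b c a' b' c' : ℝ} {z : Pt}
    (h : z ∈ segment ℝ (pt a b c) (pt a' b' c')) : ∃ s, 0 ≤ s ∧ s ≤ 1 ∧
      z = pt (a + s * (a' - a)) (b + s * (b' - b)) (c + s * (c' - c)) := by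
  obtain ⟨s, ⟨h0, h1⟩, rfl⟩ := mem_segment_iff_exists.1 h
  refine ⟨s, h0, h1, ?_⟩
  ext i
  fin_cases i <;> simp [pt]

theorem triangle_coords {a b c a' b' c' a'' b'' c'' : ℝ} {z : Pt}
    (h : z ∈ convexHull ℝ {pt a b c, pt a' b' c', pt a'' b'' c''}) :
    ∃ s t, 0 ≤ s ∧ 0 ≤ t ∧ s + t ≤ 1 ∧ z = pt (a + s * (a' - a) + t * (a'' - a))
      (b + s * (b' - b) + t * (b'' - b)) (c + s * (c' - c) + t * (c'' - c)) := by
  obtain ⟨y, hy, hz⟩ := mem_triangle h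
  obtain ⟨s, h0, h1, rfl⟩ := segment_coords hy
  obtain ⟨t, h2, h3, rfl⟩ := segment_coords hz
  refine ⟨t * (1 - s), t * s, mul_nonneg h2 (by linarith), mul_nonneg h2 h0, by linarith, ?_⟩
  rw [pt_inj]
  refine ⟨?_, ?_, ?_⟩ <;> ring

theorem mem_segment_pt {a b c a' b' c' s : ℝ} (h0 : 0 ≤ s) (h1 : s ≤ 1) {x y z : ℝ}
    (hx : x = a + s * (a' - a)) (hy : y = b + s * (b' - b)) (hz : z = c + s * (c' - c)) :
    pt x y z ∈ segment ℝ (pt a b c) (pt a' b' c') := by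
  refine mem_segment_iff_exists.2 ⟨s, ⟨h0, h1⟩, ?_⟩
  subst hx hy hz
  ext i
  fin_cases i <;> simp [pt]

section Stabilization

variable {m l : ℕ}

/-- The edges of the last strand from the page `j` to the page `l`. -/
def lastStrand (m j l : ℕ) : Set (Pt × Pt) :=
  {e | ∃ i, j ≤ i ∧ i < l ∧ e = (pt i (-(m + 1)) 0, pt (i + 1) (-(m + 1)) 0)}

theorem lastStrand_self : lastStrand m l l = ∅ := by
  ext e
  simp only [lastStrand, Set.mem_ofPred_eq, Set.mem_empty_iff_false, iff_false]
  rintro ⟨i, h1, h2, -⟩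
  omega

theorem lastStrand_eq_insert {j : ℕ} (hj : j < l) : lastStrand m j l =
    insert (pt j (-(m + 1)) 0, pt (j + 1) (-(m + 1)) 0) (lastStrand m (j + 1) l) := by
  ext e
  simp only [lastStrand, Set.mem_insert_iff, Set.mem_ofPred_eq]
  constructor
  · rintro ⟨i, h1, h2, rfl⟩
    rcases Nat.eq_or_lt_of_le h1 with rfl | h1
    · exact Or.inl rfl
    · exact Or.inr ⟨i, h1, h2, rfl⟩
  · rintro (rfl | ⟨i, h1, h2, rfl⟩)
    · exact ⟨j, le_rfl, hj, rfl⟩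
    · exact ⟨i, by omega, h2, rfl⟩

/-- The edges of the added strand which do not lie over a page. -/
def stabEdges (m l : ℕ) : Set (Pt × Pt) :=
  {(pt l (-m) 0, pt (l + 1 / 2) (-(m + 1 / 2)) 1),
    (pt (l + 1 / 2) (-(m + 1 / 2)) 1, pt (l + 1) (-(m + 1)) 0),
    (pt (l + 1) (-(m + 1)) 0, pt (l + 2) (-(m + 1)) (-1)),
    (pt (l + 2) (-(m + 1)) (-1), pt (-1) (-(m + 1)) (-1)),
    (pt l (-(m + 1)) 0, pt (l + 1) (-m) 0)}

/-- The added strand runs in the plane `y = -(m + 1)`, which the rest of the braid does not meet.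
Its vertices are removed one by one from the left, and the edge coming from behind is lengthened
each time. -/
theorem isotopic_lastStrand {T : Set (Pt × Pt)}
    (hT : ∀ e ∈ T, ∀ z ∈ segment ℝ e.1 e.2, -(m : ℝ) ≤ z 1)
    (hE : IsPolygonalLink (T ∪ lastStrand m 0 l ∪ stabEdges m l ∪
      {(pt (-1) (-(m + 1)) (-1), pt (0 : ℕ) (-(m + 1)) 0)})) {j : ℕ} (hj : j ≤ l) :
    PolyIsotopic (T ∪ lastStrand m 0 l ∪ stabEdges m l ∪
        {(pt (-1) (-(m + 1)) (-1), pt (0 : ℕ) (-(m + 1)) 0)})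
      (T ∪ lastStrand m j l ∪ stabEdges m l ∪
        {(pt (-1) (-(m + 1)) (-1), pt j (-(m + 1)) 0)}) := by
  induction j with
  | zero => exact PolyIsotopic.refl hE
  | succ j ih =>
    have h1 := ih (by omega)
    have hjl : (j : ℝ) + 1 ≤ l := by exact_mod_cast hj
    have hj0 : (0 : ℝ) ≤ j := Nat.cast_nonneg j
    refine h1.trans ?_
    have e1 : T ∪ lastStrand m j l ∪ stabEdges m l ∪
        {(pt (-1) (-(m + 1)) (-1), pt j (-(m + 1)) 0)} =
        (T ∪ lastStrand m (j + 1) l ∪ stabEdges m l) ∪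
          {(pt (-1) (-(m + 1)) (-1), pt j (-(m + 1)) 0),
            (pt j (-(m + 1)) 0, pt (j + 1) (-(m + 1)) 0)} := by
      rw [lastStrand_eq_insert (show j < l by omega)]
      ext e
      simp only [Set.mem_union, Set.mem_insert_iff, Set.mem_singleton_iff]
      tauto
    have hP := h1.2.1
    rw [e1] at hP ⊢
    push_cast
    have hTy : ∀ e ∈ T, -(m : ℝ) ≤ e.1 1 := fun e he => hT e he _ (left_mem_segment ℝ _ _)
    refine replace_corner hP ?_ ?_ ?_
    · rintro ((h | ⟨i, -, -, h⟩) | h)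
      · have := hTy _ h
        simp only [pt, Matrix.cons_val_one, Matrix.cons_val_zero] at this
        linarith
      · simp [pt_inj] at h
      · simp [stabEdges, pt_inj] at h
    · rintro ((h | ⟨i, h3, -, h⟩) | h)
      · have := hTy _ h
        simp only [pt, Matrix.cons_val_one, Matrix.cons_val_zero] at this
        linarith
      · simp [pt_inj] at h
        omega
      · simp [stabEdges, pt_inj] at h
    · intro f hf z hz hzf
      obtain ⟨s, t, hs, ht, hst, rfl⟩ := triangle_coords hz
      -- Points of the triangle at height `0` lie on the second edge at the removed corner; height
      -- decides the remaining cases.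
      have top : s + t = 1 → pt (-1 + s * ((j : ℝ) - -1) + t * (j + 1 - -1))
          (-(m + 1 : ℝ) + s * (-(m + 1) - -(m + 1)) + t * (-(m + 1) - -(m + 1)))
          (-1 + s * (0 - -1) + t * (0 - -1)) ∈
          segment ℝ (pt j (-(m + 1)) 0) (pt (j + 1) (-(m + 1)) 0) := fun h =>
        mem_segment_pt ht (by linarith) (by linear_combination (j + 1 : ℝ) * h) (by ring)
          (by linear_combination h)
      have hx : -1 + s * ((j : ℝ) - -1) + t * (j + 1 - -1) < l + 1 := by
        nlinarith [mul_nonneg hs hj0, mul_nonneg ht hj0, mul_le_mul_of_nonneg_right hst hj0]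
      rcases hf with (hf | ⟨i, h3, h4, rfl⟩) | rfl | rfl | rfl | rfl | rfl
      · have := hT f hf _ hzf
        simp [pt] at this
        linarith
      all_goals
        obtain ⟨r, hr0, hr1, hr⟩ := segment_coords hzf
        obtain ⟨hrx, hry, hrz⟩ := pt_inj.1 hr
      · exact Or.inr (top (by linarith))
      · linarith
      · have : r = 1 := by linarith
        subst this
        linarith
      · linarith
      · obtain rfl : s = 0 := by linarith
        obtain rfl : t = 0 := by linarith
        left
        simp only [zero_mul, add_zero]
        exact left_mem_segment ℝ _ _
      · exact Or.inr (top (by linarith))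

/-- After the straight part, five corners of the added loop are removed in turn, the top of the
bridge last. Because `T` stays in `y ≥ -m`, it can meet the triangles at most along their boundary
in the plane `y = -m`. -/
theorem isotopic_stabilization {T : Set (Pt × Pt)}
    (hT : ∀ e ∈ T, ∀ z ∈ segment ℝ e.1 e.2, -(m : ℝ) ≤ z 1)
    (hE : IsPolygonalLink (T ∪ lastStrand m 0 l ∪ stabEdges m l ∪
      {(pt (-1) (-(m + 1)) (-1), pt (0 : ℕ) (-(m + 1)) 0)}))
    (hF : IsPolygonalLink (T ∪ {(pt l (-m) 0, pt (l + 1) (-m) 0)}))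
    (hPR : (pt l (-m) 0, pt (l + 1) (-m) 0) ∉ T) :
    PolyIsotopic (T ∪ lastStrand m 0 l ∪ stabEdges m l ∪
        {(pt (-1) (-(m + 1)) (-1), pt (0 : ℕ) (-(m + 1)) 0)})
      (T ∪ {(pt l (-m) 0, pt (l + 1) (-m) 0)}) := by
  have h1 := isotopic_lastStrand hT hE le_rfl
  have hl0 : (0 : ℝ) ≤ l := Nat.cast_nonneg l
  have hTy : ∀ {x y z x' y' z' : ℝ}, (pt x y z, pt x' y' z') ∈ T → -(m : ℝ) ≤ y ∧ -(m : ℝ) ≤ y' :=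
    fun he => ⟨hT _ he _ (left_mem_segment ℝ _ _), hT _ he _ (right_mem_segment ℝ _ _)⟩
  have hTz : ∀ f ∈ T, ∀ {x y z : ℝ}, pt x y z ∈ segment ℝ f.1 f.2 → -(m : ℝ) ≤ y :=
    fun f hf x y z h => hT f hf _ h
  rw [lastStrand_self, Set.union_empty] at h1
  refine h1.trans ?_
  -- the corner behind the braid on the right
  have e1 : T ∪ stabEdges m l ∪ {(pt (-1) (-(m + 1)) (-1), pt l (-(m + 1)) 0)} =
      (T ∪ {(pt l (-m) 0, pt (l + 1 / 2) (-(m + 1 / 2)) 1),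
        (pt (l + 1 / 2) (-(m + 1 / 2)) 1, pt (l + 1) (-(m + 1)) 0),
        (pt (-1) (-(m + 1)) (-1), pt l (-(m + 1)) 0),
        (pt l (-(m + 1)) 0, pt (l + 1) (-m) 0)}) ∪
        {(pt (l + 1) (-(m + 1)) 0, pt (l + 2) (-(m + 1)) (-1)),
          (pt (l + 2) (-(m + 1)) (-1), pt (-1) (-(m + 1)) (-1))} := by
    ext e
    simp only [stabEdges, Set.mem_union, Set.mem_insert_iff, Set.mem_singleton_iff]
    tauto
  have hP := h1.2.1
  rw [e1] at hP ⊢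
  have h2 := replace_corner hP
    (by
      rintro (h | h)
      · linarith [hTy h]
      · simp [pt_inj] at h
        try linarith)
    (by
      rintro (h | h)
      · linarith [hTy h]
      · simp [pt_inj] at h
        try linarith)
    (by
      intro f hf z hz hzf
      obtain ⟨s, t, hs, ht, hst, rfl⟩ := triangle_coords hz
      rcases hf with hf | rfl | rfl | rfl | rfl
      · linarith [hTz f hf hzf]
      all_goals
        obtain ⟨r, hr0, hr1, hr⟩ := segment_coords hzf
        obtain ⟨hrx, hry, hrz⟩ := pt_inj.1 hr
      · linarith
      · left
        obtain rfl : r = 1 := by linarith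
        rw [hr]
        convert left_mem_segment ℝ _ _ using 2 <;> ring
      · right
        have hsl := mul_nonneg hs hl0
        have : r = -(s * (l + 3)) := by linear_combination hrx - (l + 2 : ℝ) * hrz
        obtain rfl : r = 0 := by linarith
        rw [hr]
        convert right_mem_segment ℝ _ _ using 2 <;> ring
      · obtain rfl : r = 0 := by linarith
        have hsl := mul_nonneg hs hl0
        have : s * (l + 3) = -1 := by linear_combination hrx - (l + 2 : ℝ) * hrz
        linarith)
  refine h2.trans ?_
  -- the corner behind the braid on the left
  have e2 : T ∪ {(pt l (-m) 0, pt (l + 1 / 2) (-(m + 1 / 2)) 1), (pt (l + 1 / 2) (-(m + 1 / 2)) 1, pt (l + 1) (-(m + 1)) 0), (pt (-1) (-(m + 1)) (-1), pt l (-(m + 1)) 0), (pt l (-(m + 1)) 0, pt (l + 1) (-m) 0)} ∪ {(pt (l + 1) (-(m + 1)) 0, pt (-1) (-(m + 1)) (-1))} =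
      (T ∪ {(pt l (-m) 0, pt (l + 1 / 2) (-(m + 1 / 2)) 1), (pt (l + 1 / 2) (-(m + 1 / 2)) 1, pt (l + 1) (-(m + 1)) 0), (pt l (-(m + 1)) 0, pt (l + 1) (-m) 0)}) ∪
        {(pt (l + 1) (-(m + 1)) 0, pt (-1) (-(m + 1)) (-1)), (pt (-1) (-(m + 1)) (-1), pt l (-(m + 1)) 0)} := by
    ext e
    simp only [Set.mem_union, Set.mem_insert_iff, Set.mem_singleton_iff]
    tauto
  have hP2 := h2.2.1
  rw [e2] at hP2 ⊢
  have h3 := replace_corner hP2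
    (by
      rintro (h | h)
      · linarith [hTy h]
      · simp [pt_inj] at h
        try linarith)
    (by
      rintro (h | h)
      · linarith [hTy h]
      · simp [pt_inj] at h
        try linarith)
    (by
      intro f hf z hz hzf
      obtain ⟨s, t, hs, ht, hst, rfl⟩ := triangle_coords hz
      rcases hf with hf | rfl | rfl | rfl
      · linarith [hTz f hf hzf]
      all_goals
        obtain ⟨r, hr0, hr1, hr⟩ := segment_coords hzf
        obtain ⟨hrx, hry, hrz⟩ := pt_inj.1 hr
      · linarith
      · left
        obtain rfl : r = 1 := by linarith
        rw [hr]
        convert left_mem_segment ℝ _ _ using 2 <;> ring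
      · right
        obtain rfl : r = 0 := by linarith
        rw [hr]
        convert right_mem_segment ℝ _ _ using 2 <;> ring)
  refine h3.trans ?_
  -- the corner below the end of the strand
  have e3 : T ∪ {(pt l (-m) 0, pt (l + 1 / 2) (-(m + 1 / 2)) 1), (pt (l + 1 / 2) (-(m + 1 / 2)) 1, pt (l + 1) (-(m + 1)) 0), (pt l (-(m + 1)) 0, pt (l + 1) (-m) 0)} ∪ {(pt (l + 1) (-(m + 1)) 0, pt l (-(m + 1)) 0)} =
      (T ∪ {(pt l (-m) 0, pt (l + 1 / 2) (-(m + 1 / 2)) 1), (pt (l + 1 / 2) (-(m + 1 / 2)) 1, pt (l + 1) (-(m + 1)) 0)}) ∪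
        {(pt (l + 1) (-(m + 1)) 0, pt l (-(m + 1)) 0), (pt l (-(m + 1)) 0, pt (l + 1) (-m) 0)} := by
    ext e
    simp only [Set.mem_union, Set.mem_insert_iff, Set.mem_singleton_iff]
    tauto
  have hP3 := h3.2.1
  rw [e3] at hP3 ⊢
  have h4 := replace_corner hP3
    (by
      rintro (h | h)
      · linarith [hTy h]
      · simp [pt_inj] at h
        try linarith)
    (by
      rintro (h | h)
      · linarith [hTy h]
      · simp [pt_inj] at h
        try linarith)
    (by
      intro f hf z hz hzf
      obtain ⟨s, t, hs, ht, hst, rfl⟩ := triangle_coords hz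
      rcases hf with hf | rfl | rfl
      · right
        have := hTz f hf hzf
        obtain rfl : s = 0 := by linarith
        obtain rfl : t = 1 := by linarith
        convert right_mem_segment ℝ _ _ using 2 <;> ring
      all_goals
        obtain ⟨r, hr0, hr1, hr⟩ := segment_coords hzf
        obtain ⟨hrx, hry, hrz⟩ := pt_inj.1 hr
      · linarith
      · left
        obtain rfl : r = 1 := by linarith
        rw [hr]
        convert left_mem_segment ℝ _ _ using 2 <;> ring)
  refine h4.trans ?_
  -- the corner at the end of the bridge
  have e4 : T ∪ {(pt l (-m) 0, pt (l + 1 / 2) (-(m + 1 / 2)) 1), (pt (l + 1 / 2) (-(m + 1 / 2)) 1, pt (l + 1) (-(m + 1)) 0)} ∪ {(pt (l + 1) (-(m + 1)) 0, pt (l + 1) (-m) 0)} =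
      (T ∪ {(pt l (-m) 0, pt (l + 1 / 2) (-(m + 1 / 2)) 1)}) ∪
        {(pt (l + 1 / 2) (-(m + 1 / 2)) 1, pt (l + 1) (-(m + 1)) 0), (pt (l + 1) (-(m + 1)) 0, pt (l + 1) (-m) 0)} := by
    ext e
    simp only [Set.mem_union, Set.mem_insert_iff, Set.mem_singleton_iff]
    tauto
  have hP4 := h4.2.1
  rw [e4] at hP4 ⊢
  have h5 := replace_corner hP4
    (by
      rintro (h | h)
      · linarith [hTy h]
      · simp [pt_inj] at h
        try linarith)
    (by
      rintro (h | h)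
      · linarith [hTy h]
      · simp [pt_inj] at h
        try linarith)
    (by
      intro f hf z hz hzf
      obtain ⟨s, t, hs, ht, hst, rfl⟩ := triangle_coords hz
      rcases hf with hf | rfl
      · right
        have := hTz f hf hzf
        obtain rfl : s = 0 := by linarith
        obtain rfl : t = 1 := by linarith
        convert right_mem_segment ℝ _ _ using 2 <;> ring
      all_goals
        obtain ⟨r, hr0, hr1, hr⟩ := segment_coords hzf
        obtain ⟨hrx, hry, hrz⟩ := pt_inj.1 hr
      · left
        obtain rfl : r = 1 := by linarith
        rw [hr]
        convert left_mem_segment ℝ _ _ using 2 <;> ring)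
  refine h5.trans ?_
  -- the bridge
  have e5 : T ∪ {(pt l (-m) 0, pt (l + 1 / 2) (-(m + 1 / 2)) 1)} ∪ {(pt (l + 1 / 2) (-(m + 1 / 2)) 1, pt (l + 1) (-m) 0)} = T ∪ {(pt l (-m) 0, pt (l + 1 / 2) (-(m + 1 / 2)) 1), (pt (l + 1 / 2) (-(m + 1 / 2)) 1, pt (l + 1) (-m) 0)} := by
    ext e
    simp only [Set.mem_union, Set.mem_insert_iff, Set.mem_singleton_iff]
    tauto
  have hP5 := h5.2.1
  rw [e5] at hP5 ⊢
  refine replace_corner hP5 (fun h => by linarith [hTy h]) (fun h => by linarith [hTy h]) ?_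
  intro f hf z hz hzf
  obtain ⟨s, t, hs, ht, hst, rfl⟩ := triangle_coords hz
  have := hTz f hf hzf
  obtain rfl : s = 0 := by linarith
  -- The last triangle has the final edge on its boundary. That the final link is embedded confines
  -- the remaining edges to the end points of that edge.
  have hmem := hF.inter f (Or.inl hf) _ (Or.inr rfl) (by rintro rfl; exact hPR hf)
    ⟨hzf, mem_segment_pt ht (by linarith) (by ring) (by ring) (by ring)⟩
  rcases hmem.2 with h | h
  · rw [h]
    exact Or.inl (left_mem_segment ℝ _ _)
  · rw [Set.mem_singleton_iff.1 h]
    exact Or.inr (right_mem_segment ℝ _ _)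

end Stabilization

section Words

variable {m n : ℕ}

/-- A letter, regarded as a letter on more strands. -/
def inclLetter (h : m ≤ n) (a : BraidGen m × Bool) : BraidGen n × Bool :=
  (⟨a.1.1, a.1.2.1, a.1.2.2.trans_le h⟩, a.2)

/-- The edges of the closure of a word which are not in the closing arcs. -/
def slabEdges (w : List (GLetter n)) : Set (Pt × Pt) :=
  {e | ∃ (j : ℕ) (hj : j < w.length), e ∈ gEdges n j w[j]}

theorem gClosed_append (w : List (GLetter n)) (a : GLetter n) : gClosed (w ++ [a]) =
    slabEdges w ∪ gEdges n w.length a ∪ closingEdges n (w.length + 1) := by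
  have hl : (w ++ [a]).length = w.length + 1 := by simp
  rw [← hl, gClosed]
  congr 1
  ext e
  constructor
  · rintro ⟨j, hj, he⟩
    rcases Nat.lt_or_ge j w.length with h | h
    · rw [List.getElem_append_left h] at he
      exact Or.inl ⟨j, h, he⟩
    · obtain rfl : j = w.length := by simp at hj; omega
      right
      simpa using he
  · rintro (⟨j, hj, he⟩ | he)
    · refine ⟨j, by simp; omega, ?_⟩
      rwa [List.getElem_append_left hj]
    · exact ⟨w.length, by simp, by simpa using he⟩

theorem exists_le_succ {P : ℕ → Prop} :
    (∃ k, 1 ≤ k ∧ k ≤ m + 1 ∧ P k) ↔ (∃ k, 1 ≤ k ∧ k ≤ m ∧ P k) ∨ P (m + 1) := by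
  constructor
  · rintro ⟨k, h1, h2, h3⟩
    rcases Nat.eq_or_lt_of_le h2 with rfl | h
    · exact Or.inr h3
    · exact Or.inl ⟨k, h1, by omega, h3⟩
  · rintro (⟨k, h1, h2, h3⟩ | h)
    · exact ⟨k, h1, by omega, h3⟩
    · exact ⟨m + 1, by omega, le_rfl, h⟩

theorem gEdges_succ (j : ℕ) (a : GLetter m) : gEdges (m + 1) j (a.map (inclLetter (Nat.le_succ m))) =
    gEdges m j a ∪ {(gridPt j (m + 1), gridPt (j + 1) (m + 1))} := by
  ext e
  rcases a with _ | ⟨⟨i, h1, h2⟩, b⟩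
  · simp only [gEdges, Option.map_none, Set.mem_union, Set.mem_ofPred_eq, Set.mem_singleton_iff]
    exact exists_le_succ
  · simp only [gEdges, Option.map_some, inclLetter, letterEdges, Set.mem_union, Set.mem_ofPred_eq,
      Set.mem_singleton_iff]
    rw [exists_le_succ (P := fun k => k ≠ i ∧ k ≠ i + 1 ∧ e = (gridPt j k, gridPt (j + 1) k))]
    have h3 : m + 1 ≠ i := by omega
    have h4 : m ≠ i := by omega
    simp only [ne_eq, h3, not_false_eq_true, add_left_inj, h4, true_and]
    rw [or_right_comm]

theorem closingEdges_succ (l : ℕ) : closingEdges (m + 1) l = closingEdges m l ∪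
    {(gridPt l (m + 1), pt (l + 1) (-(m + 1)) (-1)),
      (pt (l + 1) (-(m + 1)) (-1), pt (-1) (-(m + 1)) (-1)),
      (pt (-1) (-(m + 1)) (-1), gridPt 0 (m + 1))} := by
  ext e
  simp only [closingEdges, Set.mem_union, Set.mem_ofPred_eq, Set.mem_insert_iff,
    Set.mem_singleton_iff]
  rw [exists_le_succ]
  push_cast
  rfl

/-- The edges of the first strands after the `l`-th letter. -/
def straightEdges (m l : ℕ) : Set (Pt × Pt) :=
  {e | ∃ k, 1 ≤ k ∧ k ≤ m ∧ k ≠ m ∧ e = (gridPt l k, gridPt (l + 1) k)}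

/-- The closure of a word, without the edge of the last strand behind the word. -/
def openEdges (w : List (GLetter m)) : Set (Pt × Pt) :=
  slabEdges w ∪ straightEdges m w.length ∪ closingEdges m (w.length + 1)

theorem gEdges_none (hm : 1 ≤ m) (l : ℕ) : gEdges m l none =
    straightEdges m l ∪ {(pt l (-m) 0, pt (l + 1) (-m) 0)} := by
  ext e
  constructor
  · rintro ⟨k, h1, h2, rfl⟩
    by_cases hk : k = m
    · right
      subst hk
      simp [gridPt]
    · exact Or.inl ⟨k, h1, h2, hk, rfl⟩
  · rintro (⟨k, h1, h2, -, h⟩ | rfl)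
    · exact ⟨k, h1, h2, h⟩
    · exact ⟨m, hm, le_rfl, by simp [gridPt]⟩

theorem gEdges_sigma (hm : 1 ≤ m) (l : ℕ) :
    gEdges (m + 1) l (some (⟨m, hm, Nat.lt_succ_self m⟩, true)) = straightEdges m l ∪
      {(gridPt l m, bridgePt l m), (bridgePt l m, gridPt (l + 1) (m + 1)),
        (gridPt l (m + 1), gridPt (l + 1) m)} := by
  simp only [gEdges, letterEdges, if_true]
  congr 1
  ext e
  constructor
  · rintro ⟨k, a1, a2, a3, a4, a5⟩
    exact ⟨k, a1, by omega, a3, a5⟩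
  · rintro ⟨k, a1, a2, a3, a4⟩
    exact ⟨k, a1, by omega, a3, by omega, a4⟩

theorem slabEdges_map (w : List (GLetter m)) :
    slabEdges (w.map (Option.map (inclLetter (Nat.le_succ m)))) =
      slabEdges w ∪ lastStrand m 0 w.length := by
  ext e
  have hpt : ∀ j : ℕ, (gridPt j (m + 1), gridPt (j + 1) (m + 1)) =
      (pt j (-(m + 1)) 0, pt (j + 1) (-(m + 1)) 0) := fun j => by simp [gridPt]
  simp only [slabEdges, List.length_map, List.getElem_map, gEdges_succ, hpt]
  constructor
  · rintro ⟨j, hj, he | he⟩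
    · exact Or.inl ⟨j, hj, he⟩
    · exact Or.inr ⟨j, Nat.zero_le _, hj, he⟩
  · rintro (⟨j, hj, he⟩ | ⟨j, -, hj, he⟩)
    · exact ⟨j, hj, Or.inl he⟩
    · exact ⟨j, hj, Or.inr he⟩

theorem gClosed_append_none (hm : 1 ≤ m) (w : List (GLetter m)) : gClosed (w ++ [none]) =
    openEdges w ∪ {(pt w.length (-m) 0, pt (w.length + 1) (-m) 0)} := by
  rw [gClosed_append, gEdges_none hm, openEdges, ← Set.union_assoc, Set.union_right_comm]

theorem gClosed_append_sigma (hm : 1 ≤ m) (w : List (GLetter m)) :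
    gClosed (w.map (Option.map (inclLetter (Nat.le_succ m))) ++
      [some (⟨m, hm, Nat.lt_succ_self m⟩, true)]) =
    openEdges w ∪ lastStrand m 0 w.length ∪ stabEdges m w.length ∪
      {(pt (-1) (-(m + 1)) (-1), pt (0 : ℕ) (-(m + 1)) 0)} := by
  rw [gClosed_append, slabEdges_map, List.length_map, gEdges_sigma hm, closingEdges_succ, openEdges,
    stabEdges]
  have g0 : gridPt w.length m = pt w.length (-m) 0 := rfl
  have g1 : gridPt (w.length + 1) m = pt (w.length + 1) (-m) 0 := by simp [gridPt]
  have g2 : gridPt w.length (m + 1) = pt w.length (-(m + 1)) 0 := by simp [gridPt]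
  have g3 : gridPt (w.length + 1) (m + 1) = pt (w.length + 1) (-(m + 1)) 0 := by simp [gridPt]
  have g4 : gridPt 0 (m + 1) = pt (0 : ℕ) (-(m + 1)) 0 := by simp [gridPt]
  have g5 : bridgePt w.length m = pt (w.length + 1 / 2) (-(m + 1 / 2)) 1 := rfl
  have g6 : ((w.length + 1 : ℕ) : ℝ) + 1 = w.length + 2 := by push_cast; ring
  rw [g0, g1, g2, g3, g4, g5, g6]
  generalize ((pt w.length (-m) 0, pt (w.length + 1 / 2) (-(m + 1 / 2)) 1) : Pt × Pt) = a1
  generalize ((pt (w.length + 1 / 2) (-(m + 1 / 2)) 1, pt (w.length + 1) (-(m + 1)) 0) :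
    Pt × Pt) = a2
  generalize ((pt w.length (-(m + 1)) 0, pt (w.length + 1) (-m) 0) : Pt × Pt) = a3
  generalize ((pt (w.length + 1) (-(m + 1)) 0, pt (w.length + 2) (-(m + 1)) (-1)) : Pt × Pt) = a4
  generalize ((pt (w.length + 2) (-(m + 1)) (-1), pt (-1) (-(m + 1)) (-1)) : Pt × Pt) = a5
  generalize ((pt (-1) (-(m + 1)) (-1), pt (0 : ℕ) (-(m + 1)) 0) : Pt × Pt) = a6
  generalize slabEdges w = A
  generalize straightEdges m w.length = B
  generalize closingEdges m (w.length + 1) = C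
  ext e
  simp only [Set.mem_union, Set.mem_insert_iff, Set.mem_singleton_iff]
  tauto

theorem gridPt_snd_le (j : ℕ) {k : ℕ} (h : k ≤ m) : -(m : ℝ) ≤ gridPt j k 1 := by
  simpa [gridPt, pt] using h

theorem bridgePt_snd_le {j i : ℕ} (h : i < m) : -(m : ℝ) ≤ bridgePt j i 1 := by
  have : (i : ℝ) + 1 ≤ m := by exact_mod_cast h
  simp only [bridgePt, pt, Matrix.cons_val_one, Matrix.cons_val_zero]
  linarith

theorem gEdges_snd_le (j : ℕ) (a : GLetter m) {e : Pt × Pt} (he : e ∈ gEdges m j a) :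
    -(m : ℝ) ≤ e.1 1 ∧ -(m : ℝ) ≤ e.2 1 := by
  rcases a with _ | ⟨⟨i, h1, h2⟩, b⟩
  · obtain ⟨k, -, hk, rfl⟩ := he
    exact ⟨gridPt_snd_le j hk, gridPt_snd_le (j + 1) hk⟩
  · rcases he with ⟨k, -, hk, -, -, rfl⟩ | he
    · exact ⟨gridPt_snd_le j hk, gridPt_snd_le (j + 1) hk⟩
    · have hi := bridgePt_snd_le (j := j) h2
      have l1 : -(m : ℝ) ≤ -(i : ℝ) := gridPt_snd_le j h2.le
      have l2 : -(m : ℝ) ≤ -((i + 1 : ℕ) : ℝ) := gridPt_snd_le j h2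
      split_ifs at he
      · rcases he with rfl | rfl | rfl
        exacts [⟨l1, hi⟩, ⟨hi, l2⟩, ⟨l2, l1⟩]
      · rcases he with rfl | rfl | rfl
        exacts [⟨l1, l2⟩, ⟨l2, hi⟩, ⟨hi, l1⟩]

theorem gEdges_fst (j : ℕ) (a : GLetter m) {e : Pt × Pt} (he : e ∈ gEdges m j a) :
    e.1 0 ≤ j + 1 / 2 := by
  have l1 : (j : ℝ) ≤ j + 1 / 2 := by norm_num
  rcases a with _ | ⟨⟨i, h1, h2⟩, b⟩
  · obtain ⟨k, -, hk, rfl⟩ := he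
    exact l1
  · have l2 : bridgePt j i 0 ≤ (j + 1 / 2 : ℝ) := le_rfl
    rcases he with ⟨k, -, hk, -, -, rfl⟩ | he
    · exact l1
    · split_ifs at he
      · rcases he with rfl | rfl | rfl
        exacts [l1, l2, l1]
      · rcases he with rfl | rfl | rfl
        exacts [l1, l1, l2]

theorem openEdges_snd_le (w : List (GLetter m)) {e : Pt × Pt} (he : e ∈ openEdges w) {z : Pt}
    (hz : z ∈ segment ℝ e.1 e.2) : -(m : ℝ) ≤ z 1 := by
  have key : -(m : ℝ) ≤ e.1 1 ∧ -(m : ℝ) ≤ e.2 1 := by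
    rcases he with (⟨j, hj, he⟩ | ⟨k, -, hk, -, rfl⟩) | ⟨k, -, hk, he⟩
    · exact gEdges_snd_le j _ he
    · exact ⟨gridPt_snd_le w.length hk, gridPt_snd_le (w.length + 1) hk⟩
    · have hp : -(m : ℝ) ≤ -(k : ℝ) := gridPt_snd_le 0 hk
      rcases he with rfl | rfl | rfl
      exacts [⟨hp, hp⟩, ⟨hp, hp⟩, ⟨hp, hp⟩]
  obtain ⟨s, ⟨h0, h1⟩, rfl⟩ := mem_segment_iff_exists.1 hz
  simp only [Pi.add_apply, Pi.smul_apply, Pi.sub_apply, smul_eq_mul]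
  nlinarith [key.1, key.2]

/-- The edge starts at `x = w.length`, beyond the tails of all earlier slab edges, and its position
and height distinguish it from the rest. -/
theorem notMem_openEdges (w : List (GLetter m)) :
    (pt w.length (-m) 0, pt (w.length + 1) (-m) 0) ∉ openEdges w := by
  rintro ((⟨j, hj, he⟩ | ⟨k, -, -, hk, he⟩) | ⟨k, -, -, he⟩)
  · have h1 := gEdges_fst j _ he
    have h2 : (j : ℝ) + 1 ≤ w.length := by exact_mod_cast hj
    simp only [pt, Matrix.cons_val_zero] at h1
    linarith
  · have := (pt_inj.1 (Prod.ext_iff.1 he).1).2.1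
    exact hk (by exact_mod_cast (neg_inj.1 this).symm)
  · rcases he with he | he | he
    · have := (pt_inj.1 (Prod.ext_iff.1 he).1).1
      push_cast at this
      linarith
    · have := (pt_inj.1 (Prod.ext_iff.1 he).1).2.2
      linarith
    · have := (pt_inj.1 (Prod.ext_iff.1 he).1).2.2
      linarith

/-- Stabilization does not change the closure. -/
theorem isotopic_stab (hm : 1 ≤ m) (w : List (GLetter m)) :
    PolyIsotopic (wordLink (w.map (Option.map (inclLetter (Nat.le_succ m))) ++
      [some (⟨m, hm, Nat.lt_succ_self m⟩, true)])) (wordLink w) := by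
  have h1 := isotopic_gClosed (w.map (Option.map (inclLetter (Nat.le_succ m))) ++
      [some (⟨m, hm, Nat.lt_succ_self m⟩, true)])
  -- A trivial letter at the end of `w` supplies the straight edge that remains when the stabilizing
  -- crossing is undone.
  have h2 := isotopic_gClosed (w ++ [none])
  have h3 := isotopic_none w []
  rw [List.append_nil] at h3
  rw [gClosed_append_none hm] at h2
  rw [gClosed_append_sigma hm] at h1
  exact h1.symm.trans ((isotopic_stabilization (fun e he z hz => openEdges_snd_le w he hz) h1.1 h2.1
    (notMem_openEdges w)).trans (h2.trans h3))

end Words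

/-! ### From words to braids -/

section Braids

variable {m n : ℕ}

/-- Reflexivity includes being a polygonal link; the passage through `gClosed` supplies this for the
empty word too. -/
theorem isotopic_refl_wordLink (w : List (GLetter n)) : PolyIsotopic (wordLink w) (wordLink w) :=
  (isotopic_gClosed w).symm.trans (isotopic_gClosed w)

/-- Two words are equivalent if they may replace each other in any word, without changing the
closure. -/
def closureCon (n : ℕ) : Con (FreeMonoid (BraidGen n × Bool)) where
  r w w' := ∀ u v : List (GLetter n), PolyIsotopic (wordLink (u ++ (w.toList.map some ++ v)))
    (wordLink (u ++ (w'.toList.map some ++ v)))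
  iseqv := ⟨fun _ _ _ => isotopic_refl_wordLink _, fun h u v => (h u v).symm,
    fun h h' u v => (h u v).trans (h' u v)⟩
  mul' {w x y z} h h' u v := by
    have h1 := h u (y.toList.map some ++ v)
    have h2 := h' (u ++ x.toList.map some) v
    simp only [FreeMonoid.toList_mul, List.map_append, List.append_assoc] at h1 h2 ⊢
    exact h1.trans h2

/-- The class of a word. -/
def wordClass (w : BraidWord n) : (closureCon n).Quotient := (closureCon n).mk' (FreeMonoid.ofList w)

theorem wordClass_append (w w' : BraidWord n) : wordClass (w ++ w') = wordClass w * wordClass w' := by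
  rw [wordClass, wordClass, wordClass, FreeMonoid.ofList_append, map_mul]

theorem wordClass_nil : wordClass ([] : BraidWord n) = 1 := by
  rw [wordClass, FreeMonoid.ofList_nil, map_one]

theorem wordClass_eq {w w' : BraidWord n} : wordClass w = wordClass w' ↔
    ∀ u v : List (GLetter n), PolyIsotopic (wordLink (u ++ (w.map some ++ v)))
      (wordLink (u ++ (w'.map some ++ v))) :=
  Con.eq (closureCon n)

theorem wordClass_cancel (a : BraidGen n × Bool) : wordClass [a, invLetter a] = 1 := by
  rw [← wordClass_nil, wordClass_eq]
  exact fun u v => isotopic_cancel u v a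

/-- The class of a generator, which is invertible. -/
def genClass (i : BraidGen n) : (closureCon n).Quotientˣ where
  val := wordClass [(i, true)]
  inv := wordClass [(i, false)]
  val_inv := by rw [← wordClass_append]; exact wordClass_cancel (i, true)
  inv_val := by rw [← wordClass_append]; exact wordClass_cancel (i, false)

/-- Cancellation makes the generators units of the quotient monoid, and the two local moves are the
Artin relations. So the braid group maps to these units, and the class of a word depends on its
braid only. -/
theorem genClass_rels : ∀ r ∈ artinRels n, FreeGroup.lift genClass r = 1 := by
  rintro r (⟨i, j, hij, rfl⟩ | ⟨i, j, hij, rfl⟩)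
  · simp only [map_mul, map_inv, FreeGroup.lift_apply_of, mul_inv_eq_one]
    ext
    simp only [genClass, Units.val_mul, ← wordClass_append]
    rw [wordClass_eq]
    exact fun u v => isotopic_braid u v hij
  · simp only [map_mul, map_inv, FreeGroup.lift_apply_of, mul_inv_eq_one]
    ext
    simp only [genClass, Units.val_mul, ← wordClass_append]
    rw [wordClass_eq]
    exact fun u v => isotopic_commute u v hij

/-- The class of the words that represent a braid. -/
def braidClass (n : ℕ) : BraidGroup n →* (closureCon n).Quotientˣ :=
  PresentedGroup.toGroup genClass_rels

theorem toBraid_append (w w' : BraidWord n) :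
    BraidWord.toBraid (w ++ w') = w.toBraid * BraidWord.toBraid w' := by
  rw [BraidWord.toBraid, BraidWord.toBraid, BraidWord.toBraid, ← map_mul, FreeGroup.mul_mk]

theorem toBraid_nil : BraidWord.toBraid ([] : BraidWord n) = 1 :=
  map_one (PresentedGroup.mk (artinRels n))

theorem toBraid_true (i : BraidGen n) : BraidWord.toBraid [(i, true)] = PresentedGroup.of i := rfl

theorem toBraid_cancel (a : BraidGen n × Bool) :
    BraidWord.toBraid [a] * BraidWord.toBraid [invLetter a] = 1 := by
  rw [← toBraid_append, ← toBraid_nil, BraidWord.toBraid, BraidWord.toBraid]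
  congr 1
  exact Quot.sound (FreeGroup.Red.Step.not (L₁ := []) (L₂ := []))

theorem toBraid_false (i : BraidGen n) :
    BraidWord.toBraid [(i, false)] = (PresentedGroup.of i)⁻¹ :=
  (inv_eq_of_mul_eq_one_right (toBraid_cancel (i, true))).symm

theorem braidClass_toBraid (w : BraidWord n) :
    (braidClass n w.toBraid : (closureCon n).Quotient) = wordClass w := by
  induction w with
  | nil => rw [toBraid_nil, map_one, wordClass_nil]; rfl
  | cons a w ih =>
    rw [← List.singleton_append, toBraid_append, map_mul, Units.val_mul, ih, wordClass_append]
    congr 1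
    rcases a with ⟨i, _ | _⟩
    · rw [toBraid_false, map_inv, braidClass, PresentedGroup.toGroup.of]
      rfl
    · rw [toBraid_true, braidClass, PresentedGroup.toGroup.of]
      rfl

theorem isotopic_of_toBraid_eq {w w' : BraidWord n} (h : w.toBraid = w'.toBraid) :
    PolyIsotopic (wordLink (w.map some)) (wordLink (w'.map some)) := by
  have h1 : wordClass w = wordClass w' := by
    rw [← braidClass_toBraid, ← braidClass_toBraid, h]
  simpa using wordClass_eq.1 h1 [] []

theorem exists_word (β : BraidGroup n) : ∃ w : BraidWord n, w.toBraid = β := by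
  obtain ⟨g, rfl⟩ := PresentedGroup.mk_surjective (artinRels n) β
  exact ⟨g.toWord, by rw [BraidWord.toBraid, FreeGroup.mk_toWord]⟩

theorem isotopic_closedBraid (w : BraidWord n) :
    PolyIsotopic (closedBraid w) (wordLink (w.map some)) := by
  rw [closedBraid_eq_gClosed]
  exact isotopic_gClosed _

theorem sameClosure_toBraid {w : BraidWord m} {w' : BraidWord n}
    (h : PolyIsotopic (wordLink (w.map some)) (wordLink (w'.map some))) :
    SameClosure w.toBraid w'.toBraid := fun v v' hv hv' =>
  (isotopic_closedBraid v).trans ((isotopic_of_toBraid_eq hv).trans (h.trans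
    ((isotopic_of_toBraid_eq hv').symm.trans (isotopic_closedBraid v').symm)))

theorem SameClosure.refl (β : BraidGroup n) : SameClosure β β := by
  obtain ⟨w, rfl⟩ := exists_word β
  exact sameClosure_toBraid (isotopic_refl_wordLink _)

theorem SameClosure.symm {β : BraidGroup m} {β' : BraidGroup n} (h : SameClosure β β') :
    SameClosure β' β := fun w w' hw hw' => (h w' w hw' hw).symm

theorem SameClosure.trans {l : ℕ} {β : BraidGroup l} {β' : BraidGroup m} {β'' : BraidGroup n}
    (h : SameClosure β β') (h' : SameClosure β' β'') : SameClosure β β'' := fun w w'' hw hw'' => by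
  -- Since `SameClosure` quantifies over all words, transitivity needs a word for the middle braid.
  obtain ⟨w', hw'⟩ := exists_word β'
  exact (h w w' hw hw').trans (h' w' w'' hw' hw'')

theorem sameClosure_conj (γ β : BraidGroup n) : SameClosure (γ * β * γ⁻¹) β := by
  obtain ⟨u, rfl⟩ := exists_word γ
  obtain ⟨w, rfl⟩ := exists_word β
  -- The innermost letter of the conjugating word is absorbed into the conjugated braid.
  induction u using List.reverseRecOn generalizing w with
  | nil => simpa [toBraid_nil] using SameClosure.refl _
  | append_singleton u a ih =>
    have h1 := ih (a :: (w ++ [invLetter a]))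
    have h2 : SameClosure (BraidWord.toBraid (a :: (w ++ [invLetter a]))) w.toBraid :=
      sameClosure_toBraid (by simpa using isotopic_conj_letter a (w.map some))
    have h3 : (BraidWord.toBraid [a])⁻¹ = BraidWord.toBraid [invLetter a] :=
      inv_eq_of_mul_eq_one_right (toBraid_cancel a)
    have h4 : BraidWord.toBraid (a :: (w ++ [invLetter a])) =
        BraidWord.toBraid [a] * (w.toBraid * BraidWord.toBraid [invLetter a]) := by
      rw [← toBraid_append, ← toBraid_append]
      rfl
    have h5 : BraidWord.toBraid (u ++ [a]) * w.toBraid * (BraidWord.toBraid (u ++ [a]))⁻¹ =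
        BraidWord.toBraid u * BraidWord.toBraid (a :: (w ++ [invLetter a])) *
          (BraidWord.toBraid u)⁻¹ := by
      rw [h4, toBraid_append, mul_inv_rev, h3]
      group
    rw [h5]
    exact h1.trans h2

theorem sameClosure_mul_comm (α β : BraidGroup n) : SameClosure (α * β) (β * α) := by
  have := sameClosure_conj α (β * α)
  rwa [show α * (β * α) * α⁻¹ = α * β by group] at this

theorem toBraid_incl (h : m ≤ n) (w : BraidWord m) :
    BraidWord.toBraid (w.map (inclLetter h)) = braidIncl h w.toBraid := by
  induction w with
  | nil => rw [toBraid_nil, map_one]; exact toBraid_nil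
  | cons a w ih =>
    rw [List.map_cons, ← List.singleton_append, toBraid_append, ih, ← List.singleton_append (x := a),
      toBraid_append, map_mul]
    congr 1
    rcases a with ⟨i, _ | _⟩
    · rw [toBraid_false, map_inv, braidIncl, PresentedGroup.toGroup.of]
      exact toBraid_false _
    · rw [toBraid_true, braidIncl, PresentedGroup.toGroup.of]
      rfl

theorem sameClosure_stab (hm : 1 ≤ m) (β : BraidGroup m) :
    SameClosure (braidIncl (Nat.le_succ m) β * sigma (m + 1) m) β := by
  obtain ⟨w, rfl⟩ := exists_word β
  have hs : sigma (m + 1) m = BraidWord.toBraid [(⟨m, hm, Nat.lt_succ_self m⟩, true)] := by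
    rw [sigma, dif_pos ⟨hm, Nat.lt_succ_self m⟩, toBraid_true]
  rw [← toBraid_incl, hs, ← toBraid_append]
  refine sameClosure_toBraid ?_
  have := isotopic_stab hm (w.map some)
  simpa [Function.comp_def] using this

end Braids

/-! ### Identities in braid groups -/

section Identities

variable {n : ℕ}

theorem sigma_of_not {i : ℕ} (h : ¬(1 ≤ i ∧ i < n)) : sigma n i = 1 := dif_neg h

/-- No range conditions are required, since `sigma` is `1` outside the range. -/
theorem sigma_commute {i j : ℕ} (h : i + 2 ≤ j) : Commute (sigma n i) (sigma n j) := by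
  by_cases hi : 1 ≤ i ∧ i < n
  · by_cases hj : 1 ≤ j ∧ j < n
    · have key := PresentedGroup.one_of_mem (rels := artinRels n) (Or.inr ⟨⟨i, hi⟩, ⟨j, hj⟩, h, rfl⟩)
      rw [map_mul, map_inv, mul_inv_eq_one, map_mul, map_mul] at key
      rw [sigma, sigma, dif_pos hi, dif_pos hj]
      exact key
    · rw [sigma_of_not hj]
      exact Commute.one_right _
  · rw [sigma_of_not hi]
    exact Commute.one_left _

theorem sigma_braid {i : ℕ} (h1 : 1 ≤ i) (h2 : i + 1 < n) :
    sigma n i * sigma n (i + 1) * sigma n i = sigma n (i + 1) * sigma n i * sigma n (i + 1) := by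
  have hi : 1 ≤ i ∧ i < n := ⟨h1, by omega⟩
  have hj : 1 ≤ i + 1 ∧ i + 1 < n := ⟨by omega, h2⟩
  have key := PresentedGroup.one_of_mem (rels := artinRels n)
    (Or.inl ⟨⟨i, hi⟩, ⟨i + 1, hj⟩, rfl, rfl⟩)
  rw [map_mul, map_inv, mul_inv_eq_one] at key
  simp only [map_mul] at key
  rw [sigma, sigma, dif_pos hi, dif_pos hj]
  exact key

theorem bracket_one_one : bracket n 1 1 = 1 := by simp [bracket]

theorem bracket_one_succ {k : ℕ} (hk : 1 ≤ k) :
    bracket n 1 (k + 1) = bracket n 1 k * sigma n k := by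
  obtain ⟨k, rfl⟩ := Nat.exists_eq_add_of_le' hk
  simp [bracket, List.range'_concat, add_comm 1 k]

theorem bracket_succ_one {k : ℕ} (hk : 1 ≤ k) :
    bracket n (k + 1) 1 = sigma n k * bracket n k 1 := by
  obtain ⟨k, rfl⟩ := Nat.exists_eq_add_of_le' hk
  rcases k with _ | k
  · simp [bracket]
  · simp [bracket, List.range'_concat, add_comm 1]

/-- The anti-automorphism of the braid group that fixes the generators, as a homomorphism to the
opposite group. -/
def braidRev (n : ℕ) : BraidGroup n →* (BraidGroup n)ᵐᵒᵖ :=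
  PresentedGroup.toGroup (f := fun i => MulOpposite.op (PresentedGroup.of i)) (by
    rintro r (⟨i, j, hij, rfl⟩ | ⟨i, j, hij, rfl⟩)
    · simp only [map_mul, map_inv, FreeGroup.lift_apply_of, mul_inv_eq_one, ← MulOpposite.op_mul]
      have key := PresentedGroup.one_of_mem (rels := artinRels n) (Or.inl ⟨i, j, hij, rfl⟩)
      rw [map_mul, map_inv, mul_inv_eq_one] at key
      simp only [map_mul] at key
      rw [← mul_assoc, ← mul_assoc]
      exact congrArg MulOpposite.op key
    · simp only [map_mul, map_inv, FreeGroup.lift_apply_of, mul_inv_eq_one, ← MulOpposite.op_mul]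
      have key := PresentedGroup.one_of_mem (rels := artinRels n) (Or.inr ⟨i, j, hij, rfl⟩)
      rw [map_mul, map_inv, mul_inv_eq_one] at key
      simp only [map_mul] at key
      exact congrArg MulOpposite.op key.symm)

theorem braidRev_sigma (i : ℕ) : braidRev n (sigma n i) = MulOpposite.op (sigma n i) := by
  by_cases h : 1 ≤ i ∧ i < n
  · rw [sigma, dif_pos h, braidRev, PresentedGroup.toGroup.of]
  · rw [sigma_of_not h, map_one, MulOpposite.op_one]

theorem braidRev_bracket {k : ℕ} (hk : 1 ≤ k) :
    braidRev n (bracket n 1 k) = MulOpposite.op (bracket n k 1) := by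
  induction k, hk using Nat.le_induction with
  | base => simp [bracket_one_one]
  | succ k hk ih =>
    rw [bracket_one_succ hk, bracket_succ_one hk, map_mul, ih, braidRev_sigma, MulOpposite.op_mul]

theorem braidRev_bracket' {k : ℕ} (hk : 1 ≤ k) :
    braidRev n (bracket n k 1) = MulOpposite.op (bracket n 1 k) := by
  induction k, hk using Nat.le_induction with
  | base => simp [bracket_one_one]
  | succ k hk ih =>
    rw [bracket_one_succ hk, bracket_succ_one hk, map_mul, ih, braidRev_sigma, MulOpposite.op_mul]

theorem bracket_commute_sigma {k j : ℕ} (hk : 1 ≤ k) (hj : k < j) :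
    Commute (bracket n 1 k) (sigma n j) := by
  induction k, hk using Nat.le_induction with
  | base => rw [bracket_one_one]; exact Commute.one_left _
  | succ k hk ih =>
    rw [bracket_one_succ hk]
    exact (ih (by omega)).mul_left (sigma_commute (by omega))

/-- Conjugation by `[1,k]` shifts the generators. -/
theorem bracket_semiconj {k i : ℕ} (hi : 1 ≤ i) (hik : i + 1 < k) (hk : k ≤ n) :
    SemiconjBy (bracket n 1 k) (sigma n i) (sigma n (i + 1)) := by
  induction k, (show i + 2 ≤ k from hik) using Nat.le_induction with
  | base =>
    have h1 := sigma_braid hi (show i + 1 < n by omega)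
    have h2 := (bracket_commute_sigma (n := n) hi (Nat.lt_succ_self i)).eq
    rw [SemiconjBy, bracket_one_succ (by omega), bracket_one_succ hi]
    rw [mul_assoc, mul_assoc, ← mul_assoc (sigma n i), h1]
    simp only [← mul_assoc]
    rw [h2]
  | succ k hk' ih =>
    rw [bracket_one_succ (by omega)]
    exact (ih (by omega) (by omega)).mul_left (sigma_commute (by omega)).symm

/-- The shift turns `[1,k] [1,j]` into `σ_2 ⋯ σ_j [1,k]`; the missing first generator is supplied on
the left. -/
theorem bracket_mul_bracket {k j : ℕ} (hj : 1 ≤ j) (hjk : j < k) (hk : k ≤ n) :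
    sigma n 1 * (bracket n 1 k * bracket n 1 j) = bracket n 1 (j + 1) * bracket n 1 k := by
  induction j, hj using Nat.le_induction with
  | base => simp [bracket_one_one, bracket_one_succ]
  | succ j hj ih =>
    rw [bracket_one_succ hj, ← mul_assoc (bracket n 1 k), ← mul_assoc, ih (by omega), mul_assoc,
      (bracket_semiconj hj hjk hk).eq, ← mul_assoc, ← bracket_one_succ (by omega)]

theorem bracket_mul_self {k : ℕ} (hk2 : 2 ≤ k) (hk : k ≤ n) :
    sigma n 1 * (bracket n 1 k * bracket n 1 (k - 1)) = bracket n 1 k * bracket n 1 k := by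
  have := bracket_mul_bracket (n := n) (k := k) (j := k - 1) (by omega) (by omega) hk
  rwa [Nat.sub_add_cancel (by omega)] at this

/-- The same shift applied to `[j,1]` gives `σ_j ⋯ σ_2`, that is, `[j+1,1]` without its last
generator. -/
theorem bracket_mul_bracket' {k j : ℕ} (hj : 1 ≤ j) (hjk : j < k) (hk : k ≤ n) :
    bracket n 1 k * bracket n j 1 = bracket n (j + 1) 1 * (sigma n 1)⁻¹ * bracket n 1 k := by
  induction j, hj using Nat.le_induction with
  | base => simp [bracket_one_one, bracket_succ_one]
  | succ j hj ih =>
    rw [bracket_succ_one hj, ← mul_assoc, (bracket_semiconj hj hjk hk).eq, mul_assoc,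
      ih (by omega), bracket_succ_one (by omega : 1 ≤ j + 1)]
    simp only [mul_assoc]

theorem bracket_pow {k d : ℕ} (hk2 : 2 ≤ k) (hk : k ≤ n) (hd : 1 ≤ d) (hdk : d ≤ k) :
    bracket n 1 k ^ d = bracket n d 1 * bracket n 1 k * bracket n 1 (k - 1) ^ (d - 1) := by
  induction d, hd using Nat.le_induction with
  | base => simp [bracket_one_one]
  | succ d hd ih =>
    obtain ⟨d, rfl⟩ := Nat.exists_eq_add_of_le' hd
    have h1 := bracket_mul_bracket' hd hdk hk
    have h2 := bracket_mul_self hk2 hk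
    -- The new factor `[1,k]` passes `[d,1]` and leaves `σ_1⁻¹`, which `[1,k]^2 = σ_1 [1,k] [1,k-1]`
    -- absorbs.
    rw [pow_succ', ih (by omega), ← mul_assoc, ← mul_assoc, h1, mul_assoc _ _ (bracket n 1 k), ← h2,
      Nat.add_sub_cancel, Nat.add_sub_cancel, pow_succ']
    group

/-- The mirror of `bracket_pow` under reversal of words. -/
theorem bracket_pow' {k d : ℕ} (hk2 : 2 ≤ k) (hk : k ≤ n) (hd : 1 ≤ d) (hdk : d ≤ k) :
    bracket n k 1 ^ d = bracket n (k - 1) 1 ^ (d - 1) * bracket n k 1 * bracket n 1 d := by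
  have := congrArg (fun g => (braidRev n g).unop) (bracket_pow hk2 hk hd hdk)
  simp only [map_mul, map_pow, braidRev_bracket' hd,
    braidRev_bracket (show 1 ≤ k by omega), braidRev_bracket (show 1 ≤ k - 1 by omega),
    MulOpposite.unop_mul, MulOpposite.unop_pow, MulOpposite.unop_op] at this
  rw [this, mul_assoc]

theorem bracket_semiconj' {k i : ℕ} (hi : 1 ≤ i) (hik : i + 1 < k) (hk : k ≤ n) :
    SemiconjBy (bracket n k 1) (sigma n (i + 1)) (sigma n i) := by
  have := congrArg (fun g => (braidRev n g).unop) (bracket_semiconj hi hik hk).eq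
  simp only [map_mul, braidRev_sigma, braidRev_bracket (show 1 ≤ k by omega),
    MulOpposite.unop_mul, MulOpposite.unop_op] at this
  exact this.symm

/-- Both sides are the full twist on `k` strands. In the induction step each is the full twist on
`k` strands times `[k+1,1] [1,k+1]`, in opposite orders; the latter braid takes the last strand once
around the others and commutes with their braiding. -/
theorem bracket_pow_self {k : ℕ} (hk1 : 1 ≤ k) (hk : k ≤ n) :
    bracket n 1 k ^ k = bracket n k 1 ^ k := by
  induction k, hk1 using Nat.le_induction with
  | base => rfl
  | succ k hk1 ih =>
    rw [bracket_pow (by omega) hk (by omega) le_rfl, bracket_pow' (by omega) hk (by omega) le_rfl,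
      Nat.add_sub_cancel, ih (by omega), mul_assoc _ (bracket n (k + 1) 1)]
    -- The factor `[1,k+1]` shifts `σ_i` up and `[k+1,1]` shifts it down again.
    have key : ∀ i, 1 ≤ i → i < k → Commute (bracket n (k + 1) 1 * bracket n 1 (k + 1)) (sigma n i) :=
      fun i h1 h2 => (bracket_semiconj' h1 (by omega) hk).mul_left
        (bracket_semiconj h1 (by omega) hk)
    have h : ∀ j, 1 ≤ j → j ≤ k →
        Commute (bracket n (k + 1) 1 * bracket n 1 (k + 1)) (bracket n j 1) := by
      intro j hj
      induction j, hj using Nat.le_induction with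
      | base => intro; rw [bracket_one_one]; exact Commute.one_right _
      | succ j hj ih' =>
        intro hjk
        rw [bracket_succ_one hj]
        exact (key j hj (by omega)).mul_right (ih' (by omega))
    exact ((h k hk1 le_rfl).pow_right k).eq

/-! ### The half twist and conjugation of `[n,1]` to `[1,n]`. -/

/-- The half twist of the first `k` strands. -/
def halfTwist (n : ℕ) : ℕ → BraidGroup n
  | 0 => 1
  | k + 1 => bracket n 1 (k + 1) * halfTwist n k

theorem halfTwist_commute {k j : ℕ} (hj : k < j) : Commute (halfTwist n k) (sigma n j) := by
  induction k with
  | zero => exact Commute.one_left _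
  | succ k ih => exact (bracket_commute_sigma (by omega) hj).mul_left (ih (by omega))

/-- Conjugation by the half twist reverses the order of the generators. -/
theorem halfTwist_semiconj {k i : ℕ} (hi : 1 ≤ i) (hik : i < k) (hk : k ≤ n) :
    SemiconjBy (halfTwist n k) (sigma n i) (sigma n (k - i)) := by
  induction k with
  | zero => omega
  | succ k ih =>
    rcases Nat.lt_or_ge i k with h | h
    · have h1 := bracket_semiconj (n := n) (k := k + 1) (i := k - i) (by omega) (by omega) hk
      rw [show k - i + 1 = k + 1 - i by omega] at h1
      exact h1.mul_left (ih h (by omega))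
    · obtain rfl : i = k := by omega
      obtain ⟨i, rfl⟩ := Nat.exists_eq_add_of_le' hi
      have h1 := bracket_mul_self (n := n) (k := i + 1 + 1) (by omega) hk
      have h2 := (halfTwist_commute (n := n) (Nat.lt_succ_self i)).eq
      rw [show i + 1 + 1 - (i + 1) = 1 by omega]
      simp only [SemiconjBy, halfTwist, Nat.add_sub_cancel] at h1 ⊢
      rw [mul_assoc, mul_assoc, h2, ← mul_assoc (bracket n 1 (i + 1)), ← bracket_one_succ hi,
        ← mul_assoc, ← h1]
      simp only [mul_assoc]

/-- The generators of `[j,1]` cross the half twist one at a time, with reversed indices, and extend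
`[1,i]` on the left. The case `i = 1` says that the half twist conjugates `[k,1]` to `[1,k]`. -/
theorem halfTwist_bracket {k j i : ℕ} (hj : 1 ≤ j) (hi : 1 ≤ i) (hij : i + j = k + 1) (hk : k ≤ n) :
    bracket n 1 i * (halfTwist n k * bracket n j 1) = bracket n 1 k * halfTwist n k := by
  induction j, hj using Nat.le_induction generalizing i with
  | base =>
    obtain rfl : i = k := by omega
    rw [bracket_one_one, mul_one]
  | succ j hj ih =>
    rw [bracket_succ_one hj, ← mul_assoc (halfTwist n k),
      (halfTwist_semiconj hj (by omega) hk).eq, mul_assoc, ← mul_assoc,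
      show k - j = i by omega, ← bracket_one_succ hi, ih (by omega) (by omega)]

/-- There is a braid which commutes with the first generator and conjugates `[n,1]` to `[1,n]`. -/
theorem exists_semiconj (hn : 2 ≤ n) : ∃ g : BraidGroup n,
    SemiconjBy g (sigma n 1) (sigma n 1) ∧ SemiconjBy g (bracket n n 1) (bracket n 1 n) := by
  have h1 : SemiconjBy (halfTwist n n) (bracket n n 1) (bracket n 1 n) := by
    have := halfTwist_bracket (n := n) (k := n) (j := n) (i := 1) (by omega) le_rfl (by omega) le_rfl
    rwa [bracket_one_one, one_mul] at this
  have h2 := halfTwist_semiconj (n := n) (k := n) (i := 1) le_rfl (by omega) le_rfl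
  have h3 : ∀ j, j + 2 ≤ n → SemiconjBy (bracket n 1 n ^ j) (sigma n 1) (sigma n (j + 1)) := by
    intro j
    induction j with
    | zero => simp
    | succ j ih =>
      intro hj
      rw [pow_succ']
      exact (bracket_semiconj (by omega) (by omega) le_rfl).mul_left (ih (by omega))
  have h4 := h3 (n - 2) (by omega)
  rw [show n - 2 + 1 = n - 1 by omega] at h4
  -- The half twist carries `σ_1` to `σ_{n-1}`, and the inverse power of `[1,n]` shifts it back.
  -- That power commutes with `[1,n]`, so the conjugation of the brackets is not disturbed.
  refine ⟨(bracket n 1 n ^ (n - 2))⁻¹ * halfTwist n n, h4.inv_symm_left.mul_left h2,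
    SemiconjBy.mul_left ?_ h1⟩
  exact (((Commute.refl (bracket n 1 n)).pow_left (n - 2))).inv_left

end Identities

/-! ### Closures of products of brackets -/

section Reduction

variable {m n : ℕ}

theorem braidIncl_sigma (h : m ≤ n) {i : ℕ} (hi : i < m) :
    braidIncl h (sigma m i) = sigma n i := by
  by_cases h1 : 1 ≤ i
  · rw [sigma, sigma, dif_pos ⟨h1, hi⟩, dif_pos ⟨h1, hi.trans_le h⟩, braidIncl,
      PresentedGroup.toGroup.of]
    rfl
  · rw [sigma_of_not (fun h => h1 h.1), sigma_of_not (fun h => h1 h.1), map_one]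

theorem braidIncl_bracket (h : m ≤ n) {k : ℕ} (hk1 : 1 ≤ k) (hk : k ≤ m) :
    braidIncl h (bracket m 1 k) = bracket n 1 k := by
  induction k, hk1 using Nat.le_induction with
  | base => rw [bracket_one_one, bracket_one_one, map_one]
  | succ k hk1 ih =>
    rw [bracket_one_succ hk1, bracket_one_succ hk1, map_mul, ih (by omega), braidIncl_sigma h hk]

theorem braidIncl_bracket' (h : m ≤ n) {k : ℕ} (hk1 : 1 ≤ k) (hk : k ≤ m) :
    braidIncl h (bracket m k 1) = bracket n k 1 := by
  induction k, hk1 using Nat.le_induction with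
  | base => rw [bracket_one_one, bracket_one_one, map_one]
  | succ k hk1 ih =>
    rw [bracket_succ_one hk1, bracket_succ_one hk1, map_mul, ih (by omega), braidIncl_sigma h hk]

theorem braidIncl_self (h : m ≤ m) (γ : BraidGroup m) : braidIncl h γ = γ := by
  have : braidIncl h = MonoidHom.id _ := PresentedGroup.ext fun i => by
    rw [braidIncl, PresentedGroup.toGroup.of]
    rfl
  rw [this]
  rfl

theorem braidIncl_braidIncl {l : ℕ} (h : l ≤ m) (h' : m ≤ n) (γ : BraidGroup l) :
    braidIncl h' (braidIncl h γ) = braidIncl (h.trans h') γ := by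
  have : (braidIncl h').comp (braidIncl h) = braidIncl (h.trans h') := PresentedGroup.ext fun i => by
    rw [MonoidHom.comp_apply, braidIncl, braidIncl, PresentedGroup.toGroup.of, braidInclGen,
      PresentedGroup.toGroup.of, braidIncl, PresentedGroup.toGroup.of]
    rfl
  exact DFunLike.congr_fun this γ

/-- By `bracket_pow` the power is `[ρ,1] [1,m] σ_m [1,m]^{ρ-1}`. The only letter involving the last
strand is `σ_m`, so a cyclic permutation puts it at the end and destabilization removes it. -/
theorem sameClosure_bracket_succ {ρ : ℕ} (h1 : 1 ≤ ρ) (h2 : ρ ≤ m) (γ : BraidGroup m) :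
    SameClosure (braidIncl (Nat.le_succ m) γ * bracket (m + 1) 1 (m + 1) ^ ρ)
      (γ * bracket m ρ 1 * bracket m 1 m ^ ρ) := by
  have hm : 1 ≤ m := h1.trans h2
  have e1 : braidIncl (Nat.le_succ m) γ * bracket (m + 1) 1 (m + 1) ^ ρ =
      braidIncl (Nat.le_succ m) (γ * bracket m ρ 1 * bracket m 1 m) *
        (sigma (m + 1) m * braidIncl (Nat.le_succ m) (bracket m 1 m ^ (ρ - 1))) := by
    rw [bracket_pow (by omega) le_rfl h1 (by omega), bracket_one_succ hm, Nat.add_sub_cancel]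
    simp only [map_mul, map_pow, braidIncl_bracket _ hm le_rfl, braidIncl_bracket' _ h1 h2, mul_assoc]
  have e2 : γ * bracket m ρ 1 * bracket m 1 m ^ ρ =
      γ * bracket m ρ 1 * bracket m 1 m * bracket m 1 m ^ (ρ - 1) := by
    rw [mul_assoc _ (bracket m 1 m), ← pow_succ', Nat.sub_add_cancel h1]
  rw [e1, e2, ← mul_assoc]
  refine (sameClosure_mul_comm _ _).trans ?_
  rw [← mul_assoc, ← map_mul]
  exact (sameClosure_stab hm _).trans (sameClosure_mul_comm _ _)

theorem sameClosure_bracket_succ' {ρ : ℕ} (h1 : 1 ≤ ρ) (h2 : ρ ≤ m) (γ : BraidGroup m) :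
    SameClosure (braidIncl (Nat.le_succ m) γ * bracket (m + 1) (m + 1) 1 ^ ρ)
      (bracket m 1 ρ * γ * bracket m m 1 ^ ρ) := by
  have hm : 1 ≤ m := h1.trans h2
  have e1 : braidIncl (Nat.le_succ m) γ * bracket (m + 1) (m + 1) 1 ^ ρ =
      braidIncl (Nat.le_succ m) (γ * bracket m m 1 ^ (ρ - 1)) * sigma (m + 1) m *
        braidIncl (Nat.le_succ m) (bracket m m 1 * bracket m 1 ρ) := by
    rw [bracket_pow' (by omega) le_rfl h1 (by omega), bracket_succ_one hm, Nat.add_sub_cancel]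
    simp only [map_mul, map_pow, braidIncl_bracket' _ hm le_rfl, braidIncl_bracket _ h1 h2, mul_assoc]
  have e2 : bracket m 1 ρ * γ * bracket m m 1 ^ ρ =
      bracket m 1 ρ * (γ * bracket m m 1 ^ (ρ - 1) * bracket m m 1) := by
    rw [mul_assoc γ, ← pow_succ, Nat.sub_add_cancel h1, mul_assoc]
  rw [e1, e2]
  refine (sameClosure_mul_comm _ _).trans ?_
  rw [← mul_assoc, ← map_mul]
  refine (sameClosure_stab hm _).trans ?_
  rw [mul_assoc]
  refine (sameClosure_mul_comm _ _).trans ?_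
  rw [mul_assoc (bracket m 1 ρ)]
  exact SameClosure.refl _

theorem sameClosure_bracket_add (x : ℕ) {ρ : ℕ} (h1 : 1 ≤ ρ) (h2 : ρ ≤ m) (γ : BraidGroup m) :
    SameClosure (braidIncl (Nat.le_add_right m x) γ * bracket (m + x) 1 (m + x) ^ ρ)
      (γ * bracket m ρ 1 ^ x * bracket m 1 m ^ ρ) := by
  induction x generalizing γ with
  | zero =>
    rw [pow_zero, mul_one]
    have := braidIncl_self (Nat.le_add_right m 0) γ
    rw [this]
    exact SameClosure.refl _
  | succ x ih =>
    have h := sameClosure_bracket_succ (m := m + x) h1 (by omega)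
      (braidIncl (Nat.le_add_right m x) γ)
    -- The factor `[ρ,1]` left over by the reduction already lies in the image of the braid group on
    -- `m` strands, so it joins `γ` and the induction continues.
    rw [braidIncl_braidIncl, ← braidIncl_bracket' (Nat.le_add_right m x) h1 h2, ← map_mul] at h
    have h' := ih (γ * bracket m ρ 1)
    rw [mul_assoc γ, ← pow_succ'] at h'
    exact h.trans h'

theorem sameClosure_bracket_add' (x : ℕ) {ρ : ℕ} (h1 : 1 ≤ ρ) (h2 : ρ ≤ m) (γ : BraidGroup m) :
    SameClosure (braidIncl (Nat.le_add_right m x) γ * bracket (m + x) (m + x) 1 ^ ρ)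
      (γ * bracket m m 1 ^ ρ * bracket m 1 ρ ^ x) := by
  suffices H : SameClosure (braidIncl (Nat.le_add_right m x) γ * bracket (m + x) (m + x) 1 ^ ρ)
      (bracket m 1 ρ ^ x * γ * bracket m m 1 ^ ρ) by
    refine H.trans ?_
    rw [mul_assoc]
    exact sameClosure_mul_comm _ _
  induction x generalizing γ with
  | zero =>
    rw [pow_zero, one_mul]
    have := braidIncl_self (Nat.le_add_right m 0) γ
    rw [this]
    exact SameClosure.refl _
  | succ x ih =>
    have h := sameClosure_bracket_succ' (m := m + x) h1 (by omega)
      (braidIncl (Nat.le_add_right m x) γ)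
    rw [braidIncl_braidIncl, ← braidIncl_bracket (Nat.le_add_right m x) h1 h2, ← map_mul] at h
    have h' := ih (bracket m 1 ρ * γ)
    rw [← mul_assoc, ← pow_succ] at h'
    exact h.trans h'

theorem tBraid_pair (m y n ρ : ℕ) :
    tBraid [(m, y), (n, ρ)] = bracket n 1 m ^ y * bracket n 1 n ^ ρ := by
  change [bracket n 1 m ^ y, bracket n 1 n ^ ρ].prod = _
  simp

theorem sameClosure_tBraid_pair {ρ : ℕ} (y : ℕ) (h1 : 1 ≤ ρ) (h2 : ρ ≤ m) (h3 : m ≤ n) :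
    SameClosure (tBraid [(m, y), (n, ρ)])
      (bracket m 1 m ^ y * bracket m ρ 1 ^ (n - m) * bracket m 1 m ^ ρ) := by
  obtain ⟨x, rfl⟩ := Nat.exists_eq_add_of_le h3
  have := sameClosure_bracket_add x h1 h2 (bracket m 1 m ^ y)
  rw [map_pow, braidIncl_bracket _ (h1.trans h2) le_rfl] at this
  rw [Nat.add_sub_cancel_left, tBraid_pair]
  exact this

theorem sameClosure_tBraid_pair' {ρ : ℕ} (y : ℕ) (h1 : 1 ≤ ρ) (h2 : ρ ≤ m) (h3 : m ≤ n) :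
    SameClosure (tBraid [(m, y), (n, ρ)])
      (bracket m ρ 1 ^ (n - m) * bracket m 1 m ^ (ρ + y)) := by
  refine (sameClosure_tBraid_pair y h1 h2 h3).trans ?_
  rw [mul_assoc, pow_add, ← mul_assoc (bracket m ρ 1 ^ (n - m))]
  exact sameClosure_mul_comm _ _

/-- Reduction to `ρ` strands leaves `[1,2]^y [ρ,1]^{n-ρ}` times the full twist `[1,ρ]^ρ = [ρ,1]^ρ`,
hence `[1,2]^y [ρ,1]^n`. As `[1,2]` is `σ_1`, the braid of `exists_semiconj` conjugates this to
`[1,2]^y [1,ρ]^n`. -/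
theorem sameClosure_tBraid_swap {ρ : ℕ} (y : ℕ) (h1 : 2 ≤ ρ) (h2 : ρ ≤ n) :
    SameClosure (tBraid [(2, y), (n, ρ)]) (tBraid [(2, y), (ρ, n)]) := by
  obtain ⟨x, rfl⟩ := Nat.exists_eq_add_of_le h2
  have h := sameClosure_bracket_add x (by omega) le_rfl (bracket ρ 1 2 ^ y)
  rw [map_pow, braidIncl_bracket _ (by omega) h1, bracket_pow_self (by omega) le_rfl, mul_assoc,
    ← pow_add, add_comm x] at h
  rw [tBraid_pair, tBraid_pair]
  refine SameClosure.trans (β' := bracket ρ 1 2 ^ y * bracket ρ ρ 1 ^ (ρ + x)) h ?_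
  obtain ⟨g, hg1, hg2⟩ := exists_semiconj h1
  have h12 : bracket ρ 1 2 = sigma ρ 1 := by
    rw [bracket_one_succ le_rfl, bracket_one_one, one_mul]
  have hg : SemiconjBy g (bracket ρ 1 2 ^ y * bracket ρ ρ 1 ^ (ρ + x))
      (bracket ρ 1 2 ^ y * bracket ρ 1 ρ ^ (ρ + x)) := by
    rw [h12]
    exact (hg1.pow_right y).mul_right (hg2.pow_right _)
  have h3 := sameClosure_conj g (bracket ρ 1 2 ^ y * bracket ρ ρ 1 ^ (ρ + x))
  rw [hg.eq, mul_inv_cancel_right] at h3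
  exact h3.symm

/-- Since `m` divides `n - m`, the factor `[m,1]^{n-m}` is a power of the full twist and equals
`[1,m]^{n-m}`. -/
theorem sameClosure_tBraid_dvd (y : ℕ) (h1 : 1 ≤ m) (h2 : m ≤ n) (h3 : m ∣ n) :
    SameClosure (tBraid [(m, y), (n, m)]) (tBraid [(m, n + y)]) := by
  have h := sameClosure_tBraid_pair' y h1 le_rfl h2
  obtain ⟨c, hc⟩ := Nat.dvd_sub h3 (dvd_refl m)
  have e : bracket m m 1 ^ (n - m) = bracket m 1 m ^ (n - m) := by
    rw [hc, pow_mul, pow_mul, bracket_pow_self h1 le_rfl]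
  rw [e, ← pow_add, ← add_assoc, Nat.sub_add_cancel h2] at h
  have e2 : tBraid [(m, n + y)] = bracket m 1 m ^ (n + y) := by
    change [bracket m 1 m ^ (n + y)].prod = _
    simp
  rw [e2]
  exact h

end Reduction

theorem mainTheorem8 :
    -- the braid identities
    (∀ n d : ℕ, 2 ≤ n → 1 ≤ d → d ≤ n →
      bracket n 1 n ^ d = bracket n d 1 * bracket n 1 n * bracket n 1 (n - 1) ^ (d - 1) ∧
      bracket n n 1 ^ d = bracket n (n - 1) 1 ^ (d - 1) * bracket n n 1 * bracket n 1 d) ∧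
    -- reduction of the number of strands
    (∀ m x ρ : ℕ, 1 ≤ ρ → ρ ≤ m → 2 ≤ m + x → ∀ γ : BraidGroup m,
      SameClosure (braidIncl (Nat.le_add_right m x) γ * bracket (m + x) 1 (m + x) ^ ρ)
        (γ * bracket m ρ 1 ^ x * bracket m 1 m ^ ρ) ∧
      SameClosure (braidIncl (Nat.le_add_right m x) γ * bracket (m + x) (m + x) 1 ^ ρ)
        (γ * bracket m m 1 ^ ρ * bracket m 1 ρ ^ x)) ∧
    -- consequences for T-links
    (∀ m n ρ y : ℕ, 2 ≤ ρ → ρ ≤ m → m ≤ n → 1 ≤ y →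
      SameClosure (tBraid [(m, y), (n, ρ)])
        (bracket m ρ 1 ^ (n - m) * bracket m 1 m ^ (ρ + y))) ∧
    (∀ n ρ y : ℕ, 2 ≤ ρ → 2 ≤ n → 1 ≤ y →
      SameClosure (tBraid [(2, y), (n, ρ)]) (tBraid [(2, y), (ρ, n)])) ∧
    (∀ m n y : ℕ, 2 ≤ m → m < n → m ∣ n → 1 ≤ y →
      SameClosure (tBraid [(m, y), (n, m)]) (tBraid [(m, n + y)])) := by
  refine ⟨fun n d hn h1 h2 => ⟨bracket_pow hn le_rfl h1 h2, bracket_pow' hn le_rfl h1 h2⟩,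
    fun m x ρ h1 h2 _ γ => ⟨sameClosure_bracket_add x h1 h2 γ, sameClosure_bracket_add' x h1 h2 γ⟩,
    fun m n ρ y h1 h2 h3 _ => sameClosure_tBraid_pair' y (by omega) h2 h3,
    fun n ρ y h1 h2 _ => ?_,
    fun m n y h1 h2 h3 _ => sameClosure_tBraid_dvd y (by omega) h2.le h3⟩
  -- The claim is symmetric in `ρ` and `n`, and the reduction of strands requires the exponent to be
  -- at most the number of strands.
  rcases le_total ρ n with h | h
  · exact sameClosure_tBraid_swap y h1 h
  · exact (sameClosure_tBraid_swap y h2 h).symm
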